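/- **Theorem 4.2 (with Corollary 4.3).** An algebraic set means a reduced separated scheme of finite type over $\mathbb{C}$ (not necessarily irreducible). Let $E$ and $C$ be algebraic sets, with $C$ irreducible, and let $\pi: E\to C$ be a morphism over $\mathbb{C}$ whose generic fiber is finite, i.e. the fibers over the complex points of some nonempty Zariski open subset of $C$ are finite (a *well-posed enumerative problem*). Let $U\subset C$ be a Zariski open subset contained in the smooth locus of $C$ such that, in the classical topology, $V=\pi^{-1}(U)\to U$ is a covering on complex points, and let $z\in U$ be a complex point. Loops in $U$ based at $z$ permute the fiber $\pi^{-1}(z)$; these permutations form the *monodromy group*, and it is called *doubly transitive* if for all $x\ne y$ and $x'\neq y'$ in $\pi^{-1}(z)$ some element of it sends $x$ to $x'$ and $y$ to $y'$ (a condition that is vacuous if the fiber has at most one point). Let $$E_2=\{(x,y)\in E^2 : \pi(x)=\pi(y)\},\qquad V_2=\{(x,y)\in E_2 : \pi(x)\in U\},\qquad D=\{(x,x): x\in V\}\subset V_2 ,$$ with their Zariski topologies. Then: 1. The monodromy group is doubly transitive if and only if $V_2$ has at most one irreducible component different from $D$. 2. If $E_2$ has at most one irreducible component that is different from the closure of $D$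 in $E_2$ and has the same dimension as $D$, then the monodromy group is doubly transitive. -/

import Mathlib

open CategoryTheory CategoryTheory.Limits AlgebraicGeometry

namespace EnumerativeProblem

noncomputable section

/-- The one-point scheme `Spec ℂ`. -/
abbrev SpecC : Scheme.{0} := Spec (CommRingCat.of ℂ)

/-- A scheme over `ℂ` is a (not necessarily irreducible) complex algebraic set, in the abstract
sense: a reduced, separated scheme of finite type over `ℂ`. Closed and locally closed algebraic
subsets of affine space, of tori and of projective space are all examples. -/
structure IsAlgebraicSet {X : Scheme.{0}} (f : X ⟶ SpecC) : Prop where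
  isReduced : IsReduced X
  isSeparated : IsSeparated f
  locallyOfFiniteType : LocallyOfFiniteType f
  quasiCompact : QuasiCompact f

/-- The set `X(ℂ)` of complex points of a scheme `f : X ⟶ Spec ℂ`. -/
def ComplexPoints {X : Scheme.{0}} (f : X ⟶ SpecC) : Type :=
  {p : SpecC ⟶ X // p ≫ f = 𝟙 SpecC}

namespace ComplexPoints

variable {X Y : Scheme.{0}} {f : X ⟶ SpecC} {g : Y ⟶ SpecC}

/-- The point of the underlying space of `X` at which a complex point is located. -/
def point (p : ComplexPoints f) : X := p.1 (IsLocalRing.closedPoint ℂ)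

/-- The value `φ(p)` of a regular function `φ` on the open set `U` at a complex point `p` of `U`. -/
def eval (p : ComplexPoints f) (U : X.Opens) (h : ⊤ ≤ p.1 ⁻¹ᵁ U) (φ : Γ(X, U)) : ℂ :=
  (Scheme.ΓSpecIso (CommRingCat.of ℂ)).hom (p.1.appLE U ⊤ h φ)

/-- The classical (analytic) topology on `X(ℂ)`: the coarsest one in which every Zariski open set
is open and every regular function on a Zariski open set is continuous on it (with respect to the
usual topology of `ℂ`). -/
instance : TopologicalSpace (ComplexPoints f) :=
  TopologicalSpace.generateFrom
    {S | ∃ (U : X.Opens) (φ : Γ(X, U)) (W : Set ℂ), IsOpen W ∧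
      S = {p | ∃ h : ⊤ ≤ p.1 ⁻¹ᵁ U, p.eval U h φ ∈ W}}

/-- The map `X(ℂ) → Y(ℂ)` induced by a morphism of schemes over `ℂ`. -/
def map (π : X ⟶ Y) (hπ : π ≫ g = f) (p : ComplexPoints f) : ComplexPoints g :=
  ⟨p.1 ≫ π, by rw [Category.assoc, hπ, p.2]⟩

/-- The set `U(ℂ) ⊆ X(ℂ)` of complex points of a Zariski open set `U`. -/
def ofOpen (f : X ⟶ SpecC) (U : X.Opens) : Set (ComplexPoints f) := {p | p.point ∈ U}

end ComplexPoints

section Problem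

variable {E C : Scheme.{0}} {e : E ⟶ SpecC} {c : C ⟶ SpecC} (π : E ⟶ C) (hπ : π ≫ c = e)

/-- The enumerative problem `π : E ⟶ C` is well posed: the fiber over a generic point is finite. -/
def IsWellPosed : Prop :=
  ∃ W : C.Opens, (W : Set C).Nonempty ∧
    ∀ z ∈ ComplexPoints.ofOpen c W, (ComplexPoints.map π hπ ⁻¹' {z}).Finite

/-- The restriction `π⁻¹(U)(ℂ) → U(ℂ)` of `π` to the part over the Zariski open set `U`. -/
abbrev mapOver (U : C.Opens) :
    ComplexPoints.map π hπ ⁻¹' ComplexPoints.ofOpen c U → ComplexPoints.ofOpen c U :=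
  (ComplexPoints.ofOpen c U).restrictPreimage (ComplexPoints.map π hπ)

/-- `π` is a covering over `U`, in the classical topology. -/
def IsCoveringOver (U : C.Opens) : Prop := IsCoveringMap (mapOver π hπ U)

variable {π hπ}

/-- The monodromy group of the covering `π⁻¹(U)(ℂ) → U(ℂ)` at the base point `z`: the group of
permutations of the fiber over `z` induced by the loops in `U(ℂ)` based at `z`. -/
def monodromyGroup {U : C.Opens} (hU : IsCoveringOver π hπ U) (z : ComplexPoints.ofOpen c U) :
    Subgroup (Equiv.Perm (mapOver π hπ U ⁻¹' {z})) :=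
  (IsCoveringMap.monodromyPerm hU z).range

/-- The monodromy is doubly transitive: every ordered pair of distinct points of the fiber can be
moved to every other such pair. -/
def MonodromyDoublyTransitive {U : C.Opens} (hU : IsCoveringOver π hπ U)
    (z : ComplexPoints.ofOpen c U) : Prop :=
  MulAction.IsMultiplyPretransitive (monodromyGroup hU z) (mapOver π hπ U ⁻¹' {z}) 2

variable (π)

/-- The fiber square `E₂ = {(x, y) | π x = π y}`. -/
abbrev fiberSquare : Scheme.{0} := pullback π π

/-- The part `V₂ = π₂⁻¹(U)` of the fiber square over `U`, where `π₂ (x, y) = π x = π y`. -/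
def fiberSquareOver (U : C.Opens) : (fiberSquare π).Opens :=
  (pullback.fst π π ≫ π) ⁻¹ᵁ U

/-- The diagonal `D = {(x, x) | π x ∈ U}` of `V₂`, as a subset of `E₂`. -/
def diagonalOver (U : C.Opens) : Set (fiberSquare π) :=
  Set.range (pullback.diagonal π) ∩ fiberSquareOver π U

end Problem

end

end EnumerativeProblem

/-!
Both statements come from comparing two ways to cut the fiber square into pieces. The orbits of the
monodromy group on pairs of points of a fiber are the traces of the path components of `V₂(ℂ)`, the
fiber square of the covering, so double transitivity says that at most one such component is off the
diagonal, which is itself open and closed in `V₂(ℂ)`. These path components turn out to be the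
closures of the parts of the irreducible components of `V₂` over a small Zariski open subset `W` of
`C`, and this correspondence matches the diagonals.

The purely topological part is `isMultiplyPretransitive_monodromy_iff`: it suffices to have finitely
many closed pieces of the fiber square of a covering that become disjoint and connected over a dense
subset of the base which does not locally separate it (`LocallyNonseparating`). In this way neither
the smoothness of `V₂` as a scheme nor the local irreducibility of its components is needed.

Three geometric facts make it applicable. First, the base: a nonempty Zariski open subset of a smooth
irreducible variety is dense, does not locally separate, and is connected
(`dense_ofOpen_of_smooth`, `locallyNonseparating_ofOpen_of_smooth`,
`preconnectedSpace_ofOpen_of_smooth`). Second, the pieces: every irreducible variety has a nonempty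
open part whose open subsets are connected in the classical topology
(`exists_open_isPreconnected`). Both rest on charts that are standard étale over affine space, where
the connectedness is that of an irreducible hypersurface `f(x, t) = 0` away from a discriminant
(`isPreconnected_biEval_zeros`): on a piece `S` that is open and closed, the sums over the roots in
`S` of polynomials in `t` are, by Riemann's extension theorem and Liouville's theorem, rational functions
of `x`, so Lagrange interpolation yields a polynomial that separates `S` from the rest, and `f` being
prime forces `S` to be trivial.

Third, the components of `V₂` dominate `C`, since `V₂(ℂ) → U(ℂ)` is an open map
(`apply_eq_genericPoint_of_mem_genericPoints`). The generic fiber of `E₂ → C` being finite, it is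
discrete (`eq_of_specializes_of_isWellPosed`), so two components meet only over a proper closed
subset of `C`.

Finally, generic finiteness also shows that all irreducible subsets that dominate `C` have the same
dimension (`exists_topologicalKrullDim_closure_inter_eq`). Hence the closures in `E₂` of the
components of `V₂` have the dimension of the diagonal, and the second statement reduces to the first.
-/

namespace EnumerativeProblem

/-! ### Holomorphic dependence and growth of roots of polynomials -/

open Polynomial in
/-- The value `f(x, t)` of a polynomial `f(X, T)` in `n + 1` variables, seen as a polynomial in the
last variable `T`, at the point `p = (x, t)`. -/
noncomputable def biEval {n : ℕ} (p : (Fin n → ℂ) × ℂ) : (MvPolynomial (Fin n) ℂ)[X] →+* ℂ :=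
  eval₂RingHom (MvPolynomial.eval p.1) p.2

section BiEval

open Polynomial Topology Filter

variable {n : ℕ}

lemma biEval_C (p : (Fin n → ℂ) × ℂ) (c : MvPolynomial (Fin n) ℂ) :
    biEval p (C c) = MvPolynomial.eval p.1 c := by simp [biEval]

lemma biEval_X (p : (Fin n → ℂ) × ℂ) : biEval p X = p.2 := by simp [biEval]

lemma biEval_eq_sum (p : (Fin n → ℂ) × ℂ) (f : (MvPolynomial (Fin n) ℂ)[X]) :
    biEval p f = ∑ i ∈ Finset.range (f.natDegree + 1),
      MvPolynomial.eval p.1 (f.coeff i) * p.2 ^ i := by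
  simp [biEval, eval₂_eq_sum_range]

lemma biEval_eq_eval_map (x : Fin n → ℂ) (t : ℂ) (f : (MvPolynomial (Fin n) ℂ)[X]) :
    biEval (x, t) f = (f.map (MvPolynomial.eval x)).eval t := by
  simp [biEval, eval₂_eq_eval_map]

lemma contDiff_biEval (f : (MvPolynomial (Fin n) ℂ)[X]) :
    ContDiff ℂ 1 (fun p : (Fin n → ℂ) × ℂ => biEval p f) := by
  have h1 : ∀ q : MvPolynomial (Fin n) ℂ,
      ContDiff ℂ 1 (fun x : Fin n → ℂ => MvPolynomial.eval x q) := fun q =>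
    (AnalyticOnNhd.eval_mvPolynomial q).contDiff
  have h2 : (fun p : (Fin n → ℂ) × ℂ => biEval p f) = fun p => ∑ i ∈ Finset.range (f.natDegree + 1),
      MvPolynomial.eval p.1 (f.coeff i) * p.2 ^ i := by
    ext p; exact biEval_eq_sum p f
  rw [h2]
  exact ContDiff.sum fun i _ => ((h1 _).comp contDiff_fst).mul (contDiff_snd.pow i)

lemma continuous_biEval (f : (MvPolynomial (Fin n) ℂ)[X]) :
    Continuous (fun p : (Fin n → ℂ) × ℂ => biEval p f) := (contDiff_biEval f).continuous

/-- A simple root `t₀` of `f(x₀, T)` continues to a root `ψ(x)` of `f(x, T)` depending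
holomorphically on `x`, and near `(x₀, t₀)` there is no other root. -/
lemma exists_local_root (f : (MvPolynomial (Fin n) ℂ)[X]) (x₀ : Fin n → ℂ) (t₀ : ℂ)
    (h0 : biEval (x₀, t₀) f = 0) (h1 : biEval (x₀, t₀) (derivative f) ≠ 0) :
    ∃ ψ : (Fin n → ℂ) → ℂ, ψ x₀ = t₀ ∧ (∀ᶠ x in 𝓝 x₀, DifferentiableAt ℂ ψ x) ∧
      (∀ᶠ x in 𝓝 x₀, biEval (x, ψ x) f = 0) ∧
      ∀ᶠ p in 𝓝 (x₀, t₀), biEval p f = 0 ↔ ψ p.1 = p.2 := by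
  have cd : ContDiffAt ℂ 1 (fun p : (Fin n → ℂ) × ℂ => biEval p f) (x₀, t₀) :=
    (contDiff_biEval f).contDiffAt
  have hd : HasDerivAt (fun t => biEval (x₀, t) f) (biEval (x₀, t₀) (derivative f)) t₀ := by
    simp only [biEval_eq_eval_map, ← Polynomial.derivative_map]
    exact Polynomial.hasDerivAt _ _
  have hinv : (fderiv ℂ (fun p : (Fin n → ℂ) × ℂ => biEval p f) (x₀, t₀) ∘L
      .inr ℂ (Fin n → ℂ) ℂ).IsInvertible := by
    have hc : HasDerivAt (fun t => biEval (x₀, t) f)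
        ((fderiv ℂ (fun p : (Fin n → ℂ) × ℂ => biEval p f) (x₀, t₀)) (0, 1)) t₀ := by
      have := (cd.differentiableAt (by norm_num)).hasFDerivAt.comp_hasDerivAt t₀
        ((hasDerivAt_const t₀ x₀).prodMk (hasDerivAt_id t₀))
      exact this
    have he := hc.unique hd
    refine ⟨ContinuousLinearEquiv.unitsEquivAut ℂ (Units.mk0 _ h1), ?_⟩
    ext
    simp [he]
  refine ⟨cd.implicitFunction one_ne_zero hinv, cd.implicitFunction_apply_self one_ne_zero hinv,
    ?_, ?_, ?_⟩
  · have := (cd.contDiffAt_implicitFunction one_ne_zero hinv).eventually (by simp)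
    filter_upwards [this] with x hx using hx.differentiableAt (by norm_num)
  · have := cd.eventually_apply_implicitFunction one_ne_zero hinv
    simpa only [h0] using this
  · have := cd.eventually_apply_eq_iff_implicitFunction one_ne_zero hinv
    simpa only [h0] using this

/-- Growth of polynomials: `‖p(x)‖ ≤ C (1 + ‖x‖)^N`. -/
lemma exists_norm_eval_le (p : MvPolynomial (Fin n) ℂ) :
    ∃ (K : ℝ) (N : ℕ), 0 ≤ K ∧ ∀ x : Fin n → ℂ, ‖MvPolynomial.eval x p‖ ≤ K * (1 + ‖x‖) ^ N := by
  induction p using MvPolynomial.induction_on with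
  | C a => exact ⟨‖a‖, 0, norm_nonneg _, fun x => by simp⟩
  | add p q hp hq =>
    obtain ⟨K, N, hK, h⟩ := hp
    obtain ⟨K', N', hK', h'⟩ := hq
    refine ⟨K + K', N + N', by positivity, fun x => ?_⟩
    have h1 : (1 : ℝ) ≤ 1 + ‖x‖ := by linarith [norm_nonneg x]
    rw [map_add, add_mul]
    refine (norm_add_le _ _).trans (add_le_add ((h x).trans ?_) ((h' x).trans ?_))
    · gcongr; omega
    · gcongr; omega
  | mul_X p i hp =>
    obtain ⟨K, N, hK, h⟩ := hp
    refine ⟨K, N + 1, hK, fun x => ?_⟩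
    rw [map_mul, MvPolynomial.eval_X, norm_mul, pow_succ, ← mul_assoc]
    gcongr
    · exact h x
    · linarith [norm_le_pi_norm x i]

/-- The roots of a monic polynomial `f(x, T)` grow at most polynomially in `x`, and so do the values
of any polynomial at them. -/
lemma exists_norm_biEval_le (f : (MvPolynomial (Fin n) ℂ)[X]) (hf : f.Monic)
    (r : (MvPolynomial (Fin n) ℂ)[X]) :
    ∃ (K : ℝ) (N : ℕ), 0 ≤ K ∧ ∀ (x : Fin n → ℂ) (t : ℂ), biEval (x, t) f = 0 →
      ‖biEval (x, t) r‖ ≤ K * (1 + ‖x‖) ^ N := by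
  have hroot : ∃ (K : ℝ) (N : ℕ), 0 ≤ K ∧ ∀ (x : Fin n → ℂ) (t : ℂ), biEval (x, t) f = 0 →
      ‖t‖ ≤ K * (1 + ‖x‖) ^ N := by
    choose K N hK h using fun i => exists_norm_eval_le (f.coeff i)
    refine ⟨∑ i ∈ Finset.range f.natDegree, K i + 1, ∑ i ∈ Finset.range f.natDegree, N i,
      by have := Finset.sum_nonneg fun i (_ : i ∈ Finset.range f.natDegree) => hK i; positivity,
      fun x t hx => ?_⟩
    have h1 : (1 : ℝ) ≤ 1 + ‖x‖ := by linarith [norm_nonneg x]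
    have hm : (f.map (MvPolynomial.eval x)).Monic := hf.map _
    have hb := Polynomial.IsRoot.norm_lt_cauchyBound hm.ne_zero
      (a := t) (by rwa [biEval_eq_eval_map] at hx)
    have hb' : ‖t‖ < cauchyBound (f.map (MvPolynomial.eval x)) := hb
    refine hb'.le.trans ?_
    simp only [cauchyBound, hm.leadingCoeff, nnnorm_one, div_one, hf.natDegree_map]
    rw [add_mul, one_mul, NNReal.coe_add, NNReal.coe_one]
    refine add_le_add ?_ (one_le_pow₀ h1)
    have : ((Finset.range f.natDegree).sup fun i => ‖(f.map (MvPolynomial.eval x)).coeff i‖₊) ≤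
        ∑ i ∈ Finset.range f.natDegree, ‖(f.map (MvPolynomial.eval x)).coeff i‖₊ :=
      Finset.sup_le fun i hi => Finset.single_le_sum
        (f := fun i => ‖(f.map (MvPolynomial.eval x)).coeff i‖₊) (fun _ _ => zero_le) hi
    refine (NNReal.coe_le_coe.mpr this).trans ?_
    rw [NNReal.coe_sum, Finset.sum_mul]
    refine Finset.sum_le_sum fun i hi => ?_
    rw [coeff_map, coe_nnnorm]
    refine (h i x).trans ?_
    have := hK i
    gcongr
    exact Finset.single_le_sum (f := N) (fun _ _ => Nat.zero_le _) hi
  obtain ⟨K, N, hK, hKN⟩ := hroot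
  induction r using Polynomial.induction_on' with
  | add p q hp hq =>
    obtain ⟨K, N, hK, h⟩ := hp
    obtain ⟨K', N', hK', h'⟩ := hq
    refine ⟨K + K', N + N', by positivity, fun x t hx => ?_⟩
    have h1 : (1 : ℝ) ≤ 1 + ‖x‖ := by linarith [norm_nonneg x]
    rw [map_add, add_mul]
    refine (norm_add_le _ _).trans (add_le_add ((h x t hx).trans ?_) ((h' x t hx).trans ?_))
    · gcongr; omega
    · gcongr; omega
  | monomial i a =>
    obtain ⟨K', N', hK', h'⟩ := exists_norm_eval_le a
    refine ⟨K' * K ^ i, N' + N * i, by positivity, fun x t hx => ?_⟩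
    rw [← C_mul_X_pow_eq_monomial, map_mul, map_pow, biEval_C, biEval_X, norm_mul, norm_pow]
    calc _ ≤ (K' * (1 + ‖x‖) ^ N') * (K * (1 + ‖x‖) ^ N) ^ i := by
          gcongr
          · exact h' x
          · exact hKN x t hx
      _ = _ := by rw [mul_pow, ← pow_mul, pow_add]; ring

/-- Liouville: an entire function of polynomial growth is a polynomial. -/
lemma exists_polynomial_of_growth {F : ℂ → ℂ} (hF : Differentiable ℂ F) {K : ℝ} {N : ℕ}
    (hK : 0 ≤ K) (hb : ∀ s, ‖F s‖ ≤ K * (1 + ‖s‖) ^ N) :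
    ∃ q : ℂ[X], q.natDegree ≤ N ∧ ∀ s, F s = q.eval s := by
  have hz : ∀ k, N < k → iteratedDeriv k F 0 = 0 := by
    intro k hk
    -- Cauchy's estimate on the circle of radius `R`, as `R → ∞`
    have hest : ∀ R : ℝ, 1 ≤ R → ‖iteratedDeriv k F 0‖ ≤ k.factorial * K * 2 ^ N * R⁻¹ := by
      intro R hR
      have hR0 : 0 < R := by linarith
      have := Complex.norm_iteratedDeriv_le_of_forall_mem_sphere_norm_le (c := 0) (R := R)
        (C := K * (1 + R) ^ N) k hR0 hF.diffContOnCl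
        (fun z hz => by
          have : ‖z‖ = R := by simpa using hz
          rw [← this]; exact hb z)
      refine this.trans ?_
      rw [div_le_iff₀ (by positivity)]
      have h2 : (1 + R) ^ N ≤ 2 ^ N * R ^ N := by
        rw [← mul_pow]; gcongr; linarith
      have h3 : R ^ N ≤ R⁻¹ * R ^ k := by
        obtain ⟨j, rfl⟩ : ∃ j, k = j + 1 := ⟨k - 1, by omega⟩
        rw [pow_succ, mul_comm (R ^ j), ← mul_assoc, inv_mul_cancel₀ hR0.ne', one_mul]
        exact pow_le_pow_right₀ hR (by omega)
      calc (k.factorial : ℝ) * (K * (1 + R) ^ N) ≤ k.factorial * (K * (2 ^ N * (R⁻¹ * R ^ k))) := by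
            gcongr; exact h2.trans (by gcongr)
        _ = _ := by ring
    have hlim : Tendsto (fun R : ℝ => k.factorial * K * 2 ^ N * R⁻¹) atTop (𝓝 0) := by
      simpa using tendsto_inv_atTop_zero.const_mul (k.factorial * K * 2 ^ N : ℝ)
    have := ge_of_tendsto hlim (eventually_atTop.mpr ⟨1, hest⟩)
    exact norm_le_zero_iff.mp this
  refine ⟨∑ k ∈ Finset.range (N + 1), C ((k.factorial : ℂ)⁻¹ * iteratedDeriv k F 0) * X ^ k,
    ?_, fun s => ?_⟩
  · refine natDegree_sum_le_of_forall_le _ _ fun k hk => ?_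
    exact (natDegree_C_mul_X_pow_le _ _).trans (by simpa [Nat.lt_succ_iff] using hk)
  · rw [← Complex.taylorSeries_eq_of_entire' 0 s hF, tsum_eq_sum (s := Finset.range (N + 1))]
    · simp [eval_finsetSum]
    · intro k hk
      rw [hz k (by simpa [Nat.lt_succ_iff] using hk)]
      simp

/-- A function on `ℂⁿ` which is a polynomial of bounded degree on every line parallel to a
coordinate axis is a polynomial. -/
lemma exists_mvPolynomial_of_lines (N : ℕ) : ∀ {n : ℕ} (F : (Fin n → ℂ) → ℂ),
    (∀ x i, ∃ q : ℂ[X], q.natDegree ≤ N ∧ ∀ s, F (Function.update x i s) = q.eval s) →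
    ∃ P : MvPolynomial (Fin n) ℂ, ∀ x, F x = MvPolynomial.eval x P
  | 0, F, _ => ⟨MvPolynomial.C (F 0), fun x => by simp [Subsingleton.elim x 0]⟩
  | n + 1, F, h => by
    -- interpolate in the first variable at the nodes `0, …, N`
    have hnode : Set.InjOn (fun j : ℕ => (j : ℂ)) (Finset.range (N + 1) : Finset ℕ) :=
      fun a _ b _ hab => Nat.cast_injective hab
    have ih : ∀ j : ℕ, ∃ P : MvPolynomial (Fin n) ℂ, ∀ x,
        F (Fin.cons (j : ℂ) x) = MvPolynomial.eval x P := fun j => by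
      refine exists_mvPolynomial_of_lines N (fun x => F (Fin.cons (j : ℂ) x)) fun x i => ?_
      obtain ⟨q, hq, hqs⟩ := h (Fin.cons (j : ℂ) x) i.succ
      refine ⟨q, hq, fun s => ?_⟩
      rw [← hqs, Fin.cons_update]
    choose P hP using ih
    refine ⟨∑ j ∈ Finset.range (N + 1), MvPolynomial.rename Fin.succ (P j) *
      aeval (MvPolynomial.X 0) (Lagrange.basis (Finset.range (N + 1)) (fun j : ℕ => (j : ℂ)) j),
      fun x => ?_⟩
    obtain ⟨q, hq, hqs⟩ := h x 0
    have hcons : ∀ s, Function.update x 0 s = Fin.cons s (Fin.tail x) := fun s => by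
      rw [← Fin.cons_self_tail x, Fin.update_cons_zero, Fin.tail_cons]
    have hint : q = Lagrange.interpolate (Finset.range (N + 1)) (fun j : ℕ => (j : ℂ))
        (fun j => q.eval (j : ℂ)) :=
      Lagrange.eq_interpolate_of_eval_eq _ hnode
        (by
          rw [Finset.card_range]
          exact (degree_le_natDegree).trans_lt (by exact_mod_cast Nat.lt_succ_of_le hq))
        (fun _ _ => rfl)
    have hx : F x = q.eval (x 0) := by rw [← hqs, Function.update_eq_self]
    rw [hx, hint, Lagrange.interpolate_apply, eval_finsetSum, map_sum]
    refine Finset.sum_congr rfl fun j _ => ?_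
    rw [eval_mul, eval_C, ← hqs, hcons, hP, map_mul, MvPolynomial.eval_rename]
    congr 1
    have h2 : (MvPolynomial.eval x).comp (algebraMap ℂ (MvPolynomial (Fin (n + 1)) ℂ)) =
        RingHom.id ℂ := by ext a; simp
    rw [aeval_def, Polynomial.hom_eval₂, h2, MvPolynomial.eval_X]
    simp [eval₂_eq_eval_map]

end BiEval

/-! ### Connectedness of irreducible hypersurfaces -/

section RootSum

open Polynomial Topology Filter

variable {n : ℕ}

open Classical in
/-- The sum of the values `r(x, t)` of a polynomial `r` over the roots `t` of `f(x, T)` for which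
`(x, t)` lies in the set `S`. -/
noncomputable def rootSum (f : (MvPolynomial (Fin n) ℂ)[X]) (S : Set ((Fin n → ℂ) × ℂ))
    (r : (MvPolynomial (Fin n) ℂ)[X]) (x : Fin n → ℂ) : ℂ :=
  ∑ t ∈ (f.map (MvPolynomial.eval x)).roots.toFinset, if (x, t) ∈ S then biEval (x, t) r else 0

variable {f w u : (MvPolynomial (Fin n) ℂ)[X]} {c : MvPolynomial (Fin n) ℂ}

lemma mem_roots_map_iff (hf : f.Monic) {x : Fin n → ℂ} {t : ℂ} :
    t ∈ (f.map (MvPolynomial.eval x)).roots.toFinset ↔ biEval (x, t) f = 0 := by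
  rw [Multiset.mem_toFinset, mem_roots (hf.map _).ne_zero, biEval_eq_eval_map]; rfl

lemma biEval_derivative_ne_zero (hc : derivative f * w + f * u = C c) {x : Fin n → ℂ} {t : ℂ}
    (ht : biEval (x, t) f = 0) (hx : MvPolynomial.eval x c ≠ 0) :
    biEval (x, t) (derivative f) ≠ 0 := by
  intro h
  have := congrArg (biEval (x, t)) hc
  rw [map_add, map_mul, map_mul, ht, h, biEval_C] at this
  apply hx
  simpa using this.symm

/-- Away from the zeros of `c`, the polynomial `f(x, T)` has as many roots as its degree. -/
lemma card_roots_map (hf : f.Monic) (hc : derivative f * w + f * u = C c) {x : Fin n → ℂ}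
    (hx : MvPolynomial.eval x c ≠ 0) :
    (f.map (MvPolynomial.eval x)).roots.toFinset.card = f.natDegree := by
  have hsep : (f.map (MvPolynomial.eval x)).Separable := by
    refine ⟨C (MvPolynomial.eval x c)⁻¹ * u.map (MvPolynomial.eval x),
      C (MvPolynomial.eval x c)⁻¹ * w.map (MvPolynomial.eval x), ?_⟩
    have := congrArg (Polynomial.map (MvPolynomial.eval x)) hc
    rw [Polynomial.map_add, Polynomial.map_mul, Polynomial.map_mul, Polynomial.map_C,
      ← derivative_map] at this
    calc _ = C (MvPolynomial.eval x c)⁻¹ * (derivative (f.map (MvPolynomial.eval x)) *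
          w.map (MvPolynomial.eval x) + f.map (MvPolynomial.eval x) *
          u.map (MvPolynomial.eval x)) := by ring
      _ = 1 := by rw [this, ← C_mul, inv_mul_cancel₀ hx, C_1]
  rw [Multiset.toFinset_card_of_nodup (nodup_roots hsep),
    splits_iff_card_roots.mp (IsAlgClosed.splits _), hf.natDegree_map]

/-- If `S` is open and closed in the hypersurface `f = 0` away from the zeros of `c`, then the sum
over the roots in `S` is holomorphic there. -/
lemma differentiableAt_rootSum (hf : f.Monic) (hc : derivative f * w + f * u = C c)
    {S T : Set ((Fin n → ℂ) × ℂ)} (hS : IsOpen S) (hT : IsOpen T)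
    (hcov : {p : (Fin n → ℂ) × ℂ | biEval p f = 0 ∧ MvPolynomial.eval p.1 c ≠ 0} ⊆ S ∪ T)
    (hdisj : {p : (Fin n → ℂ) × ℂ | biEval p f = 0 ∧ MvPolynomial.eval p.1 c ≠ 0} ∩ (S ∩ T) = ∅)
    (r : (MvPolynomial (Fin n) ℂ)[X]) {x₀ : Fin n → ℂ} (hx₀ : MvPolynomial.eval x₀ c ≠ 0) :
    DifferentiableAt ℂ (rootSum f S r) x₀ := by
  classical
  set R₀ := (f.map (MvPolynomial.eval x₀)).roots.toFinset with hR₀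
  have hroot : ∀ t ∈ R₀, biEval (x₀, t) f = 0 := fun t ht => (mem_roots_map_iff hf).mp ht
  have hex := fun t : R₀ => exists_local_root f x₀ t (hroot t t.2)
    (biEval_derivative_ne_zero hc (hroot t t.2) hx₀)
  choose ψ hψ0 hψd hψr _ using hex
  have hψc : ∀ t, ContinuousAt (ψ t) x₀ := fun t => (hψd t).self_of_nhds.continuousAt
  have hpc : ∀ t, ContinuousAt (fun x => (x, ψ t x)) x₀ := fun t => continuousAt_id.prodMk (hψc t)
  have hcne : ∀ᶠ x in 𝓝 x₀, MvPolynomial.eval x c ≠ 0 :=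
    (MvPolynomial.continuous_eval c).continuousAt.eventually_ne hx₀
  have hinj : ∀ᶠ x in 𝓝 x₀, ∀ t t' : R₀, t ≠ t' → ψ t x ≠ ψ t' x := by
    simp only [eventually_all]
    intro t t' htt'
    refine ((hψc t).ne_iff_eventually_ne (hψc t')).mp ?_
    rw [hψ0, hψ0]
    exact fun h => htt' (Subtype.ext h)
  have hmem : ∀ᶠ x in 𝓝 x₀, ∀ t : R₀, (x, ψ t x) ∈ S ↔ (x₀, (t : ℂ)) ∈ S := by
    rw [eventually_all]
    intro t
    by_cases h : (x₀, (t : ℂ)) ∈ S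
    · filter_upwards [(hpc t).eventually_mem (hS.mem_nhds (by rw [hψ0]; exact h))] with x hx
      simp [hx, h]
    · have hT' : (x₀, (t : ℂ)) ∈ T := (hcov ⟨hroot t t.2, hx₀⟩).resolve_left h
      filter_upwards [(hpc t).eventually_mem (hT.mem_nhds (by rw [hψ0]; exact hT')), hcne,
        hψr t] with x hx hxc hxr
      simp only [h, iff_false]
      intro hxS
      exact (Set.eq_empty_iff_forall_notMem.mp hdisj) (x, ψ t x) ⟨⟨hxr, hxc⟩, hxS, hx⟩
  have heq : ∀ᶠ x in 𝓝 x₀, rootSum f S r x =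
      ∑ t : R₀, if (x₀, (t : ℂ)) ∈ S then biEval (x, ψ t x) r else 0 := by
    filter_upwards [hcne, hinj, hmem, eventually_all.mpr hψr] with x hxc hxi hxm hxr
    have hinj' : Function.Injective (fun t : R₀ => ψ t x) := fun t t' h => by
      by_contra hne; exact hxi t t' hne h
    have him : (f.map (MvPolynomial.eval x)).roots.toFinset =
        Finset.univ.image (fun t : R₀ => ψ t x) := by
      symm
      apply Finset.eq_of_subset_of_card_le
      · intro s hs
        obtain ⟨t, -, rfl⟩ := Finset.mem_image.mp hs
        exact (mem_roots_map_iff hf).mpr (hxr t)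
      · rw [Finset.card_image_of_injective _ hinj', card_roots_map hf hc hxc, Finset.card_univ,
          Fintype.card_coe, hR₀, card_roots_map hf hc hx₀]
    rw [rootSum, him, Finset.sum_image fun a _ b _ h => hinj' h]
    exact Finset.sum_congr rfl fun t _ => by simp only [hxm t]
  refine DifferentiableAt.congr_of_eventuallyEq ?_ heq
  refine DifferentiableAt.fun_sum fun t _ => ?_
  split_ifs
  · have := ((contDiff_biEval r).differentiable (by norm_num)).differentiableAt (x := (x₀, ψ t x₀))
    exact this.comp x₀ (differentiableAt_id.prodMk (hψd t).self_of_nhds)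
  · exact differentiableAt_const _

lemma exists_norm_rootSum_le (hf : f.Monic) (S : Set ((Fin n → ℂ) × ℂ))
    (r : (MvPolynomial (Fin n) ℂ)[X]) :
    ∃ (K : ℝ) (N : ℕ), 0 ≤ K ∧ ∀ x, ‖rootSum f S r x‖ ≤ K * (1 + ‖x‖) ^ N := by
  classical
  obtain ⟨K, N, hK, h⟩ := exists_norm_biEval_le f hf r
  refine ⟨f.natDegree * K, N, by positivity, fun x => ?_⟩
  rw [rootSum]
  refine (norm_sum_le_of_le _ (f := fun t => if (x, t) ∈ S then biEval (x, t) r else 0)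
    (n := fun _ => K * (1 + ‖x‖) ^ N) fun t ht => ?_).trans ?_
  · split_ifs
    · exact h x t ((mem_roots_map_iff hf).mp ht)
    · rw [norm_zero]; positivity
  · rw [Finset.sum_const, nsmul_eq_mul, mul_assoc]
    gcongr
    refine (Multiset.toFinset_card_le _).trans ((card_roots' _).trans ?_)
    exact natDegree_map_le

/-- The sum over the roots lying in an open and closed piece is a rational function with
denominator `c`: the product with `c` is entire, of polynomial growth, on each line parallel to a
coordinate axis. -/
lemma exists_mvPolynomial_rootSum (hf : f.Monic) (hc : derivative f * w + f * u = C c)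
    {S T : Set ((Fin n → ℂ) × ℂ)} (hS : IsOpen S) (hT : IsOpen T)
    (hcov : {p : (Fin n → ℂ) × ℂ | biEval p f = 0 ∧ MvPolynomial.eval p.1 c ≠ 0} ⊆ S ∪ T)
    (hdisj : {p : (Fin n → ℂ) × ℂ | biEval p f = 0 ∧ MvPolynomial.eval p.1 c ≠ 0} ∩ (S ∩ T) = ∅)
    (r : (MvPolynomial (Fin n) ℂ)[X]) :
    ∃ P : MvPolynomial (Fin n) ℂ, ∀ x,
      MvPolynomial.eval x c * rootSum f S r x = MvPolynomial.eval x P := by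
  obtain ⟨K₁, N₁, hK₁, h₁⟩ := exists_norm_eval_le c
  obtain ⟨K₂, N₂, hK₂, h₂⟩ := exists_norm_rootSum_le hf S r
  refine exists_mvPolynomial_of_lines (N₁ + N₂) _ fun x i => ?_
  have hupd : ∀ s, DifferentiableAt ℂ (fun s : ℂ => Function.update x i s) s := fun s =>
    (hasFDerivAt_update x s).differentiableAt
  have hnorm : ∀ s : ℂ, 1 + ‖Function.update x i s‖ ≤ (1 + ‖x‖) * (1 + ‖s‖) := by
    intro s
    have : ‖Function.update x i s‖ ≤ ‖x‖ + ‖s‖ := by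
      refine (pi_norm_le_iff_of_nonneg (by positivity)).mpr fun j => ?_
      by_cases hj : j = i
      · subst hj; simp
      · rw [Function.update_of_ne hj]; linarith [norm_le_pi_norm x j, norm_nonneg s]
    nlinarith [mul_nonneg (norm_nonneg x) (norm_nonneg s)]
  have hgrow₁ : ∀ s, ‖MvPolynomial.eval (Function.update x i s) c‖ ≤
      K₁ * ((1 + ‖x‖) * (1 + ‖s‖)) ^ N₁ := fun s => (h₁ _).trans (by gcongr; exact hnorm s)
  have hgrow₂ : ∀ s, ‖rootSum f S r (Function.update x i s)‖ ≤
      K₂ * ((1 + ‖x‖) * (1 + ‖s‖)) ^ N₂ := fun s => (h₂ _).trans (by gcongr; exact hnorm s)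
  refine exists_polynomial_of_growth (K := K₁ * (1 + ‖x‖) ^ N₁ * (K₂ * (1 + ‖x‖) ^ N₂)) ?_
    (by positivity) fun s => ?_
  · have hcan : AnalyticOnNhd ℂ (fun s : ℂ => MvPolynomial.eval (Function.update x i s) c)
        Set.univ := by
      refine Complex.analyticOnNhd_univ_iff_differentiable.mpr fun s => ?_
      exact ((AnalyticOnNhd.eval_mvPolynomial c) _ (Set.mem_univ _)).differentiableAt.comp s (hupd s)
    have hne : ∀ s, MvPolynomial.eval (Function.update x i s) c ≠ 0 →
        DifferentiableAt ℂ (fun s => MvPolynomial.eval (Function.update x i s) c *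
          rootSum f S r (Function.update x i s)) s := fun s hs =>
      (hcan s (Set.mem_univ _)).differentiableAt.mul
        ((differentiableAt_rootSum hf hc hS hT hcov hdisj r hs).comp s (hupd s))
    intro s
    by_cases hs : MvPolynomial.eval (Function.update x i s) c = 0
    · rcases (hcan s (Set.mem_univ _)).eventually_eq_zero_or_eventually_ne_zero with h | h
      · refine (differentiableAt_const (0 : ℂ)).congr_of_eventuallyEq ?_
        filter_upwards [h] with s' hs'
        rw [hs', zero_mul]
      · -- an isolated zero of `c` is a removable singularity, since the sum is locally bounded
        refine (Complex.analyticAt_of_differentiable_on_punctured_nhds_of_continuousAt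
          (h.mono hne) ?_).differentiableAt
        rw [ContinuousAt, hs, zero_mul]
        have hlim : Tendsto (fun s' : ℂ => ‖MvPolynomial.eval (Function.update x i s') c‖ *
            (K₂ * ((1 + ‖x‖) * (1 + ‖s'‖)) ^ N₂)) (𝓝 s) (𝓝 0) := by
          have h1 : ContinuousAt (fun s' : ℂ =>
            ‖MvPolynomial.eval (Function.update x i s') c‖ *
            (K₂ * ((1 + ‖x‖) * (1 + ‖s'‖)) ^ N₂)) s :=
            (hcan s (Set.mem_univ _)).continuousAt.norm.mul (by fun_prop)
          have h2 := h1.tendsto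
          simpa only [hs, norm_zero, zero_mul] using h2
        refine squeeze_zero_norm (fun s' => ?_) hlim
        rw [norm_mul]
        gcongr
        exact hgrow₂ s'
    · exact hne s hs
  · rw [norm_mul]
    refine (mul_le_mul (hgrow₁ s) (hgrow₂ s) (norm_nonneg _) (by positivity)).trans (le_of_eq ?_)
    rw [mul_pow, mul_pow, pow_add]; ring

/-- A polynomial vanishing at all points of the hypersurface `f = 0` away from the zeros of `c` is
divisible by `f`. -/
lemma dvd_of_biEval_eq_zero (hf : f.Monic) (hc : derivative f * w + f * u = C c) (hc0 : c ≠ 0)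
    (a : (MvPolynomial (Fin n) ℂ)[X])
    (ha : ∀ p : (Fin n → ℂ) × ℂ, biEval p f = 0 → MvPolynomial.eval p.1 c ≠ 0 → biEval p a = 0) :
    f ∣ a := by
  rw [← modByMonic_eq_zero_iff_dvd hf]
  have hzero : ∀ x, MvPolynomial.eval x c ≠ 0 → (a %ₘ f).map (MvPolynomial.eval x) = 0 := by
    intro x hx
    have hf1 : f.natDegree ≠ 0 ∨ f = 1 := by
      by_cases h : f.natDegree = 0
      · exact Or.inr (eq_one_of_monic_natDegree_zero hf h)
      · exact Or.inl h
    rcases hf1 with hd | rfl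
    · refine Polynomial.eq_zero_of_natDegree_lt_card_of_eval_eq_zero' _
        (f.map (MvPolynomial.eval x)).roots.toFinset (fun t ht => ?_) ?_
      · rw [mem_roots_map_iff hf] at ht
        have := ha (x, t) ht hx
        rw [← modByMonic_add_div a f, map_add, map_mul, ht, zero_mul, add_zero] at this
        rw [← biEval_eq_eval_map, this]
      · rw [card_roots_map hf hc hx]
        exact natDegree_map_le.trans_lt (natDegree_modByMonic_lt a hf
          (fun h => hd (by rw [h, natDegree_one])))
    · simp
  ext1 i
  have : c * (a %ₘ f).coeff i = 0 := by
    refine MvPolynomial.funext fun x => ?_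
    rw [map_mul, map_zero]
    by_cases hx : MvPolynomial.eval x c = 0
    · rw [hx, zero_mul]
    · have := congrArg (fun q => q.coeff i) (hzero x hx)
      simp only [coeff_map, coeff_zero] at this
      rw [this, mul_zero]
  rw [coeff_zero]
  exact (mul_eq_zero.mp this).resolve_left hc0

/-- An irreducible hypersurface `f = 0` that is étale over the complement of `c = 0` is connected
over this complement. For an open and closed piece `S`, the function which is `c²` on `S` and `0`
on the rest is given, by Lagrange's interpolation formula, by a polynomial `A`; as the prime `f`
divides `A (A - c²)`, one of the two pieces is empty. -/
theorem isPreconnected_biEval_zeros (hf : f.Monic) (hp : Prime f)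
    (hc : derivative f * w + f * u = C c) (hc0 : c ≠ 0) :
    IsPreconnected {p : (Fin n → ℂ) × ℂ | biEval p f = 0 ∧ MvPolynomial.eval p.1 c ≠ 0} := by
  classical
  rw [isPreconnected_iff_subset_of_disjoint]
  intro S T hS hT hcov hdisj
  choose P hP using fun i => exists_mvPolynomial_rootSum hf hc hS hT hcov hdisj
    (w * ∑ j ∈ Finset.Icc (i + 1) f.natDegree, X ^ (j - (i + 1)) * C (f.coeff j))
  set A : (MvPolynomial (Fin n) ℂ)[X] := ∑ i ∈ Finset.range f.natDegree, C (P i) * X ^ i with hA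
  have hAval : ∀ p : (Fin n → ℂ) × ℂ, biEval p f = 0 → MvPolynomial.eval p.1 c ≠ 0 →
      biEval p A = if p ∈ S then MvPolynomial.eval p.1 c ^ 2 else 0 := by
    rintro ⟨x, t⟩ ht hx
    set fx := f.map (MvPolynomial.eval x) with hfx
    have hfxm : fx.Monic := hf.map _
    have hdeg : fx.natDegree = f.natDegree := hf.natDegree_map _
    have hrt : fx.eval t = 0 := by rw [← biEval_eq_eval_map]; exact ht
    -- the interpolation polynomial, expanded in powers of `t`
    have hA1 : biEval (x, t) A = MvPolynomial.eval x c *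
        ∑ s ∈ fx.roots.toFinset, if (x, s) ∈ S then
          biEval (x, s) w * (fx /ₘ (X - C s)).eval t else 0 := by
      have hq : ∀ s, (fx /ₘ (X - C s)).eval t = ∑ i ∈ Finset.range f.natDegree,
          biEval (x, s) (∑ j ∈ Finset.Icc (i + 1) f.natDegree,
            X ^ (j - (i + 1)) * C (f.coeff j)) * t ^ i := by
        intro s
        by_cases hd : f.natDegree = 0
        · have : f = 1 := eq_one_of_monic_natDegree_zero hf hd
          exact absurd (this ▸ ht) (by simp)
        rw [eval_eq_sum_range' (n := f.natDegree)]
        · refine Finset.sum_congr rfl fun i _ => ?_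
          rw [coeff_divByMonic_X_sub_C, hdeg, map_sum]
          congr 1
          refine Finset.sum_congr rfl fun j _ => ?_
          rw [map_mul, map_pow, biEval_X, biEval_C, coeff_map]
        · rw [natDegree_divByMonic _ (monic_X_sub_C s), natDegree_X_sub_C, hdeg]
          omega
      rw [hA, map_sum]
      have : ∀ i ∈ Finset.range f.natDegree, biEval (x, t) (C (P i) * X ^ i) =
          MvPolynomial.eval x c * ∑ s ∈ fx.roots.toFinset, if (x, s) ∈ S then
            biEval (x, s) w * (biEval (x, s) (∑ j ∈ Finset.Icc (i + 1) f.natDegree,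
            X ^ (j - (i + 1)) * C (f.coeff j)) * t ^ i) else 0 := by
        intro i _
        rw [map_mul, map_pow, biEval_C, biEval_X, ← hP, rootSum, mul_assoc, Finset.sum_mul]
        congr 1
        refine Finset.sum_congr rfl fun s _ => ?_
        split_ifs
        · rw [map_mul, mul_assoc]
        · rw [zero_mul]
      rw [Finset.sum_congr rfl this, ← Finset.mul_sum, Finset.sum_comm]
      congr 1
      refine Finset.sum_congr rfl fun s _ => ?_
      split_ifs
      · rw [hq, Finset.mul_sum]
      · simp
    rw [hA1, Finset.sum_eq_single t]
    · have h1 : fx = (X - C t) * (fx /ₘ (X - C t)) := (mul_divByMonic_eq_iff_isRoot.mpr hrt).symm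
      have h2 : (fx /ₘ (X - C t)).eval t = biEval (x, t) (derivative f) := by
        rw [biEval_eq_eval_map, ← derivative_map, ← hfx]
        conv_rhs => rw [h1]
        simp
      have h3 : biEval (x, t) (derivative f) * biEval (x, t) w = MvPolynomial.eval x c := by
        have := congrArg (biEval (x, t)) hc
        rwa [map_add, map_mul, map_mul, ht, zero_mul, add_zero, biEval_C] at this
      rw [h2]
      split_ifs
      · rw [mul_comm (biEval (x, t) w), h3, sq]
      · rw [mul_zero]
    · intro s hs hst
      have hrs : fx.eval s = 0 := by
        rw [← biEval_eq_eval_map]; exact (mem_roots_map_iff hf).mp hs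
      have h1 : (X - C s) * (fx /ₘ (X - C s)) = fx := mul_divByMonic_eq_iff_isRoot.mpr hrs
      have h2 := congrArg (eval t) h1
      rw [eval_mul, hrt, eval_sub, eval_X, eval_C] at h2
      have h3 := (mul_eq_zero.mp h2).resolve_left (sub_ne_zero.mpr hst.symm)
      rw [h3, mul_zero, ite_self]
    · intro h
      exact absurd ((mem_roots_map_iff hf).mpr ht) h
  have hdvd : f ∣ A * (A - C (c ^ 2)) := by
    refine dvd_of_biEval_eq_zero hf hc hc0 _ fun p hp0 hpc => ?_
    rw [map_mul, map_sub, hAval p hp0 hpc, biEval_C, map_pow]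
    split_ifs <;> simp
  rcases hp.dvd_or_dvd hdvd with ⟨q, hq⟩ | ⟨q, hq⟩
  · right
    intro p hp
    refine (hcov hp).resolve_left fun hpS => ?_
    have h1 := hAval p hp.1 hp.2
    rw [hq, map_mul, hp.1, zero_mul, if_pos hpS] at h1
    exact hp.2 (pow_eq_zero_iff (by norm_num) |>.mp h1.symm)
  · left
    intro p hp
    by_contra hpS
    have h1 := hAval p hp.1 hp.2
    rw [if_neg hpS] at h1
    have h2 := congrArg (biEval p) hq
    rw [map_sub, h1, map_mul, hp.1, zero_mul, biEval_C, map_pow, zero_sub, neg_eq_zero] at h2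
    exact hp.2 (pow_eq_zero_iff (by norm_num) |>.mp h2)

end RootSum

/-! ### Connectedness of the complement of a holomorphic hypersurface -/

section Connected

open Topology Filter

/-- A dense subset of a connected set that does not locally separate it is connected. -/
lemma isPreconnected_of_locally {X : Type*} [TopologicalSpace X] {D S : Set X}
    (hD : IsPreconnected D) (hSD : S ⊆ D) (hdense : D ⊆ closure S)
    (hloc : ∀ b ∈ D, ∃ N ∈ 𝓝 b, IsPreconnected (N ∩ S)) : IsPreconnected S := by
  rw [isPreconnected_iff_subset_of_disjoint]
  intro u v hu hv huv hdisj
  -- near every point of `D`, the set `S` lies in one of the two pieces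
  have key : ∀ b ∈ D, (∃ N ∈ 𝓝 b, N ∩ S ⊆ u) ∨ ∃ N ∈ 𝓝 b, N ∩ S ⊆ v := by
    intro b hb
    obtain ⟨N, hN, hNc⟩ := hloc b hb
    have := isPreconnected_iff_subset_of_disjoint.mp hNc u v hu hv
      (Set.inter_subset_right.trans huv)
      (Set.subset_empty_iff.mp ((Set.inter_subset_inter_left _ Set.inter_subset_right).trans
        hdisj.subset))
    exact this.imp (fun h => ⟨N, hN, h⟩) fun h => ⟨N, hN, h⟩
  have hopen : ∀ w : Set X, IsOpen {b | ∃ N ∈ 𝓝 b, N ∩ S ⊆ w} := by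
    intro w
    rw [isOpen_iff_mem_nhds]
    rintro b ⟨N, hN, hNw⟩
    filter_upwards [eventually_mem_nhds_iff.mpr hN] with b' hb'
    exact ⟨N, hb', hNw⟩
  have h2 := isPreconnected_iff_subset_of_disjoint.mp hD _ _ (hopen u) (hopen v) key (by
    rw [Set.eq_empty_iff_forall_notMem]
    rintro b ⟨hb, ⟨N, hN, hNu⟩, N', hN', hNv⟩
    obtain ⟨s, hs, hsS⟩ := mem_closure_iff_nhds.mp (hdense hb) _ (Filter.inter_mem hN hN')
    exact (Set.eq_empty_iff_forall_notMem.mp hdisj) s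
      ⟨hsS, hNu ⟨hs.1, hsS⟩, hNv ⟨hs.2, hsS⟩⟩)
  refine h2.imp (fun h s hs => ?_) fun h s hs => ?_
  · obtain ⟨N, hN, hNu⟩ := h (hSD hs)
    exact hNu ⟨mem_of_mem_nhds hN, hs⟩
  · obtain ⟨N, hN, hNu⟩ := h (hSD hs)
    exact hNu ⟨mem_of_mem_nhds hN, hs⟩

lemma isPreconnected_ball_diff_center (c : ℂ) (r : ℝ) :
    IsPreconnected (Metric.ball c r \ {c}) := by
  rcases le_or_gt r 0 with hr | hr
  · rw [Metric.ball_eq_empty.mpr hr, Set.empty_sdiff]; exact isPreconnected_empty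
  -- the punctured disc is the image of a half plane under the exponential
  have : Metric.ball c r \ {c} = (fun w => c + Complex.exp w) '' {w | w.re < Real.log r} := by
    ext z
    constructor
    · rintro ⟨hz, hzc⟩
      have h0 : z - c ≠ 0 := sub_ne_zero.mpr hzc
      refine ⟨Complex.log (z - c), ?_, by simp [Complex.exp_log h0]⟩
      change (Complex.log (z - c)).re < _
      rw [Complex.log_re]
      exact Real.log_lt_log (norm_pos_iff.mpr h0) (by simpa [dist_eq_norm] using hz)
    · rintro ⟨w, hw, rfl⟩
      refine ⟨?_, by simp [Complex.exp_ne_zero]⟩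
      rw [Metric.mem_ball, dist_eq_norm, add_sub_cancel_left, Complex.norm_exp]
      exact (Real.lt_log_iff_exp_lt hr).mp hw
  rw [this]
  exact (convex_halfSpace_re_lt _).isPreconnected.image _
    (continuous_const.add Complex.continuous_exp).continuousOn

/-- The non-zero locus of a holomorphic function on a connected open subset of `ℂ` is connected. -/
lemma isPreconnected_ne_zero_of_differentiableOn {D : Set ℂ} (hD : IsOpen D)
    (hDc : IsPreconnected D) {h : ℂ → ℂ} (hh : DifferentiableOn ℂ h D) :
    IsPreconnected {s | s ∈ D ∧ h s ≠ 0} := by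
  have han : AnalyticOnNhd ℂ h D := hh.analyticOnNhd hD
  by_cases hzero : Set.EqOn h 0 D
  · convert isPreconnected_empty
    ext s
    simp only [Set.mem_ofPred_eq, Set.mem_empty_iff_false, iff_false, not_and, not_not]
    exact fun hs => hzero hs
  have hiso : ∀ b ∈ D, ∀ᶠ z in 𝓝[≠] b, h z ≠ 0 := by
    intro b hb
    rcases (han b hb).eventually_eq_zero_or_eventually_ne_zero with h0 | h0
    · exact absurd (han.eqOn_zero_of_preconnected_of_eventuallyEq_zero hDc hb h0) hzero
    · exact h0
  refine isPreconnected_of_locally hDc (fun s hs => hs.1) (fun b hb => ?_) fun b hb => ?_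
  · rw [mem_closure_iff_frequently]
    have h1 : ∀ᶠ z in 𝓝[≠] b, z ∈ D ∧ h z ≠ 0 :=
      (Filter.Eventually.filter_mono nhdsWithin_le_nhds (hD.mem_nhds hb)).and (hiso b hb)
    exact h1.frequently.filter_mono nhdsWithin_le_nhds
  · have h1 := hiso b hb
    rw [eventually_nhdsWithin_iff, Metric.eventually_nhds_iff_ball] at h1
    obtain ⟨ε, hε, h1⟩ := h1
    obtain ⟨δ, hδ, h2⟩ := Metric.isOpen_iff.mp hD b hb
    refine ⟨Metric.ball b (min ε δ), Metric.ball_mem_nhds _ (lt_min hε hδ), ?_⟩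
    have hsub : Metric.ball b (min ε δ) \ {b} ⊆ Metric.ball b (min ε δ) ∩ {s | s ∈ D ∧ h s ≠ 0} :=
      fun z hz => ⟨hz.1, h2 (Metric.ball_subset_ball (min_le_right _ _) hz.1),
        h1 z (Metric.ball_subset_ball (min_le_left _ _) hz.1) hz.2⟩
    by_cases hb0 : h b = 0
    · convert isPreconnected_ball_diff_center b (min ε δ) using 1
      refine subset_antisymm (fun z hz => ⟨hz.1, fun hzb => ?_⟩) hsub
      rw [Set.mem_singleton_iff] at hzb
      exact hz.2.2 (hzb ▸ hb0)
    · convert (convex_ball b (min ε δ)).isPreconnected using 1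
      refine subset_antisymm Set.inter_subset_left fun z hz => ?_
      by_cases hzb : z = b
      · subst hzb; exact ⟨hz, hb, hb0⟩
      · exact hsub ⟨hz, hzb⟩

/-- The non-zero locus of a holomorphic function on a convex open set is connected: any two of its
points lie on a complex line. -/
lemma isPreconnected_ne_zero_of_convex {E : Type*} [NormedAddCommGroup E] [NormedSpace ℂ E]
    {B : Set E} (hB : IsOpen B) (hconv : Convex ℝ B) {h : E → ℂ} (hh : DifferentiableOn ℂ h B) :
    IsPreconnected {x | x ∈ B ∧ h x ≠ 0} := by
  refine isPreconnected_of_forall_pair fun x hx y hy => ?_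
  set L : ℂ → E := fun s => x + s • (y - x) with hL
  have hLd : Differentiable ℂ L := by fun_prop
  have hDconv : Convex ℝ (L ⁻¹' B) := by
    intro s hs t ht a b ha hb hab
    have : L (a • s + b • t) = a • L s + b • L t := by
      simp only [hL, smul_add, add_smul, smul_assoc]
      rw [add_add_add_comm, ← add_smul, hab, one_smul]
    rw [Set.mem_preimage, this]
    exact hconv hs ht ha hb hab
  have := isPreconnected_ne_zero_of_differentiableOn (hB.preimage hLd.continuous)
    hDconv.isPreconnected (hh.comp hLd.differentiableOn fun s hs => hs)
  refine ⟨L '' _, ?_, ⟨0, ?_, by simp [hL]⟩, ⟨1, ?_, by simp [hL]⟩, this.image L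
    hLd.continuous.continuousOn⟩
  · rintro _ ⟨s, hs, rfl⟩; exact hs
  · simpa [hL] using hx
  · simpa [hL] using hy

end Connected

/-! ### Complex points of étale algebras over polynomial rings -/

section AlgPoints

open Topology Filter

/-- The classical topology on the set of complex points of an affine algebraic set, that is, of
algebra homomorphisms from its coordinate ring to `ℂ`: the topology of pointwise convergence. -/
noncomputable instance algHomTopologicalSpace {A : Type*} [CommRing A] [Algebra ℂ A] :
    TopologicalSpace (A →ₐ[ℂ] ℂ) :=
  TopologicalSpace.induced (fun φ a => φ a) inferInstance

variable {A B : Type*} [CommRing A] [Algebra ℂ A] [CommRing B] [Algebra ℂ B]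

lemma continuous_algHom_apply (a : A) : Continuous fun φ : A →ₐ[ℂ] ℂ => φ a :=
  (continuous_apply a).comp continuous_induced_dom

lemma continuousAt_to_algHom {X : Type*} [TopologicalSpace X] {g : X → A →ₐ[ℂ] ℂ} {x : X}
    (h : ∀ a, ContinuousAt (fun x => g x a) x) : ContinuousAt g x := by
  rw [(Topology.IsInducing.mk rfl : Topology.IsInducing
    (fun (φ : A →ₐ[ℂ] ℂ) (a : A) => φ a)).continuousAt_iff]
  exact continuousAt_pi.mpr h

lemma continuousOn_to_algHom {X : Type*} [TopologicalSpace X] {g : X → A →ₐ[ℂ] ℂ} {s : Set X}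
    (h : ∀ a, ContinuousOn (fun x => g x a) s) : ContinuousOn g s := by
  rw [(Topology.IsInducing.mk rfl : Topology.IsInducing
    (fun (φ : A →ₐ[ℂ] ℂ) (a : A) => φ a)).continuousOn_iff]
  exact continuousOn_pi.mpr h

lemma isOpen_algHom_ne_zero (a : A) : IsOpen {φ : A →ₐ[ℂ] ℂ | φ a ≠ 0} :=
  isOpen_ne_fun (continuous_algHom_apply a) continuous_const

end AlgPoints

section StandardEtale

open Topology Filter Polynomial

variable {n : ℕ} {A : Type*} [CommRing A] [Algebra ℂ A] [Algebra (MvPolynomial (Fin n) ℂ) A]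
  [IsScalarTower ℂ (MvPolynomial (Fin n) ℂ) A]

/-- The coordinates of a complex point, for an affine algebraic set over affine `n`-space. -/
noncomputable def coords (n : ℕ) {A : Type*} [CommRing A] [Algebra ℂ A]
    [Algebra (MvPolynomial (Fin n) ℂ) A] (φ : A →ₐ[ℂ] ℂ) : Fin n → ℂ :=
  fun i => φ (algebraMap (MvPolynomial (Fin n) ℂ) A (MvPolynomial.X i))

omit [IsScalarTower ℂ (MvPolynomial (Fin n) ℂ) A] in
lemma continuous_coords : Continuous (coords n : (A →ₐ[ℂ] ℂ) → Fin n → ℂ) :=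
  continuous_pi fun _ => continuous_algHom_apply _

lemma apply_algebraMap_eq_eval_coords (φ : A →ₐ[ℂ] ℂ) (p : MvPolynomial (Fin n) ℂ) :
    φ (algebraMap (MvPolynomial (Fin n) ℂ) A p) = MvPolynomial.eval (coords n φ) p := by
  have : φ.comp (IsScalarTower.toAlgHom ℂ (MvPolynomial (Fin n) ℂ) A) =
      MvPolynomial.aeval (coords n φ) := by
    ext i; simp [coords]
  have h := DFunLike.congr_fun this p
  simpa [MvPolynomial.aeval_eq_eval] using h

lemma apply_aeval_eq_biEval (φ : A →ₐ[ℂ] ℂ) (θ : A) (q : (MvPolynomial (Fin n) ℂ)[X]) :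
    φ (aeval θ q) = biEval (coords n φ, φ θ) q := by
  rw [aeval_eq_sum_range, biEval_eq_sum, map_sum]
  refine Finset.sum_congr rfl fun i _ => ?_
  rw [Algebra.smul_def, map_mul, map_pow, apply_algebraMap_eq_eval_coords]

/-- The complex points of a standard étale algebra `(R[T]/f)[1/g]` over a polynomial ring `R` are
the pairs `(x, t)` with `f(x, t) = 0` and `g(x, t) ≠ 0`. -/
lemma exists_algHom_of_biEval (P : StandardEtalePresentation (MvPolynomial (Fin n) ℂ) A)
    (p : (Fin n → ℂ) × ℂ) (hf : biEval p P.f = 0) (hg : biEval p P.g ≠ 0) :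
    ∃ φ : A →ₐ[ℂ] ℂ, coords n φ = p.1 ∧ φ P.x = p.2 := by
  let : Algebra (MvPolynomial (Fin n) ℂ) ℂ := (MvPolynomial.eval p.1).toAlgebra
  have halg : ∀ q, algebraMap (MvPolynomial (Fin n) ℂ) ℂ q = MvPolynomial.eval p.1 q := fun _ => rfl
  have : IsScalarTower ℂ (MvPolynomial (Fin n) ℂ) ℂ := .of_algebraMap_eq fun z => by
    rw [halg, MvPolynomial.algebraMap_eq, MvPolynomial.eval_C]; rfl
  have hev : ∀ q : (MvPolynomial (Fin n) ℂ)[X], aeval p.2 q = biEval p q := fun q => rfl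
  have hmap : P.HasMap p.2 := ⟨by rw [hev]; exact hf, by rw [hev]; exact hg.isUnit⟩
  refine ⟨((P.lift p.2 hmap).comp P.equivRing.toAlgHom).restrictScalars ℂ, ?_, ?_⟩
  · ext i
    change ((P.lift p.2 hmap).comp P.equivRing.toAlgHom) (algebraMap _ _ (MvPolynomial.X i)) = _
    rw [AlgHom.commutes, halg, MvPolynomial.eval_X]
  · change (P.lift p.2 hmap) (P.equivRing P.x) = _
    rw [StandardEtalePresentation.equivRing_x, StandardEtalePair.lift_X]

lemma biEval_f_eq_zero (P : StandardEtalePresentation (MvPolynomial (Fin n) ℂ) A) (φ : A →ₐ[ℂ] ℂ) :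
    biEval (coords n φ, φ P.x) P.f = 0 := by
  rw [← apply_aeval_eq_biEval, P.hasMap.1, map_zero]

lemma biEval_g_ne_zero (P : StandardEtalePresentation (MvPolynomial (Fin n) ℂ) A) (φ : A →ₐ[ℂ] ℂ) :
    biEval (coords n φ, φ P.x) P.g ≠ 0 := by
  rw [← apply_aeval_eq_biEval]
  exact (P.hasMap.2.map φ).ne_zero

lemma biEval_derivative_f_ne_zero (P : StandardEtalePresentation (MvPolynomial (Fin n) ℂ) A)
    (φ : A →ₐ[ℂ] ℂ) : biEval (coords n φ, φ P.x) (derivative P.f) ≠ 0 := by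
  rw [← apply_aeval_eq_biEval]
  exact (P.hasMap.isUnit_derivative_f.map φ).ne_zero

/-- Every element of a standard étale algebra is a quotient of two polynomials in the generator. -/
lemma exists_apply_eq_div (P : StandardEtalePresentation (MvPolynomial (Fin n) ℂ) A) (a : A) :
    ∃ (q : (MvPolynomial (Fin n) ℂ)[X]) (k : ℕ), ∀ φ : A →ₐ[ℂ] ℂ,
      φ a = biEval (coords n φ, φ P.x) q / biEval (coords n φ, φ P.x) P.g ^ k := by
  obtain ⟨q, k, h⟩ := P.exists_mul_aeval_x_g_pow_eq_aeval_x a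
  refine ⟨q, k, fun φ => ?_⟩
  rw [eq_div_iff (pow_ne_zero _ (biEval_g_ne_zero P φ)), ← apply_aeval_eq_biEval,
    ← apply_aeval_eq_biEval, ← h, map_mul, map_pow]

lemma algHom_ext_of_coords (P : StandardEtalePresentation (MvPolynomial (Fin n) ℂ) A)
    {φ φ' : A →ₐ[ℂ] ℂ} (h : coords n φ = coords n φ') (h' : φ P.x = φ' P.x) : φ = φ' := by
  ext a
  obtain ⟨q, k, hq⟩ := exists_apply_eq_div P a
  rw [hq, hq, h, h']

open Classical in
/-- The complex point of a standard étale algebra with given coordinates `(x, t)`. The value at a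
pair `(x, t)` that does not satisfy the equations is irrelevant. -/
noncomputable def pointOfCoords (P : StandardEtalePresentation (MvPolynomial (Fin n) ℂ) A)
    (φ₀ : A →ₐ[ℂ] ℂ) (p : (Fin n → ℂ) × ℂ) : A →ₐ[ℂ] ℂ :=
  if h : biEval p P.f = 0 ∧ biEval p P.g ≠ 0 then
    (exists_algHom_of_biEval P p h.1 h.2).choose else φ₀

lemma coords_pointOfCoords (P : StandardEtalePresentation (MvPolynomial (Fin n) ℂ) A)
    (φ₀ : A →ₐ[ℂ] ℂ) {p : (Fin n → ℂ) × ℂ} (hf : biEval p P.f = 0) (hg : biEval p P.g ≠ 0) :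
    coords n (pointOfCoords P φ₀ p) = p.1 ∧ pointOfCoords P φ₀ p P.x = p.2 := by
  rw [pointOfCoords, dif_pos ⟨hf, hg⟩]
  exact (exists_algHom_of_biEval P p hf hg).choose_spec

lemma pointOfCoords_coords (P : StandardEtalePresentation (MvPolynomial (Fin n) ℂ) A)
    (φ₀ φ : A →ₐ[ℂ] ℂ) : pointOfCoords P φ₀ (coords n φ, φ P.x) = φ := by
  have := coords_pointOfCoords P φ₀ (biEval_f_eq_zero P φ) (biEval_g_ne_zero P φ)
  exact algHom_ext_of_coords P this.1 this.2

/-- Local holomorphic charts on the complex points of an étale algebra over a polynomial ring. -/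
lemma exists_chart [Algebra.IsStandardEtale (MvPolynomial (Fin n) ℂ) A] (φ₀ : A →ₐ[ℂ] ℂ)
    {O : Set (A →ₐ[ℂ] ℂ)} (hO : O ∈ 𝓝 φ₀) :
    ∃ (r : ℝ) (σ : (Fin n → ℂ) → (A →ₐ[ℂ] ℂ)), 0 < r ∧ σ (coords n φ₀) = φ₀ ∧
      (∀ a, DifferentiableOn ℂ (fun x => σ x a) (Metric.ball (coords n φ₀) r)) ∧
      (∀ x ∈ Metric.ball (coords n φ₀) r, coords n (σ x) = x) ∧
      σ '' Metric.ball (coords n φ₀) r ⊆ O ∧ IsOpen (σ '' Metric.ball (coords n φ₀) r) := by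
  obtain ⟨P⟩ := Algebra.IsStandardEtale.nonempty_standardEtalePresentation
    (R := MvPolynomial (Fin n) ℂ) (S := A)
  set x₀ := coords n φ₀
  set t₀ := φ₀ P.x
  obtain ⟨ψ, hψ0, hψd, hψr, hψu⟩ := exists_local_root P.f x₀ t₀ (biEval_f_eq_zero P φ₀)
    (biEval_derivative_f_ne_zero P φ₀)
  set σ : (Fin n → ℂ) → (A →ₐ[ℂ] ℂ) := fun x => pointOfCoords P φ₀ (x, ψ x) with hσ
  have hψc : ContinuousAt ψ x₀ := hψd.self_of_nhds.continuousAt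
  have hσ0 : σ x₀ = φ₀ := by
    simp only [hσ, hψ0]; exact pointOfCoords_coords P φ₀ φ₀
  have hgne : ∀ᶠ x in 𝓝 x₀, biEval (x, ψ x) P.g ≠ 0 := by
    have : ContinuousAt (fun x => biEval (x, ψ x) P.g) x₀ :=
      (continuous_biEval P.g).continuousAt.comp (continuousAt_id.prodMk hψc)
    refine this.eventually_ne ?_
    rw [hψ0]; exact biEval_g_ne_zero P φ₀
  have hgood : ∀ᶠ x in 𝓝 x₀, coords n (σ x) = x ∧ σ x P.x = ψ x ∧
      ∀ a, DifferentiableAt ℂ (fun x => σ x a) x := by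
    filter_upwards [(hψr.and hgne).eventually_nhds, hψd] with x hx hxd
    have h1 : ∀ᶠ y in 𝓝 x, coords n (σ y) = y ∧ σ y P.x = ψ y := by
      filter_upwards [hx] with y hy using coords_pointOfCoords P φ₀ hy.1 hy.2
    refine ⟨h1.self_of_nhds.1, h1.self_of_nhds.2, fun a => ?_⟩
    obtain ⟨q, k, hq⟩ := exists_apply_eq_div P a
    have h2 : ∀ᶠ y in 𝓝 x, σ y a = biEval (y, ψ y) q / biEval (y, ψ y) P.g ^ k := by
      filter_upwards [h1] with y hy
      rw [hq, hy.1, hy.2]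
    refine DifferentiableAt.congr_of_eventuallyEq ?_ h2
    have hd : ∀ s, DifferentiableAt ℂ (fun y => biEval (y, ψ y) s) x := fun s =>
      DifferentiableAt.comp (g := fun p => biEval p s) x
        ((contDiff_biEval s).differentiable (by norm_num)).differentiableAt
        (differentiableAt_id.prodMk hxd)
    simp only [div_eq_mul_inv]
    exact (hd q).fun_mul (((hd P.g).fun_pow k).fun_inv (pow_ne_zero _ hx.self_of_nhds.2))
  have hσc : ContinuousAt σ x₀ :=
    continuousAt_to_algHom fun a => (hgood.self_of_nhds.2.2 a).continuousAt
  obtain ⟨δ, hδ, hδu⟩ := Metric.eventually_nhds_iff_ball.mp hψu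
  have hev : ∀ᶠ x in 𝓝 x₀, (coords n (σ x) = x ∧ σ x P.x = ψ x ∧
      ∀ a, DifferentiableAt ℂ (fun x => σ x a) x) ∧ ψ x ∈ Metric.ball t₀ δ ∧ σ x ∈ O ∧
      x ∈ Metric.ball x₀ δ :=
    hgood.and ((hψc.eventually_mem (by rw [hψ0]; exact Metric.ball_mem_nhds _ hδ)).and
      ((hσc.eventually_mem (by rw [hσ0]; exact hO)).and (Metric.ball_mem_nhds _ hδ)))
  obtain ⟨r, hr, hrb⟩ := Metric.eventually_nhds_iff_ball.mp hev
  refine ⟨r, σ, hr, hσ0, fun a x hx => ((hrb x hx).1.2.2 a).differentiableWithinAt,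
    fun x hx => (hrb x hx).1.1, ?_, ?_⟩
  · rintro _ ⟨x, hx, rfl⟩; exact (hrb x hx).2.2.1
  · have himg : σ '' Metric.ball x₀ r =
        coords n ⁻¹' Metric.ball x₀ r ∩ (fun φ => φ P.x) ⁻¹' Metric.ball t₀ δ := by
      ext φ
      constructor
      · rintro ⟨x, hx, rfl⟩
        obtain ⟨⟨h1, h2, -⟩, h3, -⟩ := hrb x hx
        exact ⟨by rw [Set.mem_preimage, h1]; exact hx, by
          rw [Set.mem_preimage, h2]; exact h3⟩
      · rintro ⟨h1, h2⟩
        refine ⟨coords n φ, h1, ?_⟩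
        have h3 : (coords n φ, φ P.x) ∈ Metric.ball (x₀, t₀) δ := by
          rw [← ball_prod_same]
          exact ⟨(hrb _ h1).2.2.2, h2⟩
        have h4 := (hδu _ h3).mp (biEval_f_eq_zero P φ)
        simp only [hσ]
        rw [show ψ (coords n φ) = φ P.x from h4, pointOfCoords_coords]
    rw [himg]
    exact (Metric.isOpen_ball.preimage continuous_coords).inter
      (Metric.isOpen_ball.preimage (continuous_algHom_apply _))

/-- A non-zero polynomial does not vanish at all points of a non-empty open set of points of an
étale algebra; in particular the polynomial ring embeds. -/
lemma exists_apply_ne_zero_of_mem_nhds [Algebra.IsStandardEtale (MvPolynomial (Fin n) ℂ) A]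
    (φ₀ : A →ₐ[ℂ] ℂ) {O : Set (A →ₐ[ℂ] ℂ)} (hO : O ∈ 𝓝 φ₀) {c : MvPolynomial (Fin n) ℂ}
    (hc : c ≠ 0) : ∃ φ ∈ O, φ (algebraMap _ A c) ≠ 0 := by
  by_contra! hcon
  obtain ⟨r, σ, hr, -, -, hσ, hσO, -⟩ := exists_chart (n := n) φ₀ hO
  apply hc
  refine MvPolynomial.funext_set (fun i => Metric.ball (coords n φ₀ i) r)
    (fun i => infinite_of_mem_nhds _ (Metric.ball_mem_nhds _ hr)) fun x hx => ?_
  have hx' : x ∈ Metric.ball (coords n φ₀) r := by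
    rw [ball_pi _ hr]; exact hx
  have := hcon (σ x) (hσO ⟨x, hx', rfl⟩)
  rwa [apply_algebraMap_eq_eval_coords, hσ x hx'] at this

lemma algebraMap_injective_of_point [Algebra.IsStandardEtale (MvPolynomial (Fin n) ℂ) A]
    (φ₀ : A →ₐ[ℂ] ℂ) : Function.Injective (algebraMap (MvPolynomial (Fin n) ℂ) A) := by
  rw [injective_iff_map_eq_zero]
  intro c hc
  by_contra h
  obtain ⟨φ, -, hφ⟩ := exists_apply_ne_zero_of_mem_nhds φ₀ Filter.univ_mem h
  rw [hc, map_zero] at hφ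
  exact hφ rfl

variable [IsDomain A]

omit [Algebra ℂ A] [IsScalarTower ℂ (MvPolynomial (Fin n) ℂ) A] in
lemma exists_polynomial_dvd [Algebra.IsStandardEtale (MvPolynomial (Fin n) ℂ) A] {a : A}
    (ha : a ≠ 0) : ∃ c : MvPolynomial (Fin n) ℂ, c ≠ 0 ∧ a ∣ algebraMap _ A c := by
  obtain ⟨P⟩ := Algebra.IsStandardEtale.nonempty_standardEtalePresentation
    (R := MvPolynomial (Fin n) ℂ) (S := A)
  obtain ⟨q, k, h⟩ := P.exists_mul_aeval_x_g_pow_eq_aeval_x a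
  have hint : IsIntegral (MvPolynomial (Fin n) ℂ) P.x := ⟨P.f, P.monic_f, P.hasMap.1⟩
  have hq : IsIntegral (MvPolynomial (Fin n) ℂ) (aeval P.x q) :=
    IsIntegral.of_mem_of_fg _ hint.fg_adjoin_singleton _ (aeval_mem_adjoin_singleton _ _)
  have hq0 : aeval P.x q ≠ 0 := by
    rw [← h]; exact mul_ne_zero ha (pow_ne_zero _ P.hasMap.2.ne_zero)
  obtain ⟨c, hc, hdvd⟩ := hq.isAlgebraic.exists_nonzero_dvd (mem_nonZeroDivisors_of_ne_zero hq0)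
  exact ⟨c, hc, (Dvd.intro _ h).trans hdvd⟩

/-- On a connected étale chart, the complement of a hypersurface is dense in the classical
topology. -/
lemma dense_algHom_ne_zero (n : ℕ) [Algebra (MvPolynomial (Fin n) ℂ) A]
    [IsScalarTower ℂ (MvPolynomial (Fin n) ℂ) A]
    [Algebra.IsStandardEtale (MvPolynomial (Fin n) ℂ) A] {a : A} (ha : a ≠ 0) :
    Dense {φ : A →ₐ[ℂ] ℂ | φ a ≠ 0} := by
  intro φ₀
  rw [mem_closure_iff_nhds]
  intro O hO
  obtain ⟨c, hc, b, hb⟩ := exists_polynomial_dvd (n := n) ha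
  obtain ⟨φ, hφO, hφ⟩ := exists_apply_ne_zero_of_mem_nhds φ₀ hO hc
  rw [hb, map_mul] at hφ
  exact ⟨φ, hφO, left_ne_zero_of_mul hφ⟩

omit [IsDomain A] in
/-- Points of an étale chart have arbitrarily small open path connected neighbourhoods that are not
disconnected by any hypersurface. -/
lemma exists_nhd_algHom (n : ℕ) [Algebra (MvPolynomial (Fin n) ℂ) A]
    [IsScalarTower ℂ (MvPolynomial (Fin n) ℂ) A]
    [Algebra.IsStandardEtale (MvPolynomial (Fin n) ℂ) A] (φ₀ : A →ₐ[ℂ] ℂ)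
    {O : Set (A →ₐ[ℂ] ℂ)} (hO : O ∈ 𝓝 φ₀) :
    ∃ N ⊆ O, IsOpen N ∧ φ₀ ∈ N ∧ IsPathConnected N ∧
      ∀ a, IsPreconnected (N ∩ {φ : A →ₐ[ℂ] ℂ | φ a ≠ 0}) := by
  obtain ⟨r, σ, hr, hσ0, hσd, hσ, hσO, hσo⟩ := exists_chart (n := n) φ₀ hO
  have hσc : ContinuousOn σ (Metric.ball (coords n φ₀) r) :=
    continuousOn_to_algHom fun a => (hσd a).continuousOn
  have hconv : Convex ℝ (Metric.ball (coords n φ₀) r) := convex_ball _ _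
  refine ⟨_, hσO, hσo, ⟨_, Metric.mem_ball_self hr, hσ0⟩,
    (hconv.isPathConnected ⟨_, Metric.mem_ball_self hr⟩).image' hσc, fun a => ?_⟩
  have h1 := isPreconnected_ne_zero_of_convex Metric.isOpen_ball hconv (hσd a)
  have h2 : σ '' Metric.ball (coords n φ₀) r ∩ {φ : A →ₐ[ℂ] ℂ | φ a ≠ 0} =
      σ '' {x | x ∈ Metric.ball (coords n φ₀) r ∧ σ x a ≠ 0} := by
    ext φ
    constructor
    · rintro ⟨⟨x, hx, rfl⟩, hφ⟩; exact ⟨x, ⟨hx, hφ⟩, rfl⟩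
    · rintro ⟨x, ⟨hx, hφ⟩, rfl⟩; exact ⟨⟨x, hx, rfl⟩, hφ⟩
  rw [h2]
  exact h1.image σ (hσc.mono fun x hx => hx.1)

/-- The complement of a hypersurface in an irreducible étale chart is connected. The chart is
birational to an irreducible hypersurface `f₁ = 0`, where `f₁` is the minimal polynomial of the
generator, and a suitable dense open subset of it is connected by `isPreconnected_biEval_zeros`. -/
lemma isPreconnected_algHom_ne_zero (n : ℕ) [Algebra (MvPolynomial (Fin n) ℂ) A]
    [IsScalarTower ℂ (MvPolynomial (Fin n) ℂ) A]
    [Algebra.IsStandardEtale (MvPolynomial (Fin n) ℂ) A] (a : A) :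
    IsPreconnected {φ : A →ₐ[ℂ] ℂ | φ a ≠ 0} := by
  rcases isEmpty_or_nonempty (A →ₐ[ℂ] ℂ) with hemp | ⟨⟨φ₀⟩⟩
  · convert isPreconnected_empty
    exact Set.eq_empty_of_isEmpty _
  by_cases ha : a = 0
  · convert isPreconnected_empty
    simp [ha]
  obtain ⟨P⟩ := Algebra.IsStandardEtale.nonempty_standardEtalePresentation
    (R := MvPolynomial (Fin n) ℂ) (S := A)
  have hinj := algebraMap_injective_of_point (n := n) φ₀
  have : Module.IsTorsionFree (MvPolynomial (Fin n) ℂ) A :=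
    Module.isTorsionFree_iff_algebraMap_injective.mpr hinj
  have hint : IsIntegral (MvPolynomial (Fin n) ℂ) P.x := ⟨P.f, P.monic_f, P.hasMap.1⟩
  set f₁ := minpoly (MvPolynomial (Fin n) ℂ) P.x with hf₁
  have hmon : f₁.Monic := minpoly.monic hint
  have hprime : Prime f₁ := minpoly.prime_of_isIntegrallyClosed hint
  obtain ⟨h, hfh⟩ : f₁ ∣ P.f := minpoly.isIntegrallyClosed_dvd hint P.hasMap.1
  obtain ⟨q, k, hq⟩ := P.exists_mul_aeval_x_g_pow_eq_aeval_x a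
  have hder : aeval P.x (derivative f₁) ≠ 0 := by
    have h1 := P.hasMap.isUnit_derivative_f.ne_zero
    rw [hfh, derivative_mul, map_add, map_mul, map_mul, minpoly.aeval, zero_mul, add_zero] at h1
    exact left_ne_zero_of_mul h1
  set m := derivative f₁ * (P.g * q) with hm
  have hm0 : aeval P.x m ≠ 0 := by
    rw [hm, map_mul, map_mul, ← hq]
    exact mul_ne_zero hder (mul_ne_zero P.hasMap.2.ne_zero
      (mul_ne_zero ha (pow_ne_zero _ P.hasMap.2.ne_zero)))
  -- a polynomial `c` in the base variables is a combination of `m` and `f₁`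
  obtain ⟨c, hc0, w, u, hc⟩ : ∃ c : MvPolynomial (Fin n) ℂ, c ≠ 0 ∧
      ∃ w u, m * w + f₁ * u = C c := by
    have : IsDomain (AdjoinRoot f₁) := AdjoinRoot.isDomain_of_prime hprime
    have : Module.Finite (MvPolynomial (Fin n) ℂ) (AdjoinRoot f₁) := hmon.finite_adjoinRoot
    have hm1 : AdjoinRoot.mk f₁ m ≠ 0 := by
      rw [Ne, AdjoinRoot.mk_eq_zero]
      rintro ⟨u, hu⟩
      rw [hu, map_mul, minpoly.aeval, zero_mul] at hm0
      exact hm0 rfl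
    obtain ⟨c, hc, s, hs⟩ := (IsIntegral.of_finite (MvPolynomial (Fin n) ℂ)
      (AdjoinRoot.mk f₁ m)).isAlgebraic.exists_nonzero_dvd (mem_nonZeroDivisors_of_ne_zero hm1)
    obtain ⟨w, rfl⟩ := AdjoinRoot.mk_surjective s
    rw [AdjoinRoot.algebraMap_eq, ← AdjoinRoot.mk_C, ← map_mul, AdjoinRoot.mk_eq_mk] at hs
    obtain ⟨u, hu⟩ := hs
    exact ⟨c, hc, w, u, by rw [← hu]; ring⟩
  have hconn := isPreconnected_biEval_zeros (w := P.g * q * w) (u := u) hmon hprime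
    (by rw [← hc, hm]; ring) hc0
  set S := {p : (Fin n → ℂ) × ℂ | biEval p f₁ = 0 ∧ MvPolynomial.eval p.1 c ≠ 0}
  have hS : ∀ p ∈ S, biEval p P.f = 0 ∧ biEval p P.g ≠ 0 := by
    rintro p ⟨hp1, hp2⟩
    refine ⟨by rw [hfh, map_mul, hp1, zero_mul], fun h0 => hp2 ?_⟩
    rw [← biEval_C, ← hc, hm, map_add, map_mul, map_mul, map_mul, map_mul, h0, hp1]
    simp
  have himg : pointOfCoords P φ₀ '' S = {φ : A →ₐ[ℂ] ℂ | φ (algebraMap _ A c) ≠ 0} := by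
    ext φ
    constructor
    · rintro ⟨p, hp, rfl⟩
      have := coords_pointOfCoords P φ₀ (hS p hp).1 (hS p hp).2
      change pointOfCoords P φ₀ p _ ≠ 0
      rw [apply_algebraMap_eq_eval_coords, this.1]
      exact hp.2
    · intro hφ
      refine ⟨(coords n φ, φ P.x), ⟨?_, ?_⟩, pointOfCoords_coords P φ₀ φ⟩
      · rw [← apply_aeval_eq_biEval, minpoly.aeval, map_zero]
      · rw [← apply_algebraMap_eq_eval_coords]; exact hφ
  have hcont : ContinuousOn (pointOfCoords P φ₀) S := by
    refine continuousOn_to_algHom fun b => ?_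
    obtain ⟨s, j, hs⟩ := exists_apply_eq_div P b
    have h1 : ContinuousOn (fun p => biEval p s / biEval p P.g ^ j) S :=
      (continuous_biEval s).continuousOn.div ((continuous_biEval P.g).pow j).continuousOn
        fun p hp => pow_ne_zero _ (hS p hp).2
    refine h1.congr fun p hp => ?_
    have := coords_pointOfCoords P φ₀ (hS p hp).1 (hS p hp).2
    change pointOfCoords P φ₀ p b = _
    rw [hs, this.1, this.2]
  have hpre := hconn.image _ hcont
  rw [himg] at hpre
  refine hpre.subset_closure (fun φ hφ hφa => hφ ?_) fun φ _ => ?_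
  · have h1 : aeval P.x m * aeval P.x w = algebraMap (MvPolynomial (Fin n) ℂ) A c := by
      have := congrArg (aeval P.x) hc
      rwa [map_add, map_mul (aeval P.x) m, map_mul (aeval P.x) f₁, minpoly.aeval, zero_mul, add_zero,
        aeval_C] at this
    rw [← h1, hm, map_mul (aeval P.x), map_mul (aeval P.x) P.g, ← hq]
    simp [hφa]
  · exact dense_algHom_ne_zero n (by rwa [Ne, map_eq_zero_iff _ hinj]) φ

end StandardEtale

/-! ### Monodromy and the fiber square of a covering -/

section Covering

open Topology Filter

variable {X B : Type*} [TopologicalSpace X] [TopologicalSpace B] {p : X → B}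

/-- `B₀` does not locally separate `B`: every point of `B` has arbitrarily small path connected
open neighbourhoods whose intersection with `B₀` is connected. -/
def LocallyNonseparating (B₀ : Set B) : Prop :=
  ∀ b : B, ∀ O ∈ 𝓝 b, ∃ N ⊆ O, IsOpen N ∧ b ∈ N ∧ IsPathConnected N ∧ IsPreconnected (N ∩ B₀)

/-- The part over `B₀` of the fiber square of `p : X → B`. -/
def pullbackOver (p : X → B) (B₀ : Set B) : Set (p.Pullback p) := {q | p q.1.1 ∈ B₀}

/-- The diagonal of the fiber square of `p : X → B`. -/
def pullbackDiag (p : X → B) : Set (p.Pullback p) := {q | q.1.1 = q.1.2}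

lemma isClopen_joined {Y : Type*} [TopologicalSpace Y]
    (h : ∀ y : Y, ∃ M, IsOpen M ∧ y ∈ M ∧ IsPathConnected M) (y : Y) :
    IsClopen {y' | Joined y y'} := by
  constructor
  · rw [← isOpen_compl_iff, isOpen_iff_mem_nhds]
    intro q' hq'
    obtain ⟨M, hMo, hqM, hM⟩ := h q'
    filter_upwards [hMo.mem_nhds hqM] with q'' hq'' hcon
    exact hq' (hcon.trans (hM.joinedIn q' hqM q'' hq'').joined.symm)
  · rw [isOpen_iff_mem_nhds]
    intro q' hq'
    obtain ⟨M, hMo, hqM, hM⟩ := h q'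
    filter_upwards [hMo.mem_nhds hqM] with q'' hq''
    exact Joined.trans hq' (hM.joinedIn q' hqM q'' hq'').joined

/-- Small neighbourhoods in the fiber square of a covering are homeomorphic to neighbourhoods in the
base. -/
lemma LocallyNonseparating.exists_nhd_pullback {B₀ : Set B} (hB : LocallyNonseparating B₀)
    (cov : IsCoveringMap p) (q : p.Pullback p) {O : Set (p.Pullback p)} (hO : O ∈ 𝓝 q) :
    ∃ M ⊆ O, IsOpen M ∧ q ∈ M ∧ IsPathConnected M ∧ IsPreconnected (M ∩ pullbackOver p B₀) := by
  have hloc := cov.isLocalHomeomorph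
  set e₁ := hloc.localInverseAt q.1.1 with he₁
  set e₂ := hloc.localInverseAt q.1.2 with he₂
  have hs₁ : ∀ x, e₁.symm x = p x := fun x => by rw [he₁, hloc.localInverseAt_symm]
  have hs₂ : ∀ x, e₂.symm x = p x := fun x => by rw [he₂, hloc.localInverseAt_symm]
  have hb₁ : p q.1.1 ∈ e₁.source := hloc.apply_self_mem_localInverseAt_source
  have hb₂ : p q.1.1 ∈ e₂.source := by
    rw [q.2]; exact hloc.apply_self_mem_localInverseAt_source
  set G : B → X × X := fun b => (e₁ b, e₂ b) with hG
  have hG0 : G (p q.1.1) = q.1 := by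
    refine Prod.ext ?_ ?_
    · exact hloc.localInverseAt_apply_self
    · change e₂ (p q.1.1) = _
      rw [q.2]; exact hloc.localInverseAt_apply_self
  have hGc : ContinuousOn G (e₁.source ∩ e₂.source) :=
    (e₁.continuousOn.mono Set.inter_subset_left).prodMk (e₂.continuousOn.mono Set.inter_subset_right)
  have hsrc : e₁.source ∩ e₂.source ∈ 𝓝 (p q.1.1) :=
    (e₁.open_source.inter e₂.open_source).mem_nhds ⟨hb₁, hb₂⟩
  obtain ⟨O', hO', hOO'⟩ := mem_nhds_subtype _ _ _ |>.mp hO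
  have hGO : G ⁻¹' O' ∈ 𝓝 (p q.1.1) :=
    (hGc.continuousAt hsrc).preimage_mem_nhds (by rw [hG0]; exact hO')
  obtain ⟨N, hNO, hNo, hbN, hNp, hNc⟩ := hB _ _ (Filter.inter_mem hsrc hGO)
  set M : Set (p.Pullback p) :=
    {q' | p q'.1.1 ∈ N ∧ q'.1.1 ∈ e₁.target ∧ q'.1.2 ∈ e₂.target} with hM
  have hmem : ∀ q' ∈ M, G (p q'.1.1) = q'.1 := by
    rintro q' ⟨-, h1, h2⟩
    refine Prod.ext ?_ ?_
    · change e₁ (p q'.1.1) = _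
      rw [← hs₁, e₁.right_inv h1]
    · change e₂ (p q'.1.1) = _
      rw [q'.2, ← hs₂, e₂.right_inv h2]
  have himg : ∀ S ⊆ N, Subtype.val '' {q' ∈ M | p q'.1.1 ∈ S} = G '' S := by
    intro S hS
    ext y
    constructor
    · rintro ⟨q', ⟨hq', hqS⟩, rfl⟩
      exact ⟨_, hqS, hmem q' hq'⟩
    · rintro ⟨b, hb, rfl⟩
      have hbs := (hNO (hS hb)).1
      have h1 : p (e₁ b) = b := by rw [← hs₁, e₁.left_inv hbs.1]
      have h2 : p (e₂ b) = b := by rw [← hs₂, e₂.left_inv hbs.2]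
      refine ⟨⟨G b, h1.trans h2.symm⟩, ⟨⟨?_, e₁.map_source hbs.1, e₂.map_source hbs.2⟩, ?_⟩, rfl⟩
      · change p (e₁ b) ∈ N; rw [h1]; exact hS hb
      · change p (e₁ b) ∈ S; rw [h1]; exact hb
  have hMN : {q' ∈ M | p q'.1.1 ∈ N} = M := Set.sep_eq_self_iff_mem_true.mpr fun q' h => h.1
  have hcont : Continuous fun q' : p.Pullback p => p q'.1.1 :=
    cov.continuous.comp (continuous_fst.comp continuous_subtype_val)
  have hind : IsInducing (Subtype.val : p.Pullback p → X × X) := IsInducing.subtypeVal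
  refine ⟨M, fun q' hq' => hOO' ?_, ?_, ⟨hbN, ?_, ?_⟩, ?_, ?_⟩
  · have := (hNO hq'.1).2
    rw [Set.mem_preimage, hmem q' hq'] at this
    exact this
  · exact (hNo.preimage hcont).inter
      ((e₁.open_target.preimage (continuous_fst.comp continuous_subtype_val)).inter
        (e₂.open_target.preimage (continuous_snd.comp continuous_subtype_val)))
  · have := e₁.map_source hb₁
    rwa [show e₁ (p q.1.1) = q.1.1 from congrArg Prod.fst hG0] at this
  · have := e₂.map_source hb₂
    rwa [show e₂ (p q.1.1) = q.1.2 from congrArg Prod.snd hG0] at this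
  · rw [hind.isPathConnected_iff, ← hMN, himg N subset_rfl]
    exact hNp.image' (hGc.mono fun b hb => (hNO hb).1)
  · rw [← hind.isPreconnected_image]
    have : M ∩ pullbackOver p B₀ = {q' ∈ M | p q'.1.1 ∈ N ∩ B₀} := by
      ext q'; exact ⟨fun h => ⟨h.1, h.1.1, h.2⟩, fun h => ⟨h.1, h.2.2⟩⟩
    rw [this, himg _ Set.inter_subset_left]
    exact hNc.image _ (hGc.mono fun b hb => (hNO hb.1).1)

lemma isClopen_pullbackDiag (cov : IsCoveringMap p) : IsClopen (pullbackDiag p) :=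
  ⟨cov.isSeparatedMap.isClosed_eqLocus (g₁ := fun q : p.Pullback p => q.1.1)
      (g₂ := fun q => q.1.2) (continuous_fst.comp continuous_subtype_val)
      (continuous_snd.comp continuous_subtype_val) (funext fun q => q.2),
    cov.isLocalHomeomorph.isLocallyInjective.isOpen_eqLocus (g₁ := fun q : p.Pullback p => q.1.1)
      (g₂ := fun q => q.1.2) (continuous_fst.comp continuous_subtype_val)
      (continuous_snd.comp continuous_subtype_val) (funext fun q => q.2)⟩

/-- The part of the fiber square over a dense set is dense, as a covering is an open map. -/
lemma dense_pullbackOver {B₀ : Set B} (hd : Dense B₀)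
    (cov : IsCoveringMap p) : Dense (pullbackOver p B₀) := by
  intro q
  rw [mem_closure_iff_nhds]
  intro O hO
  have hfst : IsOpenMap fun q : p.Pullback p => p q.1.1 := by
    intro W hW
    rw [isOpen_iff_mem_nhds]
    rintro _ ⟨q', hq', rfl⟩
    have hloc := cov.isLocalHomeomorph
    set e₁ := hloc.localInverseAt q'.1.1
    set e₂ := hloc.localInverseAt q'.1.2
    have hs₁ : ∀ x, e₁.symm x = p x := fun x => by rw [hloc.localInverseAt_symm]
    have hs₂ : ∀ x, e₂.symm x = p x := fun x => by rw [hloc.localInverseAt_symm]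
    have hb₁ : p q'.1.1 ∈ e₁.source := hloc.apply_self_mem_localInverseAt_source
    have hb₂ : p q'.1.1 ∈ e₂.source := by
      rw [q'.2]; exact hloc.apply_self_mem_localInverseAt_source
    obtain ⟨W', hW', rfl⟩ := isOpen_induced_iff.mp hW
    have hGc : ContinuousAt (fun b => (e₁ b, e₂ b)) (p q'.1.1) :=
      (e₁.continuousAt hb₁).prodMk (e₂.continuousAt hb₂)
    have hG0 : (e₁ (p q'.1.1), e₂ (p q'.1.1)) = q'.1 := by
      refine Prod.ext ?_ ?_
      · exact hloc.localInverseAt_apply_self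
      · change e₂ (p q'.1.1) = _
        rw [q'.2]; exact hloc.localInverseAt_apply_self
    filter_upwards [hGc.preimage_mem_nhds (hW'.mem_nhds (by rw [hG0]; exact hq')),
      e₁.open_source.mem_nhds hb₁, e₂.open_source.mem_nhds hb₂] with b hbW hbs₁ hbs₂
    have h1 : p (e₁ b) = b := by rw [← hs₁, e₁.left_inv hbs₁]
    have h2 : p (e₂ b) = b := by rw [← hs₂, e₂.left_inv hbs₂]
    exact ⟨⟨(e₁ b, e₂ b), h1.trans h2.symm⟩, hbW, h1⟩
  have hO' : (fun q : p.Pullback p => p q.1.1) '' O ∈ 𝓝 (p q.1.1) := hfst.image_mem_nhds hO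
  obtain ⟨_, ⟨q', hq', rfl⟩, hqB⟩ := mem_closure_iff_nhds.mp (hd (p q.1.1)) _ hO'
  exact ⟨q', hq', hqB⟩

/-- Two pairs of points of a fiber that are joined by a path in the fiber square are related by an
element of the monodromy group. -/
lemma exists_monodromyPerm_of_joined (cov : IsCoveringMap p) (z : B) (x y x' y' : p ⁻¹' {z})
    (h : Joined (⟨(x.1, y.1), x.2.trans y.2.symm⟩ : p.Pullback p)
      ⟨(x'.1, y'.1), x'.2.trans y'.2.symm⟩) :
    ∃ g ∈ (cov.monodromyPerm z).range, g x = x' ∧ g y = y' := by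
  obtain ⟨Γ⟩ := h
  let Γ₁ : Path x.1 x'.1 := Γ.map (continuous_fst.comp continuous_subtype_val)
  let Γ₂ : Path y.1 y'.1 := Γ.map (continuous_snd.comp continuous_subtype_val)
  have hx : p x.1 = z := x.2
  have hx' : p x'.1 = z := x'.2
  let γ : Path z z := (Γ₁.map cov.continuous).cast hx.symm hx'.symm
  refine ⟨cov.monodromyPerm z (FundamentalGroup.fromPath (Path.Homotopic.Quotient.mk γ)),
    ⟨_, rfl⟩, ?_, ?_⟩
  · change cov.monodromy (Path.Homotopic.Quotient.mk γ) x = x'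
    refine cov.monodromy_eq_of_map_eq (Path.Homotopic.Quotient.mk Γ₁) ?_
    refine congrArg Path.Homotopic.Quotient.mk ?_
    ext t; rfl
  · change cov.monodromy (Path.Homotopic.Quotient.mk γ) y = y'
    refine cov.monodromy_eq_of_map_eq (Path.Homotopic.Quotient.mk Γ₂) ?_
    refine congrArg Path.Homotopic.Quotient.mk ?_
    ext t
    exact (Γ t).2.symm

/-- Lifting a path in the base to two sheets at once gives a path in the fiber square. -/
lemma joined_monodromy (cov : IsCoveringMap p) {b b' : B} (γ : Path b b') (x y : p ⁻¹' {b}) :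
    Joined (⟨(x.1, y.1), x.2.trans y.2.symm⟩ : p.Pullback p)
      ⟨((cov.monodromy (.mk γ) x).1, (cov.monodromy (.mk γ) y).1),
        (cov.monodromy (.mk γ) x).2.trans (cov.monodromy (.mk γ) y).2.symm⟩ := by
  have hx : (γ : C(unitInterval, B)) 0 = p x.1 := γ.source.trans x.2.symm
  have hy : (γ : C(unitInterval, B)) 0 = p y.1 := γ.source.trans y.2.symm
  have h : ∀ t, p (cov.liftPath γ x.1 hx t) = p (cov.liftPath γ y.1 hy t) := fun t =>
    (congrFun (cov.liftPath_lifts γ x.1 hx) t).trans (congrFun (cov.liftPath_lifts γ y.1 hy) t).symm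
  refine ⟨⟨⟨fun t => ⟨(cov.liftPath γ x.1 hx t, cov.liftPath γ y.1 hy t), h t⟩, ?_⟩, ?_, ?_⟩⟩
  · exact Continuous.subtype_mk (by fun_prop) _
  · exact Subtype.ext (Prod.ext (cov.liftPath_zero γ x.1 hx) (cov.liftPath_zero γ y.1 hy))
  · rfl

variable [PreconnectedSpace B]

/-- Double transitivity of the monodromy of a covering `p : X → B`, in terms of a decomposition of
the fiber square into finitely many closed pieces that become disjoint and connected over a dense
subset `B₀` of `B` which does not locally separate `B`. The closures of the pieces over `B₀` are
then the connected components of the fiber square, and these correspond to the orbits of the monodromy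
group on pairs of points of a fiber. -/
theorem isMultiplyPretransitive_monodromy_iff (cov : IsCoveringMap p) {B₀ : Set B}
    (hB : LocallyNonseparating B₀) (hd : Dense B₀) {ι : Type*} [Finite ι]
    (K : ι → Set (p.Pullback p)) (hclosed : ∀ i, IsClosed (K i)) (hcover : ⋃ i, K i = Set.univ)
    (hdisj : ∀ i j, i ≠ j → K i ∩ K j ∩ pullbackOver p B₀ = ∅)
    (hpre : ∀ i, IsPreconnected (K i ∩ pullbackOver p B₀))
    (hne : ∀ i, (K i ∩ pullbackOver p B₀).Nonempty) (z : B) :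
    MulAction.IsMultiplyPretransitive (cov.monodromyPerm z).range (p ⁻¹' {z}) 2 ↔
      {i | ¬ (K i ∩ pullbackOver p B₀ ⊆ pullbackDiag p ∧ pullbackDiag p ⊆ K i)}.Subsingleton := by
  set A : ι → Set (p.Pullback p) := fun i => closure (K i ∩ pullbackOver p B₀) with hA
  have hAK : ∀ i, A i ⊆ K i := fun i =>
    closure_minimal Set.inter_subset_left (hclosed i)
  have hAcl : ∀ i, IsClosed (A i) := fun i => isClosed_closure
  have hApre : ∀ i, IsPreconnected (A i) := fun i => (hpre i).closure
  have hAcov : ∀ q, ∃ i, q ∈ A i := by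
    intro q
    have h1 : pullbackOver p B₀ ⊆ ⋃ i, A i := fun q' hq' => by
      obtain ⟨i, hi⟩ := Set.mem_iUnion.mp (hcover.symm ▸ Set.mem_univ q' : q' ∈ ⋃ i, K i)
      exact Set.mem_iUnion.mpr ⟨i, subset_closure ⟨hi, hq'⟩⟩
    have h2 := closure_minimal h1 (isClosed_iUnion_of_finite hAcl)
    exact Set.mem_iUnion.mp (h2 (dense_pullbackOver hd cov q))
  -- the closures remain disjoint, because `B₀` does not locally separate `B`
  have hAdisj : ∀ i j q, q ∈ A i → q ∈ A j → i = j := by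
    intro i j q hi hj
    by_contra hij
    obtain ⟨M, -, hMo, hqM, -, hMc⟩ := hB.exists_nhd_pullback cov q Filter.univ_mem
    obtain ⟨q₁, hq₁M, hq₁⟩ := mem_closure_iff.mp hi M hMo hqM
    obtain ⟨q₂, hq₂M, hq₂⟩ := mem_closure_iff.mp hj M hMo hqM
    have h1 := isPreconnected_closed_iff.mp hMc (K i) (⋃ j : {j // j ≠ i}, K j) (hclosed i)
      (isClosed_iUnion_of_finite fun j => hclosed j) (fun q' _ => by
        obtain ⟨k, hk⟩ := Set.mem_iUnion.mp (hcover.symm ▸ Set.mem_univ q' : q' ∈ ⋃ i, K i)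
        by_cases hki : k = i
        · exact Or.inl (hki ▸ hk)
        · exact Or.inr (Set.mem_iUnion.mpr ⟨⟨k, hki⟩, hk⟩))
      ⟨q₁, ⟨hq₁M, hq₁.2⟩, hq₁.1⟩
      ⟨q₂, ⟨hq₂M, hq₂.2⟩, Set.mem_iUnion.mpr ⟨⟨j, fun h => hij h.symm⟩, hq₂.1⟩⟩
    obtain ⟨q₃, hq₃M, hq₃i, hq₃⟩ := h1
    obtain ⟨k, hk⟩ := Set.mem_iUnion.mp hq₃
    exact (Set.eq_empty_iff_forall_notMem.mp (hdisj i k (fun h => k.2 h.symm))) q₃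
      ⟨⟨hq₃i, hk⟩, hq₃M.2⟩
  have hAopen : ∀ i, IsOpen (A i) := by
    intro i
    have : A i = (⋃ j : {j // j ≠ i}, A j)ᶜ := by
      ext q
      simp only [Set.mem_compl_iff, Set.mem_iUnion, not_exists]
      refine ⟨fun hi j hj => j.2 (hAdisj _ _ q hj hi), fun h => ?_⟩
      obtain ⟨k, hk⟩ := hAcov q
      by_cases hki : k = i
      · exact hki ▸ hk
      · exact absurd hk (h ⟨k, hki⟩)
    rw [this]
    exact (isClosed_iUnion_of_finite fun j : {j // j ≠ i} => hAcl j).isOpen_compl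
  have hjoin_open : ∀ q : p.Pullback p, IsClopen {q' | Joined q q'} := isClopen_joined fun q => by
    obtain ⟨M, -, hMo, hqM, hMp, -⟩ := hB.exists_nhd_pullback cov q Filter.univ_mem
    exact ⟨M, hMo, hqM, hMp⟩
  have hAjoin : ∀ i q q', q ∈ A i → q' ∈ A i → Joined q q' := fun i q q' hq hq' =>
    (hApre i).subset_isClopen (hjoin_open q) ⟨q, hq, Joined.refl q⟩ hq'
  have hjoinA : ∀ i q q', q ∈ A i → Joined q q' → q' ∈ A i := by
    rintro i q q' hq ⟨Γ⟩
    have h1 : IsPreconnected (Set.range Γ) := isPreconnected_range Γ.continuous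
    exact h1.subset_isClopen ⟨hAcl i, hAopen i⟩ ⟨q, ⟨0, Γ.source⟩, hq⟩ ⟨1, Γ.target⟩
  have hBpath : ∀ b b' : B, Joined b b' := by
    intro b b'
    have hclopen : IsClopen {b' | Joined b b'} := isClopen_joined (fun b => by
      obtain ⟨N, -, hNo, hbN, hNp, -⟩ := hB b _ Filter.univ_mem
      exact ⟨N, hNo, hbN, hNp⟩) b
    exact isPreconnected_univ.subset_isClopen hclopen ⟨b, trivial, Joined.refl b⟩ (Set.mem_univ b')
  -- each piece contains pairs of points of the fiber over `z`
  have hAfib : ∀ i, ∀ q ∈ A i, ∃ x y : p ⁻¹' {z},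
      (⟨(x.1, y.1), x.2.trans y.2.symm⟩ : p.Pullback p) ∈ A i ∧
      Joined q ⟨(x.1, y.1), x.2.trans y.2.symm⟩ := by
    intro i q hq
    obtain ⟨γ⟩ := hBpath (p q.1.1) z
    have := joined_monodromy cov γ ⟨q.1.1, rfl⟩ ⟨q.1.2, q.2.symm⟩
    exact ⟨_, _, hjoinA i _ _ hq this, this⟩
  have hΔ := isClopen_pullbackDiag cov
  have hAΔ : ∀ i, (A i ∩ pullbackDiag p).Nonempty → A i ⊆ pullbackDiag p := fun i h =>
    (hApre i).subset_isClopen hΔ h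
  have hKΔ : ∀ i, K i ∩ pullbackOver p B₀ ⊆ pullbackDiag p ↔ A i ⊆ pullbackDiag p := fun i =>
    (hΔ.1.closure_subset_iff).symm
  -- the monodromy preserves the pieces
  have hmon : ∀ i (x y : p ⁻¹' {z}), (⟨(x.1, y.1), x.2.trans y.2.symm⟩ : p.Pullback p) ∈ A i →
      ∀ g ∈ (cov.monodromyPerm z).range,
      (⟨((g x).1, (g y).1), (g x).2.trans (g y).2.symm⟩ : p.Pullback p) ∈ A i := by
    rintro i x y hxy _ ⟨γ, rfl⟩
    obtain ⟨γ⟩ := γ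
    exact hjoinA i _ _ hxy (joined_monodromy cov γ x y)
  rw [MulAction.is_two_pretransitive_iff]
  constructor
  · intro h i hi j hj
    have htrans : ∀ x x' : p ⁻¹' {z}, ∃ g ∈ (cov.monodromyPerm z).range, g x = x' := by
      intro x x'
      by_cases hxx : x = x'
      · exact ⟨1, one_mem _, by simpa using hxx⟩
      · obtain ⟨g, hg, -⟩ := h (a := x) (b := x') (c := x') (d := x) hxx (Ne.symm hxx)
        exact ⟨g.1, g.2, hg⟩
    have hoff : ∀ i, ¬ (K i ∩ pullbackOver p B₀ ⊆ pullbackDiag p ∧ pullbackDiag p ⊆ K i) →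
        ¬ A i ⊆ pullbackDiag p := by
      intro i hi hAi
      refine hi ⟨(hKΔ i).mpr hAi, fun q hq => hAK i ?_⟩
      obtain ⟨q₀, hq₀⟩ := hne i
      obtain ⟨x, y, hxy, -⟩ := hAfib i q₀ (subset_closure hq₀)
      obtain ⟨j, hj⟩ := hAcov q
      obtain ⟨x', y', hxy', hjn⟩ := hAfib j q hj
      have hxyd : x = y := Subtype.ext (hAi hxy)
      have hxyd' : x' = y' := Subtype.ext (hAΔ j ⟨q, hj, hq⟩ hxy')
      subst hxyd hxyd'
      obtain ⟨g, hg, rfl⟩ := htrans x x'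
      exact hjoinA i _ _ (hmon i x x hxy g hg) hjn.symm
    have hpair : ∀ i, ¬ A i ⊆ pullbackDiag p → ∃ x y : p ⁻¹' {z}, x ≠ y ∧
        (⟨(x.1, y.1), x.2.trans y.2.symm⟩ : p.Pullback p) ∈ A i := by
      intro i hi
      obtain ⟨q₀, hq₀⟩ := hne i
      obtain ⟨x, y, hxy, -⟩ := hAfib i q₀ (subset_closure hq₀)
      exact ⟨x, y, fun hd => hi (hAΔ i ⟨_, hxy, congrArg Subtype.val hd⟩), hxy⟩
    obtain ⟨x, y, hne₁, hxy⟩ := hpair i (hoff i hi)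
    obtain ⟨x', y', hne₂, hxy'⟩ := hpair j (hoff j hj)
    obtain ⟨g, hg₁, hg₂⟩ := h hne₁ hne₂
    have hm := hmon i x y hxy g.1 g.2
    have e1 : g.1 x = x' := hg₁
    have e2 : g.1 y = y' := hg₂
    refine hAdisj i j _ ?_ hxy'
    simpa only [e1, e2] using hm
  · intro h x y x' y' hxy hxy'
    obtain ⟨i, hi⟩ := hAcov ⟨(x.1, y.1), x.2.trans y.2.symm⟩
    obtain ⟨j, hj⟩ := hAcov ⟨(x'.1, y'.1), x'.2.trans y'.2.symm⟩
    have hij : i = j := h (fun hc => hxy (Subtype.ext ((hKΔ i).mp hc.1 hi)))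
      fun hc => hxy' (Subtype.ext ((hKΔ j).mp hc.1 hj))
    subst hij
    obtain ⟨g, hg, h1, h2⟩ := exists_monodromyPerm_of_joined cov z x y x' y' (hAjoin i _ _ hi hj)
    exact ⟨⟨g, hg⟩, h1, h2⟩

end Covering

/-! ### Complex points of schemes and of algebras -/

namespace ComplexPoints

variable {X Y : Scheme.{0}} {f : X ⟶ SpecC} {g : Y ⟶ SpecC}

theorem top_le_preimage_iff (p : SpecC ⟶ X) (U : X.Opens) :
    ⊤ ≤ p ⁻¹ᵁ U ↔ p (IsLocalRing.closedPoint ℂ) ∈ U := by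
  constructor
  · intro h
    exact h (show IsLocalRing.closedPoint ℂ ∈ (⊤ : SpecC.Opens) from trivial)
  · intro h x _
    have : x = IsLocalRing.closedPoint ℂ := Subsingleton.elim (α := PrimeSpectrum ℂ) _ _
    rw [this]
    exact h

theorem isOpen_ofOpen (U : X.Opens) : IsOpen (ofOpen f U) := by
  refine TopologicalSpace.isOpen_generateFrom_of_mem ⟨U, 0, Set.univ, isOpen_univ, ?_⟩
  ext p
  simp only [ofOpen, point, top_le_preimage_iff, Set.mem_univ, Set.mem_ofPred_eq, exists_prop,
    and_true]

theorem eval_map (π : X ⟶ Y) (hπ : π ≫ g = f) (p : ComplexPoints f) (U : Y.Opens)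
    (h : ⊤ ≤ (map π hπ p).1 ⁻¹ᵁ U) (φ : Γ(Y, U)) :
    (map π hπ p).eval U h φ = p.eval (π ⁻¹ᵁ U) h (π.app U φ) := by
  have h1 : (p.1 ≫ π).appLE U ⊤ h = π.app U ≫ p.1.appLE (π ⁻¹ᵁ U) ⊤ h :=
    Scheme.Hom.comp_appLE _ _ _ _ _
  simp only [eval, map]
  rw [h1]
  rfl

theorem continuous_map (π : X ⟶ Y) (hπ : π ≫ g = f) : Continuous (map π hπ) := by
  refine continuous_generateFrom_iff.2 ?_
  rintro _ ⟨U, φ, W, hW, rfl⟩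
  refine TopologicalSpace.isOpen_generateFrom_of_mem ⟨π ⁻¹ᵁ U, π.app U φ, W, hW, ?_⟩
  ext p
  constructor
  · rintro ⟨h, hp⟩
    exact ⟨h, by rwa [eval_map] at hp⟩
  · rintro ⟨h, hp⟩
    exact ⟨h, (eval_map π hπ p U h φ).symm ▸ hp⟩

/-- A complex point of a scheme locally of finite type is determined by its underlying point. -/
theorem point_injective [LocallyOfFiniteType f] :
    Function.Injective (point : ComplexPoints f → X) := fun _ _ h =>
  (pointEquivClosedPoint f).injective (Subtype.ext h)

theorem exists_point_eq [LocallyOfFiniteType f] {x : X} (hx : IsClosed {x}) :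
    ∃ p : ComplexPoints f, p.point = x :=
  ⟨(pointEquivClosedPoint f).symm ⟨x, hx⟩,
    congrArg Subtype.val ((pointEquivClosedPoint f).apply_symm_apply ⟨x, hx⟩)⟩

/-- The Nullstellensatz for schemes: nonempty locally closed subsets have complex points. -/
theorem exists_point_mem [LocallyOfFiniteType f] {S : Set X} (hS : IsLocallyClosed S)
    (hne : S.Nonempty) : ∃ p : ComplexPoints f, p.point ∈ S := by
  have := LocallyOfFiniteType.jacobsonSpace f
  obtain ⟨x, hxS, hx⟩ := nonempty_inter_closedPoints hne hS
  obtain ⟨p, rfl⟩ := exists_point_eq (f := f) hx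
  exact ⟨p, hxS⟩

/-- A Zariski closed set that contains the complex points of a locally closed set contains it. -/
theorem subset_of_forall_point_mem [LocallyOfFiniteType f] {S T : Set X}
    (hS : IsLocallyClosed S) (hT : IsClosed T)
    (h : ∀ p : ComplexPoints f, p.point ∈ S → p.point ∈ T) : S ⊆ T := by
  by_contra hn
  obtain ⟨x, hxS, hxT⟩ := Set.not_subset.1 hn
  obtain ⟨p, hpS, hpT⟩ := exists_point_mem (f := f) (S := S ∩ Tᶜ)
    (hS.inter hT.isOpen_compl.isLocallyClosed) ⟨x, hxS, hxT⟩
  exact hpT (h p hpS)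

end ComplexPoints

section AffinePoints

variable {A : Type} [CommRing A]

/-- The point of the spectrum at which a complex valued ring homomorphism is located: its kernel. -/
noncomputable def kerPoint (φ : A →+* ℂ) : PrimeSpectrum A :=
  PrimeSpectrum.comap φ (IsLocalRing.closedPoint ℂ)

@[simp]
theorem kerPoint_mem_basicOpen (φ : A →+* ℂ) (a : A) :
    kerPoint φ ∈ PrimeSpectrum.basicOpen a ↔ φ a ≠ 0 := by
  simp [kerPoint, PrimeSpectrum.mem_basicOpen, IsLocalRing.closedPoint]

theorem asIdeal_kerPoint (φ : A →+* ℂ) : (kerPoint φ).asIdeal = RingHom.ker φ := by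
  ext a
  simp [kerPoint, IsLocalRing.closedPoint, RingHom.mem_ker]

theorem specMap_closedPoint (φ : A →+* ℂ) :
    (Spec.map (CommRingCat.ofHom φ) : SpecC ⟶ Spec (.of A)) (IsLocalRing.closedPoint ℂ)
      = kerPoint φ := rfl

theorem exists_basicOpen_le (O : (Spec (CommRingCat.of A)).Opens) {x : PrimeSpectrum A}
    (hx : x ∈ O) : ∃ a : A, x ∈ PrimeSpectrum.basicOpen a ∧ PrimeSpectrum.basicOpen a ≤ O := by
  obtain ⟨_, ⟨_, ⟨a, rfl⟩, rfl⟩, ha, haO⟩ :=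
    PrimeSpectrum.isBasis_basic_opens.exists_subset_of_mem_open
    (a := x) (u := (show TopologicalSpace.Opens (PrimeSpectrum A) from O).carrier) hx
    (show TopologicalSpace.Opens (PrimeSpectrum A) from O).isOpen
  exact ⟨a, ha, haO⟩

/-- Evaluation of regular functions on an open subset of `Spec A` at the point given by a ring
homomorphism `φ : A → ℂ`. -/
noncomputable def specEval (φ : A →+* ℂ) (O : (Spec (CommRingCat.of A)).Opens)
    (h : (⊤ : SpecC.Opens) ≤ Spec.map (CommRingCat.ofHom φ) ⁻¹ᵁ O) :
    Γ(Spec (CommRingCat.of A), O) →+* ℂ :=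
  (Scheme.ΓSpecIso (CommRingCat.of ℂ)).hom.hom.comp
    ((Spec.map (CommRingCat.ofHom φ)).appLE O ⊤ h).hom

theorem specEval_algebraMap (φ : A →+* ℂ) (O : (Spec (CommRingCat.of A)).Opens)
    (h : (⊤ : SpecC.Opens) ≤ Spec.map (CommRingCat.ofHom φ) ⁻¹ᵁ O) (a : A) :
    specEval φ O h (((Scheme.ΓSpecIso (CommRingCat.of A)).inv ≫
      (Spec (CommRingCat.of A)).presheaf.map (homOfLE le_top).op) a) = φ a := by
  have h1 : ((Scheme.ΓSpecIso (CommRingCat.of A)).inv ≫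
      (Spec (CommRingCat.of A)).presheaf.map (homOfLE le_top).op) ≫
      (Spec.map (CommRingCat.ofHom φ)).appLE O ⊤ h ≫ (Scheme.ΓSpecIso (CommRingCat.of ℂ)).hom
      = CommRingCat.ofHom φ := by
    rw [Category.assoc, Scheme.Hom.map_appLE_assoc]
    have : (Spec.map (CommRingCat.ofHom φ)).appLE ⊤ ⊤ (by simp) =
      (Spec.map (CommRingCat.ofHom φ)).appTop := by
      rw [Scheme.Hom.appTop, Scheme.Hom.app_eq_appLE]; rfl
    rw [this, Scheme.ΓSpecIso_naturality, Iso.inv_hom_id_assoc]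
  exact congr($h1 a)

variable [Algebra ℂ A] {X : Scheme.{0}} {f : X ⟶ SpecC}

/-- The complex point of `X` obtained from an algebra homomorphism `A → ℂ` by means of a morphism
`Spec A ⟶ X` over `ℂ`. -/
noncomputable def affinePoint (j : Spec (CommRingCat.of A) ⟶ X)
    (hj : j ≫ f = Spec.map (CommRingCat.ofHom (algebraMap ℂ A))) (φ : A →ₐ[ℂ] ℂ) :
    ComplexPoints f :=
  ⟨Spec.map (CommRingCat.ofHom φ.toRingHom) ≫ j, by
    rw [Category.assoc, hj, ← Spec.map_comp, ← CommRingCat.ofHom_comp]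
    have : φ.toRingHom.comp (algebraMap ℂ A) = RingHom.id ℂ := φ.comp_algebraMap
    rw [this]
    simp⟩

variable (j : Spec (CommRingCat.of A) ⟶ X)
  (hj : j ≫ f = Spec.map (CommRingCat.ofHom (algebraMap ℂ A)))

theorem point_affinePoint (φ : A →ₐ[ℂ] ℂ) :
    (affinePoint j hj φ).point = j (kerPoint φ.toRingHom) := rfl

theorem eval_affinePoint (φ : A →ₐ[ℂ] ℂ) (V : X.Opens) (O : (Spec (CommRingCat.of A)).Opens)
    (hO : O ≤ j ⁻¹ᵁ V) (h : ⊤ ≤ (affinePoint j hj φ).1 ⁻¹ᵁ V)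
    (h' : ⊤ ≤ Spec.map (CommRingCat.ofHom φ.toRingHom) ⁻¹ᵁ O) (s : Γ(X, V)) :
    (affinePoint j hj φ).eval V h s = specEval φ.toRingHom O h' (j.appLE V O hO s) := by
  have h1 : (Spec.map (CommRingCat.ofHom φ.toRingHom) ≫ j).appLE V ⊤ h =
      j.appLE V O hO ≫ (Spec.map (CommRingCat.ofHom φ.toRingHom)).appLE O ⊤ h' :=
    (Scheme.Hom.appLE_comp_appLE _ _ _ _ _ _ _).symm
  simp only [ComplexPoints.eval, affinePoint]
  rw [h1]
  rfl

theorem continuous_affinePoint : Continuous (affinePoint j hj) := by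
  refine continuous_generateFrom_iff.2 ?_
  rintro _ ⟨V, s, W, hW, rfl⟩
  rw [isOpen_iff_mem_nhds]
  rintro φ₀ ⟨h₀, hφ₀⟩
  have hmem : kerPoint φ₀.toRingHom ∈ j ⁻¹ᵁ V := by
    have := (ComplexPoints.top_le_preimage_iff _ _).1 h₀
    change (affinePoint j hj φ₀).point ∈ V at this
    rwa [point_affinePoint] at this
  obtain ⟨a, ha, hO⟩ := exists_basicOpen_le (j ⁻¹ᵁ V) hmem
  have ha' : φ₀ a ≠ 0 := (kerPoint_mem_basicOpen _ _).1 ha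
  obtain ⟨O, hOa, hb⟩ : ∃ (O : (Spec (CommRingCat.of A)).Opens)
      (_ : O = PrimeSpectrum.basicOpen a), ∀ s : Γ(Spec (CommRingCat.of A), O), ∃ (n : ℕ) (b : A),
      ((Scheme.ΓSpecIso (CommRingCat.of A)).inv ≫
        (Spec (CommRingCat.of A)).presheaf.map (homOfLE le_top).op) b =
      ((Scheme.ΓSpecIso (CommRingCat.of A)).inv ≫
        (Spec (CommRingCat.of A)).presheaf.map (homOfLE le_top).op) a ^ n * s :=
    ⟨_, basicOpen_eq_of_affine (R := CommRingCat.of A) a, fun s => by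
      obtain ⟨n, y, hy⟩ := exists_eq_pow_mul_of_isAffineOpen (Spec (CommRingCat.of A)) ⊤
        (isAffineOpen_top _) ((Scheme.ΓSpecIso (CommRingCat.of A)).inv a) s
      refine ⟨n, (Scheme.ΓSpecIso (CommRingCat.of A)).hom y, ?_⟩
      refine Eq.trans ?_ hy
      have := (Scheme.ΓSpecIso (CommRingCat.of A)).hom_inv_id_apply y
      exact congrArg ((Spec (CommRingCat.of A)).presheaf.map (homOfLE le_top).op) this⟩
  replace hO : O ≤ j ⁻¹ᵁ V := hOa ▸ hO
  obtain ⟨n, b, hb⟩ := hb (j.appLE V O hO s)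
  have key : ∀ φ : A →ₐ[ℂ] ℂ, φ a ≠ 0 → ∃ h : ⊤ ≤ (affinePoint j hj φ).1 ⁻¹ᵁ V,
      (affinePoint j hj φ).eval V h s = φ b / φ a ^ n := by
    intro φ hφ
    have h' : ⊤ ≤ Spec.map (CommRingCat.ofHom φ.toRingHom) ⁻¹ᵁ O := by
      rw [ComplexPoints.top_le_preimage_iff, specMap_closedPoint, hOa]
      exact (kerPoint_mem_basicOpen _ _).2 hφ
    have h : ⊤ ≤ (affinePoint j hj φ).1 ⁻¹ᵁ V := fun x hx => hO (h' hx)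
    refine ⟨h, ?_⟩
    rw [eval_affinePoint j hj φ V O hO h h', eq_div_iff (pow_ne_zero _ hφ)]
    have h2 := congrArg (specEval φ.toRingHom O h') hb
    rw [map_mul, map_pow, specEval_algebraMap, specEval_algebraMap, mul_comm] at h2
    exact h2.symm
  have hc : ContinuousAt (fun φ : A →ₐ[ℂ] ℂ => φ b / φ a ^ n) φ₀ :=
    ((continuous_algHom_apply b).continuousAt).div
      (((continuous_algHom_apply a).continuousAt).pow n) (pow_ne_zero _ ha')
  obtain ⟨h₁, e₁⟩ := key φ₀ ha'
  have hW' : W ∈ nhds (φ₀ b / φ₀ a ^ n) := hW.mem_nhds (by rw [← e₁]; exact hφ₀)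
  filter_upwards [hc hW', (isOpen_algHom_ne_zero a).mem_nhds ha'] with φ h1 h2
  obtain ⟨h, e⟩ := key φ h2
  exact ⟨h, by rw [e]; exact h1⟩

instance algHomT2Space : T2Space (A →ₐ[ℂ] ℂ) :=
  T2Space.of_injective_continuous (f := fun (φ : A →ₐ[ℂ] ℂ) (a : A) => φ a)
    DFunLike.coe_injective (continuous_pi continuous_algHom_apply)

variable [IsOpenImmersion j]

theorem isInducing_affinePoint : Topology.IsInducing (affinePoint j hj) := by
  refine ⟨le_antisymm (continuous_iff_le_induced.1 (continuous_affinePoint j hj)) ?_⟩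
  have key : @Continuous _ _ (TopologicalSpace.induced (affinePoint j hj) inferInstance) _
      (fun (φ : A →ₐ[ℂ] ℂ) (a : A) => φ a) := by
    refine @continuous_pi _ _ _ (TopologicalSpace.induced _ _) _ _ fun a => ?_
    refine @Continuous.mk _ _ (TopologicalSpace.induced _ _) _ _ fun W hW => ?_
    refine isOpen_induced_iff.2 ⟨_, TopologicalSpace.isOpen_generateFrom_of_mem
      ⟨j ''ᵁ ⊤, (j.appIso ⊤).inv ((Scheme.ΓSpecIso (CommRingCat.of A)).inv a), W, hW, rfl⟩, ?_⟩
    ext φ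
    have h' : ⊤ ≤ Spec.map (CommRingCat.ofHom φ.toRingHom) ⁻¹ᵁ
      (⊤ : (Spec (CommRingCat.of A)).Opens) := le_top
    have h : ⊤ ≤ (affinePoint j hj φ).1 ⁻¹ᵁ (j ''ᵁ ⊤) := by
      rw [ComplexPoints.top_le_preimage_iff]
      exact ⟨kerPoint φ.toRingHom, trivial, rfl⟩
    have hv : (affinePoint j hj φ).eval (j ''ᵁ ⊤) h
        ((j.appIso ⊤).inv ((Scheme.ΓSpecIso (CommRingCat.of A)).inv a)) = φ a := by
      rw [eval_affinePoint j hj φ _ ⊤ (Scheme.Hom.preimage_image_eq j ⊤).ge h h']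
      have h2 : (j.appIso ⊤).inv ≫ j.appLE (j ''ᵁ ⊤) ⊤ (Scheme.Hom.preimage_image_eq j ⊤).ge
          = 𝟙 _ := by
        rw [← Scheme.Hom.appIso_hom', Iso.inv_hom_id]
      have h3 := congr($h2 ((Scheme.ΓSpecIso (CommRingCat.of A)).inv a))
      have h4 := specEval_algebraMap φ.toRingHom ⊤ h' a
      have h5 : (Scheme.ΓSpecIso (CommRingCat.of A)).inv ≫
          (Spec (CommRingCat.of A)).presheaf.map (homOfLE (le_top : (⊤ : (Spec _).Opens) ≤ ⊤)).op
          = (Scheme.ΓSpecIso (CommRingCat.of A)).inv := by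
        have : (homOfLE (le_top : (⊤ : (Spec (CommRingCat.of A)).Opens) ≤ ⊤)).op = 𝟙 _ := rfl
        rw [this, CategoryTheory.Functor.map_id, Category.comp_id]
      rw [h5] at h4
      exact (congrArg (specEval φ.toRingHom ⊤ h') h3).trans h4
    constructor
    · rintro ⟨_, hW⟩
      change φ a ∈ W
      rw [← hv]
      exact hW
    · intro hφ
      exact ⟨h, by rw [hv]; exact hφ⟩
  exact continuous_iff_le_induced.1 key

theorem range_affinePoint :
    Set.range (affinePoint j hj) = ComplexPoints.ofOpen f j.opensRange := by
  ext p
  constructor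
  · rintro ⟨φ, rfl⟩
    change (affinePoint j hj φ).point ∈ j.opensRange
    rw [point_affinePoint]
    exact ⟨_, rfl⟩
  · intro hp
    have hr : Set.range p.1 ⊆ Set.range j := by
      rintro _ ⟨x, rfl⟩
      have : x = IsLocalRing.closedPoint ℂ := Subsingleton.elim (α := PrimeSpectrum ℂ) _ _
      rw [this]
      exact hp
    let q : SpecC ⟶ Spec (CommRingCat.of A) := IsOpenImmersion.lift j p.1 hr
    have hq : q ≫ j = p.1 := IsOpenImmersion.lift_fac _ _ _
    have hq' : q = Spec.map (Spec.preimage q) := (Spec.map_preimage q).symm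
    have h1 : CommRingCat.ofHom (algebraMap ℂ A) ≫ Spec.preimage q = 𝟙 _ := by
      apply Spec.map_injective
      rw [Spec.map_comp, Spec.map_preimage, ← hj, ← Category.assoc, hq, p.2]
      simp
    refine ⟨{ (Spec.preimage q).hom with commutes' := fun x => congr($h1 x) }, ?_⟩
    apply Subtype.ext
    change Spec.map (Spec.preimage q) ≫ j = p.1
    rw [← hq', hq]

theorem isOpenEmbedding_affinePoint : Topology.IsOpenEmbedding (affinePoint j hj) :=
  ⟨⟨isInducing_affinePoint j hj, (isInducing_affinePoint j hj).injective⟩, by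
    rw [range_affinePoint]; exact ComplexPoints.isOpen_ofOpen _⟩

end AffinePoints

/-! ### Étale charts of complex varieties -/

/-- A domain that is standard étale over a polynomial ring: the coordinate ring of an irreducible
smooth affine variety with an étale map of the simplest shape to affine space. -/
def IsEtaleChart (A : Type) [CommRing A] [Algebra ℂ A] : Prop :=
  IsDomain A ∧ ∃ (n : ℕ) (_ : Algebra (MvPolynomial (Fin n) ℂ) A),
    IsScalarTower ℂ (MvPolynomial (Fin n) ℂ) A ∧
    Algebra.IsStandardEtale (MvPolynomial (Fin n) ℂ) A

section EtaleChart

variable {A : Type} [CommRing A]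

theorem exists_ne_zero_basicOpen_le [IsDomain A] (O : (Spec (CommRingCat.of A)).Opens)
    {x : PrimeSpectrum A} (hx : x ∈ O) : ∃ a : A, a ≠ 0 ∧ PrimeSpectrum.basicOpen a ≤ O := by
  obtain ⟨a, ha, haO⟩ := exists_basicOpen_le O hx
  refine ⟨a, ?_, haO⟩
  rintro rfl
  simp at ha

variable [Algebra ℂ A]

theorem IsEtaleChart.dense_kerPoint_mem (hA : IsEtaleChart A)
    (O : (Spec (CommRingCat.of A)).Opens) {x : PrimeSpectrum A} (hx : x ∈ O) :
    Dense {φ : A →ₐ[ℂ] ℂ | kerPoint φ.toRingHom ∈ O} := by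
  obtain ⟨_, n, _, _, _⟩ := hA
  obtain ⟨a, ha, haO⟩ := exists_ne_zero_basicOpen_le O hx
  exact (dense_algHom_ne_zero n ha).mono fun φ hφ => haO ((kerPoint_mem_basicOpen _ _).2 hφ)

theorem IsEtaleChart.isPreconnected_inter_kerPoint_mem (hA : IsEtaleChart A)
    (O : (Spec (CommRingCat.of A)).Opens) {N : Set (A →ₐ[ℂ] ℂ)} (hN : IsOpen N)
    (h : ∀ a : A, IsPreconnected (N ∩ {φ | φ a ≠ 0})) :
    IsPreconnected (N ∩ {φ : A →ₐ[ℂ] ℂ | kerPoint φ.toRingHom ∈ O}) := by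
  rcases Set.eq_empty_or_nonempty (N ∩ {φ : A →ₐ[ℂ] ℂ | kerPoint φ.toRingHom ∈ O}) with he | he
  · rw [he]; exact isPreconnected_empty
  obtain ⟨_, n, _, _, _⟩ := hA
  obtain ⟨φ₀, -, hφ₀⟩ := he
  obtain ⟨a, ha, haO⟩ := exists_ne_zero_basicOpen_le O hφ₀
  refine (h a).subset_closure ?_ ?_
  · rintro φ ⟨h1, h2⟩
    exact ⟨h1, haO ((kerPoint_mem_basicOpen _ _).2 h2)⟩
  · rintro φ ⟨h1, -⟩
    exact (dense_algHom_ne_zero n ha).open_subset_closure_inter hN h1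

theorem IsEtaleChart.isPreconnected_kerPoint_mem (hA : IsEtaleChart A)
    (O : (Spec (CommRingCat.of A)).Opens) :
    IsPreconnected {φ : A →ₐ[ℂ] ℂ | kerPoint φ.toRingHom ∈ O} := by
  have := hA.isPreconnected_inter_kerPoint_mem O isOpen_univ fun a => by
    obtain ⟨_, n, _, _, _⟩ := hA
    simpa using isPreconnected_algHom_ne_zero n a
  simpa using this

theorem IsEtaleChart.isPreconnected_univ (hA : IsEtaleChart A) :
    IsPreconnected (Set.univ : Set (A →ₐ[ℂ] ℂ)) := by
  obtain ⟨_, n, _, _, _⟩ := hA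
  simpa using isPreconnected_algHom_ne_zero n (1 : A)

theorem IsEtaleChart.exists_nhd (hA : IsEtaleChart A) (φ₀ : A →ₐ[ℂ] ℂ)
    {Q : Set (A →ₐ[ℂ] ℂ)} (hQ : Q ∈ nhds φ₀) (O : (Spec (CommRingCat.of A)).Opens) :
    ∃ N ⊆ Q, IsOpen N ∧ φ₀ ∈ N ∧ IsPathConnected N ∧
      IsPreconnected (N ∩ {φ | kerPoint φ.toRingHom ∈ O}) := by
  obtain ⟨N, hNQ, hN, hφ, hp, h⟩ : ∃ N ⊆ Q, IsOpen N ∧ φ₀ ∈ N ∧ IsPathConnected N ∧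
      ∀ a : A, IsPreconnected (N ∩ {φ | φ a ≠ 0}) := by
    obtain ⟨_, n, _, _, _⟩ := hA
    exact exists_nhd_algHom n φ₀ hQ
  exact ⟨N, hNQ, hN, hφ, hp, hA.isPreconnected_inter_kerPoint_mem O hN h⟩

/-- A smooth point of an integral affine variety has an affine neighbourhood that is an étale
chart. -/
theorem exists_isEtaleChart_localization [IsDomain A] [Algebra.FiniteType ℂ A] (p : Ideal A)
    [p.IsPrime] [Algebra.IsSmoothAt ℂ p] : ∃ a ∉ p, IsEtaleChart (Localization.Away a) := by
  have : Algebra.FinitePresentation ℂ A := Algebra.FinitePresentation.of_finiteType.1 ‹_›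
  obtain ⟨a, ha, n, h1, h2, h3⟩ :=
    Algebra.IsSmoothAt.exists_isStandardEtale_mvPolynomial (R := ℂ) (p := p)
  have h0 : a ≠ 0 := fun h => ha (h ▸ p.zero_mem)
  exact ⟨a, ha, IsLocalization.isDomain_localization (powers_le_nonZeroDivisors_of_noZeroDivisors h0),
    n, h1, h2, h3⟩

/-- Generic smoothness: an integral affine variety has an open affine subset that is an étale
chart. -/
theorem exists_isEtaleChart_localization_of_isDomain [IsDomain A] [Algebra.FiniteType ℂ A] :
    ∃ a : A, a ≠ 0 ∧ IsEtaleChart (Localization.Away a) := by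
  have : Algebra.IsSmoothAt ℂ (⊥ : Ideal A) := by
    have hm : (⊥ : Ideal A).primeCompl = nonZeroDivisors A := by
      ext x; rw [mem_nonZeroDivisors_iff_ne_zero]; exact not_congr Ideal.mem_bot
    have : IsFractionRing A (Localization.AtPrime (⊥ : Ideal A)) := by
      have key : ∀ M : Submonoid A, M = nonZeroDivisors A →
          IsLocalization M (Localization.AtPrime (⊥ : Ideal A)) →
          IsFractionRing A (Localization.AtPrime (⊥ : Ideal A)) := by
        rintro _ rfl h; exact h
      exact key _ hm inferInstance
    let : Field (Localization.AtPrime (⊥ : Ideal A)) := IsFractionRing.toField A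
    have : Algebra.EssFiniteType ℂ (Localization.AtPrime (⊥ : Ideal A)) :=
      Algebra.EssFiniteType.comp ℂ A _
    exact Algebra.FormallySmooth.of_perfectField
  obtain ⟨a, ha, h⟩ := exists_isEtaleChart_localization (⊥ : Ideal A)
  exact ⟨a, by simpa using ha, h⟩

end EtaleChart

section AffineCharts

variable {X : Scheme.{0}} {f : X ⟶ SpecC}

theorem exists_affineChart (f : X ⟶ SpecC) {x : X} {O : X.Opens} (hx : x ∈ O) :
    ∃ (B : Type) (_ : CommRing B) (_ : Algebra ℂ B) (j : Spec (CommRingCat.of B) ⟶ X)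
      (_ : IsOpenImmersion j), j ≫ f = Spec.map (CommRingCat.ofHom (algebraMap ℂ B)) ∧
      x ∈ j.opensRange ∧ j.opensRange ≤ O := by
  obtain ⟨_, ⟨V, hV, rfl⟩, hxV, hVO⟩ :=
    X.isBasis_affineOpens.exists_subset_of_mem_open hx O.isOpen
  let B := Γ(X, V)
  let φ : CommRingCat.of ℂ ⟶ B := Spec.preimage (hV.fromSpec ≫ f)
  let : Algebra ℂ B := φ.hom.toAlgebra
  have hj : hV.fromSpec ≫ f = Spec.map (CommRingCat.ofHom (algebraMap ℂ B)) :=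
    (Spec.map_preimage _).symm
  refine ⟨B, inferInstance, inferInstance, hV.fromSpec, hV.isOpenImmersion_fromSpec, hj, ?_, ?_⟩
  · rw [hV.opensRange_fromSpec]; exact hxV
  · rw [hV.opensRange_fromSpec]; exact hVO

variable {B : Type} [CommRing B] {j : Spec (CommRingCat.of B) ⟶ X}

theorem isDomain_of_affineChart [IsIntegral X] [IsOpenImmersion j] (x : PrimeSpectrum B) :
    IsDomain B := by
  have : Nonempty (Spec (CommRingCat.of B)) := ⟨x⟩
  have : IsIntegral (Spec (CommRingCat.of B)) := isIntegral_of_isOpenImmersion j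
  exact (affine_isIntegral_iff (CommRingCat.of B)).1 this

variable [Algebra ℂ B]

theorem finiteType_of_affineChart [LocallyOfFiniteType f] [IsOpenImmersion j]
    (hj : j ≫ f = Spec.map (CommRingCat.ofHom (algebraMap ℂ B))) : Algebra.FiniteType ℂ B := by
  have h : LocallyOfFiniteType (Spec.map (CommRingCat.ofHom (algebraMap ℂ B))) := by
    rw [← hj]; infer_instance
  have := (HasRingHomProperty.Spec_iff (P := @LocallyOfFiniteType)).1 h
  rwa [CommRingCat.hom_ofHom, RingHom.finiteType_algebraMap] at this

theorem smooth_of_affineChart [IsOpenImmersion j] {U : X.Opens} [Smooth (U.ι ≫ f)]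
    (hj : j ≫ f = Spec.map (CommRingCat.ofHom (algebraMap ℂ B))) (hU : j.opensRange ≤ U) :
    Algebra.Smooth ℂ B := by
  have hr : Set.range j ⊆ Set.range U.ι := by
    rw [Scheme.Opens.range_ι]; exact hU
  have h : Smooth (Spec.map (CommRingCat.ofHom (algebraMap ℂ B))) := by
    rw [← hj, ← IsOpenImmersion.lift_fac U.ι j hr, Category.assoc]
    infer_instance
  have := (HasRingHomProperty.Spec_iff (P := @Smooth)).1 h
  rwa [CommRingCat.hom_ofHom, RingHom.smooth_algebraMap] at this

/-- Every point of an irreducible variety that lies in a smooth open subset `U` is contained in an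
étale chart. -/
theorem exists_etaleChart_of_smooth [IsIntegral X] [LocallyOfFiniteType f] {U : X.Opens}
    [Smooth (U.ι ≫ f)] {x : X} (hx : x ∈ U) :
    ∃ (A : Type) (_ : CommRing A) (_ : Algebra ℂ A) (j : Spec (CommRingCat.of A) ⟶ X)
      (_ : IsOpenImmersion j), IsEtaleChart A ∧
      j ≫ f = Spec.map (CommRingCat.ofHom (algebraMap ℂ A)) ∧
      x ∈ j.opensRange ∧ j.opensRange ≤ U := by
  obtain ⟨B, _, _, j, _, hj, ⟨y, hy⟩, hU⟩ := exists_affineChart f hx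
  have := isDomain_of_affineChart (j := j) y
  have := finiteType_of_affineChart hj
  have := smooth_of_affineChart hj hU
  let p : PrimeSpectrum B := y
  have : Algebra.IsSmoothAt ℂ p.asIdeal := by
    infer_instance
  obtain ⟨a, ha, hA⟩ := exists_isEtaleChart_localization p.asIdeal
  let i : Spec (CommRingCat.of (Localization.Away a)) ⟶ Spec (CommRingCat.of B) :=
    Spec.map (CommRingCat.ofHom (algebraMap B (Localization.Away a)))
  have hi : IsOpenImmersion i := by infer_instance
  refine ⟨Localization.Away a, inferInstance, inferInstance, i ≫ j, inferInstance, hA, ?_, ?_, ?_⟩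
  · rw [Category.assoc, hj, ← Spec.map_comp, ← CommRingCat.ofHom_comp,
      ← IsScalarTower.algebraMap_eq]
  · rw [Scheme.Hom.opensRange_comp]
    refine ⟨y, ?_, hy⟩
    have h1 : p ∈ Set.range (PrimeSpectrum.comap (algebraMap B (Localization.Away a))) := by
      rw [PrimeSpectrum.localization_away_comap_range _ a]
      exact ha
    exact h1
  · exact (Scheme.Hom.opensRange_comp i j).le.trans ((j.image_le_opensRange _).trans hU)

end AffineCharts

/-! ### Connectedness properties of complex points -/

section Irreducible

theorem exists_algHom_comp_eq {B A : Type} [CommRing B] [Algebra ℂ B] {P : Ideal B} {b : B}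
    [CommRing A] [Algebra ℂ A] [Algebra (B ⧸ P) A] [IsScalarTower ℂ (B ⧸ P) A]
    [IsLocalization.Away (Ideal.Quotient.mk P b) A] (φ : B →ₐ[ℂ] ℂ)
    (hφ : P ≤ RingHom.ker φ.toRingHom) (hb : φ b ≠ 0) :
    ∃ ψ : A →ₐ[ℂ] ℂ, ψ.comp ((IsScalarTower.toAlgHom ℂ (B ⧸ P) A).comp
      (Ideal.Quotient.mkₐ ℂ P)) = φ := by
  obtain ⟨φ₁, h1⟩ : ∃ φ₁ : (B ⧸ P) →ₐ[ℂ] ℂ, ∀ x, φ₁ (Ideal.Quotient.mk P x) = φ x :=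
    ⟨Ideal.Quotient.liftₐ P φ fun x hx => hφ hx, fun _ => rfl⟩
  have hu : IsUnit (φ₁.toRingHom (Ideal.Quotient.mk P b)) :=
    IsUnit.mk0 _ (by change φ₁ _ ≠ 0; rwa [h1])
  have hl : ∀ x, IsLocalization.Away.lift (S := A) (Ideal.Quotient.mk P b) hu
      (algebraMap (B ⧸ P) A x) = φ₁ x := IsLocalization.Away.lift_eq _ hu
  refine ⟨⟨IsLocalization.Away.lift (S := A) (Ideal.Quotient.mk P b) hu, fun x => ?_⟩,
    AlgHom.ext fun x => ?_⟩
  · rw [IsScalarTower.algebraMap_apply ℂ (B ⧸ P) A]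
    exact (hl _).trans (φ₁.commutes x)
  · exact (hl _).trans (h1 x)

/-- Every irreducible closed subset `Z` of a complex variety contains a nonempty open piece all of
whose Zariski open subsets are connected in the classical topology. Here `Z` is given by its generic
point `ξ` and the piece by an open subset of the ambient variety. -/
theorem exists_open_isPreconnected (g : Y ⟶ SpecC) [LocallyOfFiniteType g] (ξ : Y) :
    ∃ O : Y.Opens, ξ ∈ O ∧ ∀ O' ≤ O,
      IsPreconnected {p : ComplexPoints g | p.point ∈ closure {ξ} ∧ p.point ∈ O'} := by
  obtain ⟨B, _, _, j, _, hj, ⟨y, hy⟩, -⟩ := exists_affineChart g (O := ⊤) (x := ξ) trivial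
  have := finiteType_of_affineChart hj
  let P : PrimeSpectrum B := y
  have : Algebra.FiniteType ℂ (B ⧸ P.asIdeal) :=
    Algebra.FiniteType.of_surjective (Ideal.Quotient.mkₐ ℂ P.asIdeal)
      (Ideal.Quotient.mkₐ_surjective ℂ _)
  obtain ⟨a, ha0, hA⟩ := exists_isEtaleChart_localization_of_isDomain (A := B ⧸ P.asIdeal)
  obtain ⟨b, rfl⟩ := Ideal.Quotient.mk_surjective a
  have hb : b ∉ P.asIdeal := fun h => ha0 (Ideal.Quotient.eq_zero_iff_mem.2 h)
  let A := Localization.Away (Ideal.Quotient.mk P.asIdeal b)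
  let ρ : B →ₐ[ℂ] A := (IsScalarTower.toAlgHom ℂ (B ⧸ P.asIdeal) A).comp
    (Ideal.Quotient.mkₐ ℂ P.asIdeal)
  let i : Spec (CommRingCat.of A) ⟶ Y := Spec.map (CommRingCat.ofHom ρ.toRingHom) ≫ j
  have hi : i ≫ g = Spec.map (CommRingCat.ofHom (algebraMap ℂ A)) := by
    rw [Category.assoc, hj, ← Spec.map_comp, ← CommRingCat.ofHom_comp]
    exact congrArg (fun r => Spec.map (CommRingCat.ofHom r)) ρ.comp_algebraMap
  have hcomp : ∀ φ : A →ₐ[ℂ] ℂ, affinePoint i hi φ = affinePoint j hj (φ.comp ρ) := by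
    intro φ
    apply Subtype.ext
    change Spec.map (CommRingCat.ofHom φ.toRingHom) ≫ i = _
    rw [← Category.assoc, ← Spec.map_comp, ← CommRingCat.ofHom_comp]
    rfl
  have hspec : ∀ φ : B →ₐ[ℂ] ℂ, (affinePoint j hj φ).point ∈ closure {ξ} ↔
      P.asIdeal ≤ RingHom.ker φ.toRingHom := by
    intro φ
    rw [point_affinePoint, ← specializes_iff_mem_closure, ← hy, ← asIdeal_kerPoint]
    exact j.isOpenEmbedding.isInducing.specializes_iff.trans
      (PrimeSpectrum.le_iff_specializes P (kerPoint φ.toRingHom)).symm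
  let D : (Spec (CommRingCat.of B)).Opens := PrimeSpectrum.basicOpen b
  refine ⟨j ''ᵁ D, ⟨y, hb, hy⟩, fun O' hO' => ?_⟩
  have himage : {p : ComplexPoints g | p.point ∈ closure {ξ} ∧ p.point ∈ O'} =
      affinePoint i hi '' {φ | kerPoint φ.toRingHom ∈ i ⁻¹ᵁ O'} := by
    ext p
    constructor
    · rintro ⟨hp, hpO⟩
      have hpj : p ∈ Set.range (affinePoint j hj) := by
        rw [range_affinePoint]
        exact j.image_le_opensRange _ (hO' hpO)
      obtain ⟨φ, rfl⟩ := hpj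
      have hker := (hspec φ).1 hp
      have hφb : φ b ≠ 0 := by
        obtain ⟨x, hx, hxe⟩ := hO' hpO
        have : x = kerPoint φ.toRingHom := j.isOpenEmbedding.injective hxe
        rw [this] at hx
        exact (kerPoint_mem_basicOpen _ _).1 hx
      obtain ⟨φ₂, hφ₂⟩ := exists_algHom_comp_eq (A := A) φ hker hφb
      replace hφ₂ : φ₂.comp ρ = φ := hφ₂
      refine ⟨φ₂, ?_, ?_⟩
      · change (affinePoint i hi φ₂).point ∈ O'
        rw [hcomp, hφ₂]
        exact hpO
      · rw [hcomp, hφ₂]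
    · rintro ⟨φ, hφ, rfl⟩
      refine ⟨?_, hφ⟩
      rw [hcomp, hspec]
      intro x hx
      have h1 : ρ x = 0 := by
        change algebraMap (B ⧸ P.asIdeal) A (Ideal.Quotient.mk P.asIdeal x) = 0
        rw [Ideal.Quotient.eq_zero_iff_mem.2 hx, map_zero]
      change φ (ρ x) = 0
      rw [h1, map_zero]
  rw [himage]
  exact (hA.isPreconnected_kerPoint_mem _).image _ (continuous_affinePoint i hi).continuousOn

end Irreducible

section Smooth

variable {X : Scheme.{0}} {f : X ⟶ SpecC} [IsIntegral X] [LocallyOfFiniteType f]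
  {U : X.Opens} [Smooth (U.ι ≫ f)]

theorem exists_isOpenEmbedding_of_smooth (b : ComplexPoints.ofOpen f U) :
    ∃ (A : Type) (_ : CommRing A) (_ : Algebra ℂ A) (j : Spec (CommRingCat.of A) ⟶ X)
      (_ : IsOpenImmersion j) (k : (A →ₐ[ℂ] ℂ) → ComplexPoints.ofOpen f U), IsEtaleChart A ∧
      Topology.IsOpenEmbedding k ∧ b ∈ Set.range k ∧
      Set.range k = {u | u.1.point ∈ j.opensRange} ∧
      ∀ φ, (k φ).1.point = j (kerPoint φ.toRingHom) := by
  obtain ⟨A, _, _, j, _, hA, hj, hb, hU⟩ := exists_etaleChart_of_smooth (f := f) b.2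
  refine ⟨A, inferInstance, inferInstance, j, inferInstance,
    fun φ => ⟨affinePoint j hj φ, hU ⟨kerPoint φ.toRingHom, rfl⟩⟩, hA, ?_, ?_, ?_,
    fun φ => rfl⟩
  · exact Topology.IsOpenEmbedding.of_comp _
      (ComplexPoints.isOpen_ofOpen U).isOpenEmbedding_subtypeVal (isOpenEmbedding_affinePoint j hj)
  · have : b.1 ∈ Set.range (affinePoint j hj) := by
      rw [range_affinePoint]; exact hb
    obtain ⟨φ, hφ⟩ := this
    exact ⟨φ, Subtype.ext hφ⟩
  · ext u
    have : u.1 ∈ Set.range (affinePoint j hj) ↔ u.1.point ∈ j.opensRange := by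
      rw [range_affinePoint]; rfl
    rw [Set.mem_ofPred_eq, ← this]
    exact ⟨fun ⟨φ, hφ⟩ => ⟨φ, congrArg Subtype.val hφ⟩, fun ⟨φ, hφ⟩ => ⟨φ, Subtype.ext hφ⟩⟩

theorem dense_ofOpen_of_smooth {W : X.Opens} (hW : (W : Set X).Nonempty) :
    Dense {u : ComplexPoints.ofOpen f U | u.1.point ∈ W} := by
  intro b
  obtain ⟨A, _, _, j, _, k, hA, hk, ⟨φ, rfl⟩, -, hpt⟩ := exists_isOpenEmbedding_of_smooth (f := f) b
  obtain ⟨_, ⟨x, rfl⟩, hx⟩ := nonempty_preirreducible_inter (X := X) (s := j.opensRange) (t := W)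
    j.opensRange.isOpen W.isOpen ⟨_, kerPoint φ.toRingHom, rfl⟩ hW
  have hd := hA.dense_kerPoint_mem (j ⁻¹ᵁ W) (x := x) hx
  refine closure_mono ?_ (image_closure_subset_closure_image hk.continuous
    (Set.mem_image_of_mem k (hd φ)))
  rintro _ ⟨ψ, hψ, rfl⟩
  change (k ψ).1.point ∈ W
  rw [hpt]
  exact hψ

theorem locallyNonseparating_ofOpen_of_smooth (W : X.Opens) :
    LocallyNonseparating {u : ComplexPoints.ofOpen f U | u.1.point ∈ W} := by
  intro b O hO
  obtain ⟨A, _, _, j, _, k, hA, hk, ⟨φ, rfl⟩, -, hpt⟩ := exists_isOpenEmbedding_of_smooth (f := f) b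
  obtain ⟨N, hNO, hN, hφ, hp, hc⟩ := hA.exists_nhd φ (hk.continuous.continuousAt hO) (j ⁻¹ᵁ W)
  refine ⟨k '' N, Set.image_subset_iff.2 hNO, hk.isOpenMap _ hN, ⟨φ, hφ, rfl⟩,
    hp.image hk.continuous, ?_⟩
  have : k '' N ∩ {u | u.1.point ∈ W} = k '' (N ∩ {φ | kerPoint φ.toRingHom ∈ j ⁻¹ᵁ W}) := by
    rw [← Set.image_inter_preimage]
    congr 2
    ext ψ
    change (k ψ).1.point ∈ W ↔ _
    rw [hpt]
    rfl
  rw [this]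
  exact hc.image _ hk.continuous.continuousOn

variable (f U) in
/-- A smooth Zariski open subset of an irreducible complex variety is connected in the classical
topology. -/
theorem preconnectedSpace_ofOpen_of_smooth : PreconnectedSpace (ComplexPoints.ofOpen f U) := by
  refine ⟨isPreconnected_of_forall_pair fun b _ b' _ => ?_⟩
  obtain ⟨A, _, _, j, _, k, hA, hk, hb, hr, -⟩ := exists_isOpenEmbedding_of_smooth (f := f) b
  obtain ⟨A', _, _, j', _, k', hA', hk', hb', -, -⟩ := exists_isOpenEmbedding_of_smooth (f := f) b'
  refine ⟨Set.range k ∪ Set.range k', Set.subset_univ _, Or.inl hb, Or.inr hb', ?_⟩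
  have hd := dense_ofOpen_of_smooth (f := f) (U := U) (W := j.opensRange) (by
    obtain ⟨φ, -⟩ := hb
    exact ⟨_, kerPoint φ.toRingHom, rfl⟩)
  obtain ⟨u, hu, hu'⟩ := hd.inter_open_nonempty _ hk'.isOpen_range ⟨b', hb'⟩
  have h1 := hA.isPreconnected_univ.image k hk.continuous.continuousOn
  have h2 := hA'.isPreconnected_univ.image k' hk'.continuous.continuousOn
  rw [Set.image_univ] at h1 h2
  exact h1.union u (by rw [hr]; exact hu') hu h2

end Smooth

/-! ### Complex points of the fiber square -/

section FiberSquare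

variable {E C : Scheme.{0}} {e : E ⟶ SpecC} {c : C ⟶ SpecC} {π : E ⟶ C} (hπ : π ≫ c = e)

/-- The complex point of the fiber square given by two complex points with the same image. -/
noncomputable def pairPoint (x y : ComplexPoints e)
    (h : ComplexPoints.map π hπ x = ComplexPoints.map π hπ y) :
    ComplexPoints (pullback.fst π π ≫ e) :=
  ⟨pullback.lift x.1 y.1 (congrArg Subtype.val h),
    (pullback.lift_fst_assoc _ _ _ _).trans x.2⟩

theorem snd_comp (hπ : π ≫ c = e) : pullback.snd π π ≫ e = pullback.fst π π ≫ e := by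
  rw [← hπ, pullback.condition_assoc]

theorem map_fst_pairPoint (x y : ComplexPoints e)
    (h : ComplexPoints.map π hπ x = ComplexPoints.map π hπ y) :
    ComplexPoints.map (pullback.fst π π) rfl (pairPoint hπ x y h) = x :=
  Subtype.ext (pullback.lift_fst _ _ _)

theorem map_snd_pairPoint (x y : ComplexPoints e)
    (h : ComplexPoints.map π hπ x = ComplexPoints.map π hπ y) :
    ComplexPoints.map (pullback.snd π π) (snd_comp hπ) (pairPoint hπ x y h) = y :=
  Subtype.ext (pullback.lift_snd _ _ _)

theorem map_fst_eq_map_snd (p : ComplexPoints (pullback.fst π π ≫ e)) :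
    ComplexPoints.map π hπ (ComplexPoints.map (pullback.fst π π) rfl p) =
      ComplexPoints.map π hπ (ComplexPoints.map (pullback.snd π π) (snd_comp hπ) p) := by
  apply Subtype.ext
  change (p.1 ≫ pullback.fst π π) ≫ π = (p.1 ≫ pullback.snd π π) ≫ π
  rw [Category.assoc, Category.assoc, pullback.condition]

theorem pairPoint_map (p : ComplexPoints (pullback.fst π π ≫ e)) :
    pairPoint hπ (ComplexPoints.map (pullback.fst π π) rfl p)
      (ComplexPoints.map (pullback.snd π π) (snd_comp hπ) p) (map_fst_eq_map_snd hπ p) = p := by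
  apply Subtype.ext
  apply pullback.hom_ext
  · exact pullback.lift_fst _ _ _
  · exact pullback.lift_snd _ _ _

theorem exists_affineChart_over (hπ : π ≫ c = e) {B : Type} [CommRing B] [Algebra ℂ B]
    (j : Spec (CommRingCat.of B) ⟶ C) [IsOpenImmersion j]
    (hj : j ≫ c = Spec.map (CommRingCat.ofHom (algebraMap ℂ B))) {x : E}
    (hx : π x ∈ j.opensRange) :
    ∃ (A : Type) (_ : CommRing A) (_ : Algebra ℂ A) (_ : Algebra B A)
      (i : Spec (CommRingCat.of A) ⟶ E)
      (_ : IsOpenImmersion i), IsScalarTower ℂ B A ∧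
      i ≫ e = Spec.map (CommRingCat.ofHom (algebraMap ℂ A)) ∧
      i ≫ π = Spec.map (CommRingCat.ofHom (algebraMap B A)) ≫ j ∧
      x ∈ i.opensRange := by
  obtain ⟨A, _, _, i, _, hi, hxi, hiO⟩ := exists_affineChart e (O := π ⁻¹ᵁ j.opensRange) (x := x) hx
  have hr : Set.range (i ≫ π) ⊆ Set.range j := by
    rintro _ ⟨y, rfl⟩
    exact hiO ⟨y, rfl⟩
  let q := IsOpenImmersion.lift j (i ≫ π) hr
  have hq : q ≫ j = i ≫ π := IsOpenImmersion.lift_fac _ _ _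
  let : Algebra B A := (Spec.preimage q).hom.toAlgebra
  have hq' : q = Spec.map (CommRingCat.ofHom (algebraMap B A)) := (Spec.map_preimage q).symm
  refine ⟨A, inferInstance, inferInstance, inferInstance, i, inferInstance, ?_, hi, ?_, hxi⟩
  · apply IsScalarTower.of_algebraMap_eq'
    have : Spec.map (CommRingCat.ofHom (algebraMap ℂ A)) =
        Spec.map (CommRingCat.ofHom ((algebraMap B A).comp (algebraMap ℂ B))) := by
      rw [CommRingCat.ofHom_comp, Spec.map_comp, ← hj, ← hq', ← Category.assoc, hq, Category.assoc,
        hπ, hi]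
    exact congrArg CommRingCat.Hom.hom (Spec.map_injective this)
  · rw [← hq, hq']

open TensorProduct in
theorem continuous_lift_apply {B A₁ A₂ : Type} [CommRing B] [CommRing A₁] [CommRing A₂]
    [Algebra ℂ A₁] [Algebra ℂ A₂] [Algebra B A₁] [Algebra B A₂] (t : A₁ ⊗[B] A₂) :
    ∃ F : (A₁ →ₐ[ℂ] ℂ) × (A₂ →ₐ[ℂ] ℂ) → ℂ, Continuous F ∧
      ∀ (φ₁ : A₁ →ₐ[ℂ] ℂ) (φ₂ : A₂ →ₐ[ℂ] ℂ) (φ : A₁ ⊗[B] A₂ →+* ℂ),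
        (∀ a, φ (a ⊗ₜ 1) = φ₁ a) → (∀ a, φ (1 ⊗ₜ a) = φ₂ a) → φ t = F (φ₁, φ₂) := by
  induction t with
  | zero => exact ⟨0, continuous_const, fun _ _ φ _ _ => by simp⟩
  | tmul a b =>
    refine ⟨fun q => q.1 a * q.2 b, ((continuous_algHom_apply a).comp continuous_fst).mul
      ((continuous_algHom_apply b).comp continuous_snd), fun φ₁ φ₂ φ h1 h2 => ?_⟩
    have : a ⊗ₜ[B] b = (a ⊗ₜ 1) * (1 ⊗ₜ b) := by simp
    rw [this, map_mul, h1, h2]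
  | add s t hs ht =>
    obtain ⟨F, hF, h⟩ := hs
    obtain ⟨G, hG, h'⟩ := ht
    exact ⟨fun q => F q + G q, hF.add hG, fun φ₁ φ₂ φ h1 h2 => by
      rw [map_add, h φ₁ φ₂ φ h1 h2, h' φ₁ φ₂ φ h1 h2]⟩

open TensorProduct in
/-- Zariski open subsets of the fiber square are open for the topology on its complex points that
comes from the product of two copies of `E(ℂ)`. -/
theorem isOpen_pairPoint_mem (O : (fiberSquare π).Opens) :
    IsOpen {q : {q : ComplexPoints e × ComplexPoints e //
      ComplexPoints.map π hπ q.1 = ComplexPoints.map π hπ q.2} |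
      (pairPoint hπ q.1.1 q.1.2 q.2).point ∈ O} := by
  rw [isOpen_iff_mem_nhds]
  rintro ⟨⟨x, y⟩, h⟩ hO
  simp only at h hO
  obtain ⟨B, _, _, j, _, hj, hzj, -⟩ :=
    exists_affineChart c (O := ⊤) (x := (ComplexPoints.map π hπ x).point) trivial
  obtain ⟨A₁, _, _, _, i₁, _, _, hi₁, hij₁, hx₁⟩ :=
    exists_affineChart_over hπ j hj (x := x.point) hzj
  obtain ⟨A₂, _, _, _, i₂, _, _, hi₂, hij₂, hx₂⟩ :=
    exists_affineChart_over hπ j hj (x := y.point) (by rw [h] at hzj; exact hzj)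
  let m : pullback (Spec.map (CommRingCat.ofHom (algebraMap B A₁)))
      (Spec.map (CommRingCat.ofHom (algebraMap B A₂))) ⟶ pullback π π :=
    pullback.map _ _ _ _ i₁ i₂ j hij₁.symm hij₂.symm
  have hm : IsOpenImmersion m := inferInstance
  let J : Spec (CommRingCat.of (A₁ ⊗[B] A₂)) ⟶ fiberSquare π := (pullbackSpecIso B A₁ A₂).inv ≫ m
  have hJ1 : J ≫ pullback.fst π π =
      Spec.map (CommRingCat.ofHom Algebra.TensorProduct.includeLeftRingHom) ≫ i₁ := by
    simp only [J, m, Category.assoc, pullback.map, pullback.lift_fst]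
    rw [pullbackSpecIso_inv_fst_assoc]
  have hJ2 : J ≫ pullback.snd π π = Spec.map (CommRingCat.ofHom (R := A₂) (S := A₁ ⊗[B] A₂)
      (RingHomClass.toRingHom (Algebra.TensorProduct.includeRight : A₂ →ₐ[B] A₁ ⊗[B] A₂))) ≫ i₂ := by
    simp only [J, m, Category.assoc, pullback.map, pullback.lift_snd]
    rw [pullbackSpecIso_inv_snd_assoc]
  -- a pair of points of the charts with the same image is given by a homomorphism on the tensor
  -- product
  have key : ∀ (φ₁ : A₁ →ₐ[ℂ] ℂ) (φ₂ : A₂ →ₐ[ℂ] ℂ)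
      (h : ComplexPoints.map π hπ (affinePoint i₁ hi₁ φ₁) =
        ComplexPoints.map π hπ (affinePoint i₂ hi₂ φ₂)),
      ∃ φ : A₁ ⊗[B] A₂ →+* ℂ, (∀ a, φ (a ⊗ₜ 1) = φ₁ a) ∧ (∀ a, φ (1 ⊗ₜ a) = φ₂ a) ∧
        (pairPoint hπ _ _ h).point = J (kerPoint φ) := by
    intro φ₁ φ₂ h
    have h1 := congrArg Subtype.val h
    have h2 : φ₁.toRingHom.comp (algebraMap B A₁) = φ₂.toRingHom.comp (algebraMap B A₂) := by
      have : Spec.map (CommRingCat.ofHom (φ₁.toRingHom.comp (algebraMap B A₁))) =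
          Spec.map (CommRingCat.ofHom (φ₂.toRingHom.comp (algebraMap B A₂))) := by
        rw [← cancel_mono j]
        simp only [CommRingCat.ofHom_comp, Spec.map_comp, Category.assoc, ← hij₁, ← hij₂]
        simpa only [ComplexPoints.map, affinePoint, Category.assoc] using h1
      exact congrArg CommRingCat.Hom.hom (Spec.map_injective this)
    let : Algebra B ℂ := (φ₁.toRingHom.comp (algebraMap B A₁)).toAlgebra
    let ψ₁ : A₁ →ₐ[B] ℂ := { φ₁.toRingHom with commutes' := fun _ => rfl }
    let ψ₂ : A₂ →ₐ[B] ℂ := { φ₂.toRingHom with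
      commutes' := fun b => (congrArg (fun r : B →+* ℂ => r b) h2).symm }
    let φ : A₁ ⊗[B] A₂ →ₐ[B] ℂ := Algebra.TensorProduct.lift ψ₁ ψ₂ fun _ _ => Commute.all _ _
    have e1 : ∀ a, φ (a ⊗ₜ 1) = φ₁ a := fun a => by
      have : φ (a ⊗ₜ 1) = ψ₁ a * ψ₂ 1 := Algebra.TensorProduct.lift_tmul _ _ _ _ _
      rw [this, map_one, mul_one]; rfl
    have e2 : ∀ a, φ (1 ⊗ₜ a) = φ₂ a := fun a => by
      have : φ (1 ⊗ₜ a) = ψ₁ 1 * ψ₂ a := Algebra.TensorProduct.lift_tmul _ _ _ _ _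
      rw [this, map_one, one_mul]; rfl
    refine ⟨φ.toRingHom, e1, e2, ?_⟩
    have h3 : (pairPoint hπ _ _ h).1 = Spec.map (CommRingCat.ofHom φ.toRingHom) ≫ J := by
      apply pullback.hom_ext
      · rw [Category.assoc, hJ1, ← Category.assoc, ← Spec.map_comp, ← CommRingCat.ofHom_comp]
        refine (pullback.lift_fst _ _ _).trans ?_
        have : φ.toRingHom.comp Algebra.TensorProduct.includeLeftRingHom = φ₁.toRingHom :=
          RingHom.ext e1
        rw [this]; rfl
      · rw [Category.assoc, hJ2, ← Category.assoc, ← Spec.map_comp, ← CommRingCat.ofHom_comp]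
        refine (pullback.lift_snd _ _ _).trans ?_
        have : φ.toRingHom.comp (RingHomClass.toRingHom
            (Algebra.TensorProduct.includeRight : A₂ →ₐ[B] A₁ ⊗[B] A₂)) = φ₂.toRingHom :=
          RingHom.ext e2
        rw [this]; rfl
    have h4 : (pairPoint hπ _ _ h).point =
        (Spec.map (CommRingCat.ofHom φ.toRingHom) ≫ J) (IsLocalRing.closedPoint ℂ) := by
      rw [← h3]; rfl
    exact h4
  obtain ⟨φ₁, rfl⟩ : x ∈ Set.range (affinePoint i₁ hi₁) := by rw [range_affinePoint]; exact hx₁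
  obtain ⟨φ₂, rfl⟩ : y ∈ Set.range (affinePoint i₂ hi₂) := by rw [range_affinePoint]; exact hx₂
  obtain ⟨φ, e1, e2, e3⟩ := key φ₁ φ₂ h
  have hφO : kerPoint φ ∈ J ⁻¹ᵁ O := by
    have hO' : (pairPoint hπ _ _ h).point ∈ O := hO
    rw [e3] at hO'
    exact hO'
  obtain ⟨t, ht, htO⟩ := exists_basicOpen_le (J ⁻¹ᵁ O) hφO
  obtain ⟨F, hF, hFt⟩ := continuous_lift_apply t
  have hopen : IsOpen (Prod.map (affinePoint i₁ hi₁) (affinePoint i₂ hi₂) '' {q | F q ≠ 0}) :=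
    ((isOpenEmbedding_affinePoint i₁ hi₁).isOpenMap.prodMap
      (isOpenEmbedding_affinePoint i₂ hi₂).isOpenMap) _ (isOpen_ne_fun hF continuous_const)
  refine Filter.mem_of_superset ((hopen.preimage continuous_subtype_val).mem_nhds
    ⟨(φ₁, φ₂), ?_, rfl⟩) ?_
  · change F (φ₁, φ₂) ≠ 0
    rw [← hFt φ₁ φ₂ φ e1 e2]
    exact (kerPoint_mem_basicOpen _ _).1 ht
  · rintro ⟨⟨x', y'⟩, h'⟩ ⟨⟨ψ₁, ψ₂⟩, hψ, hψe⟩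
    obtain ⟨rfl, rfl⟩ := Prod.mk.inj hψe
    obtain ⟨ψ, e1', e2', e3'⟩ := key ψ₁ ψ₂ h'
    change (pairPoint hπ _ _ h').point ∈ O
    rw [e3']
    refine htO ((kerPoint_mem_basicOpen _ _).2 ?_)
    rw [hFt ψ₁ ψ₂ ψ e1' e2']
    exact hψ

end FiberSquare

/-! ### Algebraicity of generically finite extensions -/

section Algebraicity

/-- Chevalley's theorem: the image of a dominant morphism of integral affine varieties contains a
nonempty basic open set. -/
theorem exists_basicOpen_subset_range_comap {A B : Type*} [CommRing A] [IsDomain A]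
    [IsNoetherianRing A] [CommRing B] [IsDomain B] [Algebra A B] [Algebra.FiniteType A B]
    (hinj : Function.Injective (algebraMap A B)) :
    ∃ a : A, a ≠ 0 ∧ ∀ x : PrimeSpectrum A, a ∉ x.asIdeal →
      x ∈ Set.range (PrimeSpectrum.comap (algebraMap A B)) := by
  have hfp : (algebraMap A B).FinitePresentation :=
    (RingHom.finitePresentation_algebraMap).2 (Algebra.FinitePresentation.of_finiteType.1 ‹_›)
  obtain ⟨S, hS⟩ := PrimeSpectrum.exists_constructibleSetData_iff.2
    (PrimeSpectrum.isConstructible_range_comap hfp)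
  have hbot : (⊥ : PrimeSpectrum A) ∈ Set.range (PrimeSpectrum.comap (algebraMap A B)) := by
    refine ⟨⊥, PrimeSpectrum.ext ?_⟩
    change Ideal.comap (algebraMap A B) ⊥ = ⊥
    rw [← RingHom.ker_eq_comap_bot, (RingHom.injective_iff_ker_eq_bot _).1 hinj]
  rw [← hS] at hbot ⊢
  simp only [PrimeSpectrum.ConstructibleSetData.toSet, Set.mem_iUnion] at hbot ⊢
  obtain ⟨D, hDS, hD⟩ := hbot
  have h1 : ∀ i, D.g i = 0 := fun i => by
    have := hD.1 ⟨i, rfl⟩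
    simpa using this
  refine ⟨D.f, fun h => hD.2 ?_, fun x hx => ⟨D, hDS, ?_, ?_⟩⟩
  · rw [h]; simp
  · rintro _ ⟨i, rfl⟩
    rw [h1 i]
    exact x.asIdeal.zero_mem
  · simpa using hx

variable {A B : Type} [CommRing A] [Algebra ℂ A]

theorem isMaximal_ker_algHom (φ : A →ₐ[ℂ] ℂ) : (RingHom.ker φ.toRingHom).IsMaximal :=
  RingHom.ker_isMaximal_of_surjective _ fun x => ⟨algebraMap ℂ A x, φ.commutes x⟩

theorem algHom_ext_of_ker_le {φ ψ : A →ₐ[ℂ] ℂ}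
    (h : RingHom.ker φ.toRingHom ≤ RingHom.ker ψ.toRingHom) : φ = ψ := by
  ext x
  have h1 : φ (x - algebraMap ℂ A (φ x)) = 0 := by simp
  have h2 : ψ (x - algebraMap ℂ A (φ x)) = 0 := h h1
  rw [map_sub, ψ.commutes, sub_eq_zero] at h2
  exact h2.symm

variable [CommRing B] [Algebra ℂ B] [Algebra A B]
  [IsScalarTower ℂ A B]

/-- The Nullstellensatz for fibers: a point of an affine variety extends to a point of a variety
over it as soon as its fiber is nonempty. -/
theorem exists_algHom_extension [Algebra.FiniteType ℂ B] (φ : A →ₐ[ℂ] ℂ)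
    (h : kerPoint φ.toRingHom ∈ Set.range (PrimeSpectrum.comap (algebraMap A B))) :
    ∃ ψ : B →ₐ[ℂ] ℂ, ∀ x, ψ (algebraMap A B x) = φ x := by
  let f : Spec (CommRingCat.of B) ⟶ SpecC := Spec.map (CommRingCat.ofHom (algebraMap ℂ B))
  have : LocallyOfFiniteType f :=
    (HasRingHomProperty.Spec_iff (P := @LocallyOfFiniteType)).2
      ((RingHom.finiteType_algebraMap).2 inferInstance)
  have hcl : IsClosed {kerPoint φ.toRingHom} := by
    rw [PrimeSpectrum.isClosed_singleton_iff_isMaximal, asIdeal_kerPoint]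
    exact isMaximal_ker_algHom φ
  obtain ⟨x, hx⟩ := h
  obtain ⟨p, hp⟩ := ComplexPoints.exists_point_mem (f := f)
    (S := PrimeSpectrum.comap (algebraMap A B) ⁻¹' {kerPoint φ.toRingHom})
    (hcl.preimage (PrimeSpectrum.continuous_comap _)).isLocallyClosed ⟨x, hx⟩
  have hj : 𝟙 (Spec (CommRingCat.of B)) ≫ f =
      Spec.map (CommRingCat.ofHom (algebraMap ℂ B)) := Category.id_comp _
  obtain ⟨ψ, rfl⟩ : p ∈ Set.range (affinePoint (𝟙 (Spec (CommRingCat.of B))) hj) := by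
    rw [range_affinePoint]
    exact ⟨p.point, rfl⟩
  refine ⟨ψ, fun x => ?_⟩
  let ψ' : A →ₐ[ℂ] ℂ := ψ.comp (IsScalarTower.toAlgHom ℂ A B)
  have h1 : RingHom.ker φ.toRingHom ≤ RingHom.ker ψ'.toRingHom := by
    have h2 : PrimeSpectrum.comap (algebraMap A B) (kerPoint ψ.toRingHom) =
      kerPoint φ.toRingHom := hp
    rw [← asIdeal_kerPoint φ.toRingHom, ← h2]
    intro y hy
    have : algebraMap A B y ∈ (kerPoint ψ.toRingHom).asIdeal := hy
    rw [asIdeal_kerPoint] at this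
    exact this
  exact (DFunLike.congr_fun (algHom_ext_of_ker_le h1) x).symm

theorem finiteType_localization [Algebra.FiniteType ℂ A] (a : A) :
    Algebra.FiniteType ℂ (Localization.Away a) :=
  have := IsLocalization.Away.finitePresentation (S := Localization.Away a) a
  Algebra.FiniteType.trans (S := A) inferInstance inferInstance

theorem exists_algHom_ne_zero [IsDomain A] [Algebra.FiniteType ℂ A] {a : A} (ha : a ≠ 0) :
    ∃ φ : A →ₐ[ℂ] ℂ, φ a ≠ 0 := by
  have hn : Nontrivial (Localization.Away a) :=
    (IsLocalization.isDomain_localization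
        (powers_le_nonZeroDivisors_of_noZeroDivisors ha)).toNontrivial
  have := finiteType_localization a
  obtain ⟨x⟩ : Nonempty (PrimeSpectrum (Localization.Away a)) := inferInstance
  obtain ⟨ψ, -⟩ := exists_algHom_extension (B := Localization.Away a) (Algebra.ofId ℂ ℂ) (by
    refine ⟨x, ?_⟩
    exact Subsingleton.elim (α := PrimeSpectrum ℂ) _ _)
  refine ⟨ψ.comp (IsScalarTower.toAlgHom ℂ A _), ?_⟩
  have hu : IsUnit (algebraMap A (Localization.Away a) a) :=
    IsLocalization.map_units _ (⟨a, Submonoid.mem_powers a⟩ : Submonoid.powers a)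
  exact (hu.map ψ).ne_zero

/-- A dominant morphism of integral affine varieties whose fibers over a nonempty open set have only
finitely many complex points is generically algebraic: a transcendental element would take
infinitely many values on a general fiber, by Chevalley's theorem. -/
theorem isAlgebraic_of_finite_fibers [IsDomain A] [IsDomain B] [Algebra.FiniteType ℂ A]
    [Algebra.FiniteType ℂ B] {a : A} (ha : a ≠ 0)
    (hfin : ∀ φ : A →ₐ[ℂ] ℂ, φ a ≠ 0 →
      {ψ : B →ₐ[ℂ] ℂ | ∀ x, ψ (algebraMap A B x) = φ x}.Finite) :
    Algebra.IsAlgebraic A B := by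
  refine ⟨fun t => ?_⟩
  by_contra ht
  have htr : Function.Injective (Polynomial.aeval t : Polynomial A →ₐ[A] B) :=
    transcendental_iff_injective.1 ht
  let : Algebra (Polynomial A) B := (Polynomial.aeval t : Polynomial A →ₐ[A] B).toRingHom.toAlgebra
  have hmap : ∀ p : Polynomial A, algebraMap (Polynomial A) B p = Polynomial.aeval t p := fun _ => rfl
  have : IsScalarTower ℂ (Polynomial A) B := IsScalarTower.of_algebraMap_eq fun x => by
    rw [hmap, IsScalarTower.algebraMap_apply ℂ A (Polynomial A), Polynomial.algebraMap_eq,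
      Polynomial.aeval_C, ← IsScalarTower.algebraMap_apply]
  have : Algebra.FiniteType (Polynomial A) B :=
    Algebra.FiniteType.of_restrictScalars_finiteType ℂ _ _
  have : IsNoetherianRing A := Algebra.FiniteType.isNoetherianRing ℂ A
  obtain ⟨g, hg, hrange⟩ := exists_basicOpen_subset_range_comap
    (A := Polynomial A) (B := B) htr
  obtain ⟨φ, hφ⟩ := exists_algHom_ne_zero (A := A)
    (mul_ne_zero ha (Polynomial.leadingCoeff_ne_zero.2 hg))
  rw [map_mul, mul_ne_zero_iff] at hφ
  have hgφ : g.map φ.toRingHom ≠ 0 := fun h => hφ.2 (by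
    have := congrArg (fun p => p.coeff g.natDegree) h
    simpa using this)
  have key : ∀ τ : ℂ, (g.map φ.toRingHom).eval τ ≠ 0 → ∃ ψ : B →ₐ[ℂ] ℂ,
      (∀ x, ψ (algebraMap A B x) = φ x) ∧ ψ t = τ := by
    intro τ hτ
    let χ : Polynomial A →ₐ[ℂ] ℂ := 
      { Polynomial.eval₂RingHom φ.toRingHom τ with
        commutes' := fun x => by
          change Polynomial.eval₂ φ.toRingHom τ (algebraMap ℂ (Polynomial A) x) = x
          rw [IsScalarTower.algebraMap_apply ℂ A (Polynomial A), Polynomial.algebraMap_eq,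
            Polynomial.eval₂_C]
          exact φ.commutes x }
    have hχ : χ g ≠ 0 := by
      change Polynomial.eval₂ φ.toRingHom τ g ≠ 0
      rwa [← Polynomial.eval_map]
    obtain ⟨ψ, hψ⟩ := exists_algHom_extension (B := B) χ (hrange _ (by
      rw [asIdeal_kerPoint]; exact hχ))
    refine ⟨ψ, fun x => ?_, ?_⟩
    · have := hψ (Polynomial.C x)
      rw [hmap, Polynomial.aeval_C] at this
      rw [this]
      exact Polynomial.eval₂_C _ _
    · have := hψ Polynomial.X
      rw [hmap, Polynomial.aeval_X] at this
      rw [this]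
      exact Polynomial.eval₂_X _ _
  have hinf : {τ : ℂ | (g.map φ.toRingHom).eval τ ≠ 0}.Infinite := by
    have hf : {τ : ℂ | (g.map φ.toRingHom).eval τ = 0}.Finite := by
      refine ((g.map φ.toRingHom).roots.toFinset.finite_toSet).subset fun τ hτ => ?_
      rw [Finset.mem_coe, Multiset.mem_toFinset, Polynomial.mem_roots hgφ]
      exact hτ
    exact hf.infinite_compl
  refine hinf (((hfin φ hφ.1).image fun ψ => ψ t).subset fun τ hτ => ?_)
  obtain ⟨ψ, h1, h2⟩ := key τ hτ
  exact ⟨ψ, h1, h2⟩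

end Algebraicity

/-! ### Dimension -/

section KrullDimension

/-- Going up: an injective integral ring homomorphism preserves the Krull dimension. -/
theorem ringKrullDim_eq_of_isIntegral {R S : Type*} [CommRing R] [CommRing S] [Algebra R S]
    [Algebra.IsIntegral R S] (hinj : Function.Injective (algebraMap R S)) :
    ringKrullDim S = ringKrullDim R := by
  refine le_antisymm (Order.krullDim_le_of_strictMono (PrimeSpectrum.comap (algebraMap R S))
    fun P Q h => Ideal.IsIntegral.comap_lt_comap (R := R) (I := P.asIdeal) (J := Q.asIdeal) h) ?_
  have key : ∀ p : LTSeries (PrimeSpectrum R), ∃ q : LTSeries (PrimeSpectrum S),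
      q.length = p.length ∧ PrimeSpectrum.comap (algebraMap R S) q.last = p.last := by
    intro p
    induction p using RelSeries.inductionOn' with
    | singleton x =>
      obtain ⟨Q, -, hQ, hQx⟩ := Ideal.exists_ideal_over_prime_of_isIntegral (S := S) x.asIdeal ⊥ (by
        rw [← RingHom.ker_eq_comap_bot, (RingHom.injective_iff_ker_eq_bot _).1 hinj]
        exact bot_le)
      exact ⟨RelSeries.singleton _ ⟨Q, hQ⟩, rfl, PrimeSpectrum.ext hQx⟩
    | snoc p x hx hp =>
      obtain ⟨q, hq, hql⟩ := hp
      have hle : p.last ≤ x := le_of_lt hx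
      obtain ⟨Q, hle', hQ, hQx⟩ := Ideal.exists_ideal_over_prime_of_isIntegral (S := S) x.asIdeal
        q.last.asIdeal (by rw [← PrimeSpectrum.comap_asIdeal, hql]; exact hle)
      have hlt : q.last < ⟨Q, hQ⟩ := by
        refine lt_of_le_of_ne hle' fun h => ?_
        have h1 : p.last = x := by
          rw [← hql, h]
          exact PrimeSpectrum.ext hQx
        exact (ne_of_lt hx) h1
      refine ⟨RelSeries.snoc q ⟨Q, hQ⟩ hlt, ?_, ?_⟩
      · rw [RelSeries.snoc_length, RelSeries.snoc_length, hq]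
      · rw [RelSeries.last_snoc, RelSeries.last_snoc]
        exact PrimeSpectrum.ext hQx
  refine iSup_le fun p => ?_
  obtain ⟨q, hq, -⟩ := key p
  rw [← hq]
  exact Order.LTSeries.length_le_krullDim q

/-- The dimension of an integral affine variety is its transcendence degree. -/
theorem exists_ringKrullDim_eq (A : Type) [CommRing A] [IsDomain A] [Algebra ℂ A]
    [Algebra.FiniteType ℂ A] : ∃ n : ℕ, ringKrullDim A = n ∧ Algebra.trdeg ℂ A = n := by
  obtain ⟨n, g, hg, hfin⟩ := exists_finite_inj_algHom_of_fg ℂ A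
  let : Algebra (MvPolynomial (Fin n) ℂ) A := g.toRingHom.toAlgebra
  have : IsScalarTower ℂ (MvPolynomial (Fin n) ℂ) A :=
    IsScalarTower.of_algebraMap_eq' g.comp_algebraMap.symm
  have : Module.Finite (MvPolynomial (Fin n) ℂ) A := hfin
  have hinj : Function.Injective (algebraMap (MvPolynomial (Fin n) ℂ) A) := hg
  have : FaithfulSMul (MvPolynomial (Fin n) ℂ) A :=
    (faithfulSMul_iff_algebraMap_injective _ _).2 hinj
  refine ⟨n, ?_, ?_⟩
  · rw [ringKrullDim_eq_of_isIntegral hinj, MvPolynomial.ringKrullDim_of_isNoetherianRing,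
      ringKrullDim_eq_zero_of_field]
    simp
  · rw [← trdeg_add_eq ℂ (MvPolynomial (Fin n) ℂ) (A := A),
      trdeg_eq_zero (R := MvPolynomial (Fin n) ℂ) (A := A),
      MvPolynomial.trdeg_of_isDomain]
    simp

theorem ringKrullDim_eq_of_isAlgebraic {A B : Type} [CommRing A] [IsDomain A] [Algebra ℂ A]
    [Algebra.FiniteType ℂ A] [CommRing B] [IsDomain B] [Algebra ℂ B] [Algebra.FiniteType ℂ B]
    [Algebra A B] [IsScalarTower ℂ A B] [Algebra.IsAlgebraic A B]
    (hinj : Function.Injective (algebraMap A B)) : ringKrullDim B = ringKrullDim A := by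
  have : FaithfulSMul A B := (faithfulSMul_iff_algebraMap_injective _ _).2 hinj
  obtain ⟨n, hn, hn'⟩ := exists_ringKrullDim_eq A
  obtain ⟨m, hm, hm'⟩ := exists_ringKrullDim_eq B
  have h := trdeg_add_eq ℂ A (A := B)
  rw [hn', hm', trdeg_eq_zero, add_zero, Nat.cast_inj] at h
  rw [hn, hm, h]

theorem ringKrullDim_localization_away {A : Type} [CommRing A] [IsDomain A] [Algebra ℂ A]
    [Algebra.FiniteType ℂ A] {a : A} (ha : a ≠ 0) :
    ringKrullDim (Localization.Away a) = ringKrullDim A := by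
  have hle := powers_le_nonZeroDivisors_of_noZeroDivisors ha
  have : IsDomain (Localization.Away a) := IsLocalization.isDomain_localization hle
  have := finiteType_localization a
  have : Algebra.IsAlgebraic A (Localization.Away a) :=
    IsLocalization.isAlgebraic (Localization.Away a) (Submonoid.powers a)
  exact ringKrullDim_eq_of_isAlgebraic (IsLocalization.injective _ hle)

end KrullDimension

section TopologicalKrullDim

open TopologicalSpace

theorem topologicalKrullDim_mono {X : Type*} [TopologicalSpace X] {S T : Set X} (h : S ⊆ T) :
    topologicalKrullDim S ≤ topologicalKrullDim T :=
  (Topology.IsEmbedding.inclusion h).isInducing.topologicalKrullDim_le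

/-- The dimension can be bounded locally. -/
theorem topologicalKrullDim_le_of_forall_exists_isOpen {X : Type*} [TopologicalSpace X] {T : Set X}
    {d : WithBot ℕ∞} (h : ∀ x ∈ T, ∃ O : Set X, IsOpen O ∧ x ∈ O ∧
      topologicalKrullDim ↑(T ∩ O) ≤ d) : topologicalKrullDim T ≤ d := by
  refine iSup_le fun p => ?_
  obtain ⟨⟨x, hxT⟩, hx⟩ := p.head.isIrreducible.nonempty
  obtain ⟨O, hO, hxO, hd⟩ := h x hxT
  let j : ↑(T ∩ O) → T := Set.inclusion Set.inter_subset_left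
  have hj : Topology.IsOpenEmbedding j := by
    refine ⟨Topology.IsEmbedding.inclusion _, ?_⟩
    have : Set.range j = Subtype.val ⁻¹' O := by
      ext y
      exact ⟨fun ⟨z, hz⟩ => hz ▸ z.2.2, fun hy => ⟨⟨y.1, y.2, hy⟩, rfl⟩⟩
    rw [this]
    exact hO.preimage continuous_subtype_val
  have hmem : ∀ i, ⟨x, hxT⟩ ∈ (p i : Set T) := fun i => p.head_le i hx
  have hne : ∀ i, ((p i : Set T) ∩ Set.range j).Nonempty := fun i =>
    ⟨⟨x, hxT⟩, hmem i, ⟨x, hxT, hxO⟩, rfl⟩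
  let r : Fin (p.length + 1) → IrreducibleCloseds ↑(T ∩ O) := fun i =>
    ⟨j ⁻¹' (p i), (p i).isIrreducible.preimage hj (hne i), (p i).isClosed.preimage hj.continuous⟩
  let q : LTSeries (IrreducibleCloseds ↑(T ∩ O)) :=
    { length := p.length
      toFun := r
      step := fun i => by
        have hlt : p i.castSucc < p i.succ := p.step i
        have hsub : (p i.castSucc : Set T) ⊆ p i.succ := le_of_lt hlt
        have hle : r i.castSucc ≤ r i.succ := Set.preimage_mono (f := j) hsub
        refine lt_of_le_of_ne hle fun heq => ?_
        refine (ne_of_lt hlt) ((le_of_lt hlt).antisymm ?_)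
        have heq' : j ⁻¹' (p i.castSucc : Set T) = j ⁻¹' (p i.succ) :=
          congrArg IrreducibleCloseds.carrier heq
        -- an irreducible set is the closure of its intersection with an open set that it meets
        have h1 : (p i.succ : Set T) ⊆ closure ((p i.succ : Set T) ∩ Set.range j) :=
          subset_closure_inter_of_isPreirreducible_of_isOpen
            (p i.succ).isIrreducible.isPreirreducible hj.isOpen_range (hne _)
        have h2 : (p i.succ : Set T) ∩ Set.range j ⊆ p i.castSucc := by
          rintro _ ⟨hy, ⟨y, rfl⟩⟩
          have : y ∈ j ⁻¹' (p i.succ : Set T) := hy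
          rw [← heq'] at this
          exact this
        exact h1.trans (closure_minimal h2 (p i.castSucc).isClosed) }
  exact (Order.LTSeries.length_le_krullDim q).trans hd

end TopologicalKrullDim

section Charts

variable {X : Scheme.{0}} {f : X ⟶ SpecC}

theorem topologicalKrullDim_closure_inter_image_basicOpen {B : Type} [CommRing B] [Algebra ℂ B]
    [Algebra.FiniteType ℂ B] (j : Spec (CommRingCat.of B) ⟶ X) [IsOpenImmersion j]
    (P : PrimeSpectrum B) {b : B} (hb : b ∉ P.asIdeal) :
    topologicalKrullDim ↑(closure {j P} ∩ j '' {x : PrimeSpectrum B | b ∉ x.asIdeal}) =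
      ringKrullDim (B ⧸ P.asIdeal) := by
  let m := Ideal.Quotient.mk P.asIdeal
  have hb' : m b ≠ 0 := fun h => hb (Ideal.Quotient.eq_zero_iff_mem.1 h)
  have : Algebra.FiniteType ℂ (B ⧸ P.asIdeal) :=
    Algebra.FiniteType.of_surjective (Ideal.Quotient.mkₐ ℂ P.asIdeal)
      (Ideal.Quotient.mkₐ_surjective ℂ _)
  rw [← ringKrullDim_localization_away hb', ← PrimeSpectrum.topologicalKrullDim_eq_ringKrullDim]
  let A := Localization.Away (m b)
  have h1 := PrimeSpectrum.localization_away_isOpenEmbedding A (m b)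
  have h2 := PrimeSpectrum.isClosedEmbedding_comap_of_surjective _ m Ideal.Quotient.mk_surjective
  have hj : Topology.IsEmbedding (fun x : PrimeSpectrum B => j x) := j.isOpenEmbedding.isEmbedding
  have h3 : Topology.IsEmbedding fun x : PrimeSpectrum A =>
      j (PrimeSpectrum.comap m (PrimeSpectrum.comap (algebraMap (B ⧸ P.asIdeal) A) x)) :=
    hj.comp (h2.isEmbedding.comp h1.isEmbedding)
  have hr : Set.range (fun x : PrimeSpectrum A =>
      j (PrimeSpectrum.comap m (PrimeSpectrum.comap (algebraMap (B ⧸ P.asIdeal) A) x))) =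
      closure {j P} ∩ j '' {x : PrimeSpectrum B | b ∉ x.asIdeal} := by
    have hspec : ∀ x : PrimeSpectrum B, j x ∈ closure {j P} ↔ P ≤ x := fun x => by
      rw [← specializes_iff_mem_closure, PrimeSpectrum.le_iff_specializes]
      exact hj.isInducing.specializes_iff
    ext y
    constructor
    · rintro ⟨x, rfl⟩
      refine ⟨(hspec _).2 fun t ht => ?_, _, ?_, rfl⟩
      · change m t ∈ (PrimeSpectrum.comap (algebraMap (B ⧸ P.asIdeal) A) x).asIdeal
        rw [Ideal.Quotient.eq_zero_iff_mem.2 ht]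
        exact Ideal.zero_mem _
      · have : PrimeSpectrum.comap (algebraMap (B ⧸ P.asIdeal) A) x ∈
            (PrimeSpectrum.basicOpen (m b) : Set (PrimeSpectrum (B ⧸ P.asIdeal))) := by
          rw [← PrimeSpectrum.localization_away_comap_range A (m b)]
          exact ⟨x, rfl⟩
        exact this
    · rintro ⟨hy, x, hx, rfl⟩
      have hPx := (hspec _).1 hy
      obtain ⟨x', rfl⟩ : x ∈ Set.range (PrimeSpectrum.comap m) := by
        rw [range_comap_of_surjective _ m Ideal.Quotient.mk_surjective,
          Ideal.mk_ker]
        exact hPx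
      obtain ⟨x'', rfl⟩ : x' ∈ Set.range (PrimeSpectrum.comap (algebraMap (B ⧸ P.asIdeal) A)) := by
        rw [PrimeSpectrum.localization_away_comap_range A (m b)]
        exact hx
      exact ⟨x'', rfl⟩
  rw [← hr]
  exact (IsHomeomorph.topologicalKrullDim_eq _ h3.toHomeomorph.isHomeomorph).symm

theorem topologicalKrullDim_closure_inter_of_le {B : Type} [CommRing B] [Algebra ℂ B]
    [Algebra.FiniteType ℂ B] (j : Spec (CommRingCat.of B) ⟶ X) [IsOpenImmersion j]
    (P : PrimeSpectrum B) {O : X.Opens} (hP : j P ∈ O) (hO : O ≤ j.opensRange) :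
    topologicalKrullDim ↑(closure {j P} ∩ (O : Set X)) = ringKrullDim (B ⧸ P.asIdeal) := by
  obtain ⟨b, hb, hbO⟩ := exists_basicOpen_le (j ⁻¹ᵁ O) (x := P) hP
  refine le_antisymm ?_ ?_
  · rw [← topologicalKrullDim_closure_inter_image_basicOpen j P
      (b := 1) ((Ideal.ne_top_iff_one _).1 P.isPrime.ne_top)]
    refine topologicalKrullDim_mono (Set.inter_subset_inter_right _ fun y hy => ?_)
    obtain ⟨x, rfl⟩ := hO hy
    have h : (1 : B) ∉ (show PrimeSpectrum B from x).asIdeal :=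
      (Ideal.ne_top_iff_one _).1 (show PrimeSpectrum B from x).isPrime.ne_top
    exact ⟨x, h, rfl⟩
  · rw [← topologicalKrullDim_closure_inter_image_basicOpen j P (b := b) hb]
    refine topologicalKrullDim_mono (Set.inter_subset_inter_right _ ?_)
    rintro _ ⟨x, hx, rfl⟩
    exact hbO hx

/-- All nonempty open subsets of an irreducible variety have the same dimension, which can be
computed in any affine chart that contains the generic point. -/
theorem topologicalKrullDim_closure_inter [LocallyOfFiniteType f] {B : Type} [CommRing B]
    [Algebra ℂ B] (j : Spec (CommRingCat.of B) ⟶ X) [IsOpenImmersion j]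
    (hj : j ≫ f = Spec.map (CommRingCat.ofHom (algebraMap ℂ B)))
    (P : PrimeSpectrum B) {O : X.Opens} (hP : j P ∈ O) :
    topologicalKrullDim ↑(closure {j P} ∩ (O : Set X)) = ringKrullDim (B ⧸ P.asIdeal) := by
  have := finiteType_of_affineChart hj
  refine le_antisymm (topologicalKrullDim_le_of_forall_exists_isOpen fun x hx => ?_) ?_
  · obtain ⟨B', _, _, j', _, hj', hxj', hO⟩ := exists_affineChart f (O := O) (x := x) hx.2
    have := finiteType_of_affineChart hj'
    obtain ⟨P', hP'⟩ : j P ∈ j'.opensRange :=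
      (specializes_iff_mem_closure.2 hx.1).mem_open j'.opensRange.isOpen hxj'
    refine ⟨j'.opensRange, j'.opensRange.isOpen, hxj', ?_⟩
    rw [Set.inter_assoc,
      Set.inter_eq_self_of_subset_right (show (j'.opensRange : Set X) ⊆ O from hO)]
    have e1 := topologicalKrullDim_closure_inter_of_le j' P' (O := j'.opensRange)
      ⟨P', rfl⟩ le_rfl
    have e2 := topologicalKrullDim_closure_inter_of_le j' P' (O := j'.opensRange ⊓ j.opensRange)
      ⟨⟨P', rfl⟩, ⟨P, hP'.symm⟩⟩ inf_le_left
    have e3 := topologicalKrullDim_closure_inter_of_le j P (O := j'.opensRange ⊓ j.opensRange)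
      ⟨⟨P', hP'⟩, ⟨P, rfl⟩⟩ inf_le_right
    rw [hP'] at e1 e2
    rw [e1, ← e2, e3]
  · rw [← topologicalKrullDim_closure_inter_of_le j P (O := O ⊓ j.opensRange) ⟨hP, ⟨P, rfl⟩⟩
      inf_le_right]
    exact topologicalKrullDim_mono (Set.inter_subset_inter_right _ Set.inter_subset_left)

end Charts

/-! ### Generically finite morphisms -/

section GenericallyFinite

variable {Y C : Scheme.{0}} {g : Y ⟶ SpecC} {c : C ⟶ SpecC} {q : Y ⟶ C} {hq : q ≫ c = g}

theorem isWellPosed_fiberSquare (hw : IsWellPosed q hq) :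
    IsWellPosed (pullback.fst q q ≫ q) (e := pullback.fst q q ≫ g)
      (by rw [Category.assoc, hq]) := by
  obtain ⟨W, hW, hfin⟩ := hw
  refine ⟨W, hW, fun z hz => ?_⟩
  refine Set.Finite.of_finite_image (f := fun p => (ComplexPoints.map (pullback.fst q q) rfl p,
    ComplexPoints.map (pullback.snd q q) (snd_comp hq) p))
    (((hfin z hz).prod (hfin z hz)).subset ?_) ?_
  · rintro _ ⟨p, hp, rfl⟩
    have hp' : ComplexPoints.map q hq (ComplexPoints.map (pullback.fst q q) rfl p) = z :=
      (Subtype.ext (Category.assoc _ _ _)).trans hp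
    exact ⟨hp', (map_fst_eq_map_snd hq p).symm.trans hp'⟩
  · intro p _ p' _ h
    obtain ⟨h1, h2⟩ := Prod.mk.inj h
    apply Subtype.ext
    apply pullback.hom_ext
    · exact congrArg Subtype.val h1
    · exact congrArg Subtype.val h2

variable [LocallyOfFiniteType g] [LocallyOfFiniteType c] [IsIntegral C]

/-- A point of `Y` over the generic point of `C` has an algebraic residue field extension; here the
residue fields are represented by coordinate rings of affine charts. -/
theorem isAlgebraic_quotient_of_isWellPosed (hw : IsWellPosed q hq) {B A : Type} [CommRing B]
    [Algebra ℂ B] [CommRing A] [Algebra ℂ A] [Algebra B A] [IsScalarTower ℂ B A]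
    (j : Spec (CommRingCat.of B) ⟶ C) [IsOpenImmersion j]
    (hj : j ≫ c = Spec.map (CommRingCat.ofHom (algebraMap ℂ B)))
    (i : Spec (CommRingCat.of A) ⟶ Y) [IsOpenImmersion i]
    (hi : i ≫ g = Spec.map (CommRingCat.ofHom (algebraMap ℂ A)))
    (hij : i ≫ q = Spec.map (CommRingCat.ofHom (algebraMap B A)) ≫ j)
    (P : PrimeSpectrum A) (hP : q (i P) = genericPoint C) :
    Function.Injective (algebraMap B (A ⧸ P.asIdeal)) ∧ Algebra.IsAlgebraic B (A ⧸ P.asIdeal) := by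
  have hcomp : ∀ x : PrimeSpectrum A, j (PrimeSpectrum.comap (algebraMap B A) x) = q (i x) :=
    fun x => by
    have h : (i ≫ q) x = (Spec.map (CommRingCat.ofHom (algebraMap B A)) ≫ j) x := by rw [hij]
    exact h.symm
  have := isDomain_of_affineChart (j := j) (PrimeSpectrum.comap (algebraMap B A) P)
  have := finiteType_of_affineChart hj
  have := finiteType_of_affineChart hi
  have : Algebra.FiniteType ℂ (A ⧸ P.asIdeal) :=
    Algebra.FiniteType.of_surjective (Ideal.Quotient.mkₐ ℂ P.asIdeal)
      (Ideal.Quotient.mkₐ_surjective ℂ _)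
  have hbot : PrimeSpectrum.comap (algebraMap B A) P = ⊥ := by
    refine le_antisymm ?_ bot_le
    rw [PrimeSpectrum.le_iff_specializes]
    have h : j (PrimeSpectrum.comap (algebraMap B A) P) ⤳ j (⊥ : PrimeSpectrum B) := by
      rw [hcomp, hP]
      exact genericPoint_specializes _
    exact j.isOpenEmbedding.isInducing.specializes_iff.1 h
  refine ⟨?_, ?_⟩
  · rw [injective_iff_map_eq_zero]
    intro b hb
    rw [IsScalarTower.algebraMap_apply B A (A ⧸ P.asIdeal)] at hb
    have h1 : b ∈ (PrimeSpectrum.comap (algebraMap B A) P).asIdeal :=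
      (Ideal.Quotient.eq_zero_iff_mem (I := P.asIdeal)).1 hb
    rw [hbot] at h1
    exact h1
  · obtain ⟨W, hW, hfin⟩ := hw
    have hηW : genericPoint C ∈ W := by
      obtain ⟨w, hw⟩ := hW
      exact (genericPoint_specializes w).mem_open W.isOpen hw
    obtain ⟨a, ha, haW⟩ := exists_ne_zero_basicOpen_le (j ⁻¹ᵁ W)
      (x := PrimeSpectrum.comap (algebraMap B A) P) (by
        change j (PrimeSpectrum.comap (algebraMap B A) P) ∈ W
        rw [hcomp, hP]
        exact hηW)
    refine isAlgebraic_of_finite_fibers ha fun φ hφ => ?_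
    let Ψ : ((A ⧸ P.asIdeal) →ₐ[ℂ] ℂ) → ComplexPoints g := fun ψ =>
      affinePoint i hi (ψ.comp (Ideal.Quotient.mkₐ ℂ P.asIdeal))
    have hΨ : Function.Injective Ψ := by
      intro ψ ψ' h
      have h1 := (isOpenEmbedding_affinePoint i hi).injective h
      exact (AlgHom.cancel_right (Ideal.Quotient.mkₐ_surjective ℂ _)).1 h1
    refine Set.Finite.of_finite_image ((hfin (affinePoint j hj φ) ?_).subset ?_) hΨ.injOn
    · exact haW ((kerPoint_mem_basicOpen _ _).2 hφ)
    · rintro _ ⟨ψ, hψ, rfl⟩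
      apply Subtype.ext
      change (Spec.map (CommRingCat.ofHom _) ≫ i) ≫ q = Spec.map (CommRingCat.ofHom _) ≫ j
      rw [Category.assoc, hij, ← Category.assoc, ← Spec.map_comp, ← CommRingCat.ofHom_comp]
      have : (ψ.comp (Ideal.Quotient.mkₐ ℂ P.asIdeal)).toRingHom.comp (algebraMap B A) =
          φ.toRingHom := RingHom.ext hψ
      rw [this]

/-- The generic fiber of a generically finite morphism is discrete. -/
theorem eq_of_specializes_of_isWellPosed (hw : IsWellPosed q hq) {y y' : Y} (h : y ⤳ y')
    (hy : q y = genericPoint C) (hy' : q y' = genericPoint C) : y = y' := by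
  obtain ⟨B, _, _, j, _, hj, hηj, -⟩ := exists_affineChart c (O := ⊤) (x := genericPoint C) trivial
  obtain ⟨A, _, _, _, i, _, _, hi, hij, hy'i⟩ :=
    exists_affineChart_over hq j hj (x := y') (by rw [hy']; exact hηj)
  obtain ⟨(P : PrimeSpectrum A), rfl⟩ := h.mem_open i.opensRange.isOpen hy'i
  obtain ⟨(P' : PrimeSpectrum A), rfl⟩ := hy'i
  replace h : P ≤ P' :=
    (PrimeSpectrum.le_iff_specializes (R := A) P P').2
      (i.isOpenEmbedding.isInducing.specializes_iff.1 h)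
  obtain ⟨-, halg⟩ := isAlgebraic_quotient_of_isWellPosed hw j hj i hi hij P hy
  obtain ⟨hinj', -⟩ := isAlgebraic_quotient_of_isWellPosed hw j hj i hi hij P' hy'
  by_contra hne
  have hlt : P < P' := lt_of_le_of_ne h fun h' => hne (by rw [h'])
  obtain ⟨a, haP', haP⟩ := SetLike.exists_of_lt
    (show P.asIdeal < P'.asIdeal from hlt)
  let I : Ideal (A ⧸ P.asIdeal) :=
    P'.asIdeal.map (Ideal.Quotient.mk _)
  have h1 : I.comap (algebraMap B _) ≠ ⊥ :=
    Ideal.comap_ne_bot_of_algebraic_mem (x := Ideal.Quotient.mk _ a)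
      (fun h0 => haP (Ideal.Quotient.eq_zero_iff_mem.1 h0)) (Ideal.mem_map_of_mem _ haP')
      (halg.isAlgebraic _)
  obtain ⟨b, hb, hb0⟩ := Submodule.exists_mem_ne_zero_of_ne_bot h1
  have h2 : algebraMap B A b ∈ P'.asIdeal := by
    have h3 : Ideal.Quotient.mk P.asIdeal (algebraMap B A b) ∈ I := hb
    obtain ⟨x, hx, hxe⟩ := (Ideal.mem_map_iff_of_surjective _ Ideal.Quotient.mk_surjective).1 h3
    have h4 : algebraMap B A b - x ∈ P.asIdeal :=
      Ideal.Quotient.eq.1 hxe.symm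
    simpa using Ideal.add_mem _ (h h4) hx
  refine hb0 (hinj' ?_)
  rw [map_zero, IsScalarTower.algebraMap_apply B A]
  exact Ideal.Quotient.eq_zero_iff_mem.2 h2

/-- All irreducible locally closed subsets of `Y` that dominate `C` have the same dimension. -/
theorem exists_topologicalKrullDim_closure_inter_eq (hw : IsWellPosed q hq) :
    ∃ d : WithBot ℕ∞, ∀ y : Y, q y = genericPoint C → ∀ O : Y.Opens, y ∈ O →
      topologicalKrullDim ↑(closure {y} ∩ (O : Set Y)) = d := by
  obtain ⟨B, _, _, j, _, hj, hηj, -⟩ := exists_affineChart c (O := ⊤) (x := genericPoint C) trivial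
  refine ⟨ringKrullDim B, fun y hy O hyO => ?_⟩
  obtain ⟨A, _, _, _, i, _, _, hi, hij, hyi⟩ :=
    exists_affineChart_over hq j hj (x := y) (by rw [hy]; exact hηj)
  obtain ⟨(P : PrimeSpectrum A), rfl⟩ := hyi
  rw [topologicalKrullDim_closure_inter i hi P hyO]
  obtain ⟨x, hx⟩ := hηj
  have := isDomain_of_affineChart (j := j) x
  have := finiteType_of_affineChart hj
  have := finiteType_of_affineChart hi
  have : Algebra.FiniteType ℂ (A ⧸ P.asIdeal) :=
    Algebra.FiniteType.of_surjective (Ideal.Quotient.mkₐ ℂ P.asIdeal)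
      (Ideal.Quotient.mkₐ_surjective ℂ _)
  obtain ⟨hinj, halg⟩ := isAlgebraic_quotient_of_isWellPosed hw j hj i hi hij P hy
  exact ringKrullDim_eq_of_isAlgebraic hinj

end GenericallyFinite

section NonDominant

/-- A closed subset of a Noetherian space whose image misses the generic point of the target lies
over the complement of a nonempty open set. -/
theorem exists_open_forall_notMem {Y C : Type*} [TopologicalSpace Y] [TopologicalSpace C]
    [TopologicalSpace.NoetherianSpace Y] [QuasiSober Y] [IrreducibleSpace C] [QuasiSober C]
    {q : Y → C} (hq : Continuous q) {S : Set Y} (hS : IsClosed S)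
    (h : ∀ y ∈ S, ¬ IsGenericPoint (q y) Set.univ) :
    ∃ W : Set C, IsOpen W ∧ W.Nonempty ∧ ∀ y ∈ S, q y ∉ W := by
  obtain ⟨F, hF, hcl, hirr, rfl⟩ :=
    TopologicalSpace.NoetherianSpace.exists_finite_set_isClosed_irreducible hS
  have key : ∀ Z ∈ F, ∃ W : Set C, IsOpen W ∧ W.Nonempty ∧ ∀ y ∈ Z, q y ∉ W := by
    intro Z hZ
    obtain ⟨ζ, hζ⟩ := QuasiSober.sober (hirr Z hZ) (hcl Z hZ)
    refine ⟨(closure {q ζ})ᶜ, isClosed_closure.isOpen_compl, ?_, fun y hy hyc => hyc ?_⟩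
    · rw [Set.nonempty_compl]
      exact h ζ ⟨Z, hZ, hζ.mem⟩
    · have : y ∈ closure {ζ} := by rw [hζ.def]; exact hy
      simpa using map_mem_closure hq this (t := {q ζ}) (by simp [Set.MapsTo])
  choose! W hWo hWn hW using key
  refine ⟨⋂ Z ∈ F, W Z, hF.isOpen_biInter hWo, ?_, ?_⟩
  · clear hcl hirr hS h
    obtain ⟨η, hη⟩ := QuasiSober.sober (IrreducibleSpace.isIrreducible_univ C) isClosed_univ
    refine ⟨η, Set.mem_iInter₂.2 fun Z hZ => ?_⟩
    obtain ⟨w, hw⟩ := hWn Z hZ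
    exact (isGenericPoint_iff_specializes.1 hη w |>.2 trivial).mem_open (hWo Z hZ) hw
  · rintro y ⟨Z, hZ, hy⟩ hyW
    exact hW Z hZ y hy (Set.mem_iInter₂.1 hyW Z hZ)

end NonDominant

/-! ### Irreducible components of an open subspace -/

section Components

open TopologicalSpace

/-- The dimension of a sober space can be bounded on the closures of points that suffice to
generalize all points. -/
theorem topologicalKrullDim_le_of_forall_exists_specializes {Y : Type*} [TopologicalSpace Y]
    [QuasiSober Y] {d : WithBot ℕ∞}
    (h : ∀ y : Y, ∃ ξ, ξ ⤳ y ∧ topologicalKrullDim (closure {ξ} : Set Y) ≤ d) :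
    topologicalKrullDim Y ≤ d := by
  refine iSup_le fun p => ?_
  obtain ⟨y, hy⟩ := QuasiSober.sober p.last.isIrreducible p.last.isClosed
  obtain ⟨ξ, hξ, hd⟩ := h y
  have hsub : ∀ i, (p i : Set Y) ⊆ closure {ξ} := fun i x hx =>
    (hξ.trans (hy.specializes (p.strictMono.monotone (Fin.le_last i) hx))).mem_closure
  let r : Fin (p.length + 1) → IrreducibleCloseds (closure {ξ} : Set Y) := fun i =>
    ⟨Subtype.val ⁻¹' (p i), by
      obtain ⟨x, hx⟩ := QuasiSober.sober (p i).isIrreducible (p i).isClosed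
      have h1 : (Subtype.val ⁻¹' (p i : Set Y) : Set (closure {ξ} : Set Y)) =
          closure {⟨x, hsub i hx.mem⟩} := by
        rw [Topology.IsInducing.subtypeVal.closure_eq_preimage_closure_image, Set.image_singleton,
          hx.def]
      rw [h1]
      exact isIrreducible_singleton.closure, (p i).isClosed.preimage continuous_subtype_val⟩
  let s : LTSeries (IrreducibleCloseds (closure {ξ} : Set Y)) :=
    { length := p.length
      toFun := r
      step := fun i => by
        have hlt : p i.castSucc < p i.succ := p.step i
        refine lt_of_le_not_ge (Set.preimage_mono (le_of_lt hlt)) fun hle => hlt.not_ge ?_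
        intro x hx
        exact hle (show (⟨x, hsub _ hx⟩ : (closure {ξ} : Set Y)) ∈ r i.succ from hx) }
  exact (Order.LTSeries.length_le_krullDim s).trans hd

variable {Y : Type*} [TopologicalSpace Y] (V : Opens Y)

theorem closure_singleton_subtype (ζ : V) :
    closure {ζ} = (Subtype.val ⁻¹' closure {ζ.1} : Set V) := by
  rw [Topology.IsInducing.subtypeVal.closure_eq_preimage_closure_image, Set.image_singleton]
  rfl

/-- The components of an open subspace are the traces of components of the whole space. -/
theorem exists_preimage_eq_of_mem_irreducibleComponents {Z : Set V}
    (hZ : Z ∈ irreducibleComponents V) :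
    ∃ Z' ∈ irreducibleComponents Y, Subtype.val ⁻¹' Z' = Z := by
  obtain ⟨Z', hZ', hsub⟩ := exists_mem_irreducibleComponents_subset_of_isIrreducible
    (Subtype.val '' Z) (hZ.1.image _ continuous_subtype_val.continuousOn)
  refine ⟨Z', hZ', (hZ.eq_of_subset ?_ (Set.image_subset_iff.1 hsub)).symm⟩
  refine hZ'.1.preimage V.isOpen.isOpenEmbedding_subtypeVal ?_
  obtain ⟨x, hx⟩ := hZ.1.nonempty
  exact ⟨x.1, hsub ⟨x, hx, rfl⟩, ⟨x, rfl⟩⟩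

end Components

/-! ### From the fiber square of the covering to the fiber square of schemes -/

section SquarePoint

variable {E C : Scheme.{0}} {e : E ⟶ SpecC} {c : C ⟶ SpecC} {π : E ⟶ C} (hπ : π ≫ c = e)
  (U : C.Opens)

/-- The point of the scheme `E₂` at which a pair of complex points of `E` with the same image in
`U` is located. -/
noncomputable def squarePoint (w : (mapOver π hπ U).Pullback (mapOver π hπ U)) : fiberSquare π :=
  (pairPoint hπ w.1.1.1 w.1.2.1 (congrArg Subtype.val w.2)).point

/-- `squarePoint` is continuous from the classical to the Zariski topology. -/
theorem continuous_squarePoint : Continuous (squarePoint hπ U) := by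
  refine continuous_def.2 fun O hO => ?_
  have h : Continuous fun w : (mapOver π hπ U).Pullback (mapOver π hπ U) =>
      (⟨(w.1.1.1, w.1.2.1), congrArg Subtype.val w.2⟩ :
        {q : ComplexPoints e × ComplexPoints e //
          ComplexPoints.map π hπ q.1 = ComplexPoints.map π hπ q.2}) :=
    Continuous.subtype_mk ((continuous_subtype_val.comp
      (continuous_fst.comp continuous_subtype_val)).prodMk (continuous_subtype_val.comp
      (continuous_snd.comp continuous_subtype_val))) _
  exact (isOpen_pairPoint_mem hπ ⟨O, hO⟩).preimage h

theorem apply_squarePoint (w : (mapOver π hπ U).Pullback (mapOver π hπ U)) :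
    (pullback.fst π π ≫ π) (squarePoint hπ U w) = (mapOver π hπ U w.1.1).1.point := by
  have h := map_fst_pairPoint hπ w.1.1.1 w.1.2.1 (congrArg Subtype.val w.2)
  have h' := congrArg (fun p => π (ComplexPoints.point p)) h
  exact h'

theorem squarePoint_mem (w : (mapOver π hπ U).Pullback (mapOver π hπ U)) :
    squarePoint hπ U w ∈ fiberSquareOver π U := by
  change (pullback.fst π π ≫ π) (squarePoint hπ U w) ∈ U
  rw [apply_squarePoint]
  exact (mapOver π hπ U w.1.1).2

/-- The inverse of `squarePoint`, on the complex points of `V₂`. -/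
noncomputable def toPullback
    (P : {P : ComplexPoints (pullback.fst π π ≫ e) // P.point ∈ fiberSquareOver π U}) :
    (mapOver π hπ U).Pullback (mapOver π hπ U) :=
  ⟨(⟨ComplexPoints.map (pullback.fst π π) rfl P.1, P.2⟩,
    ⟨ComplexPoints.map (pullback.snd π π) (snd_comp hπ) P.1, by
      rw [Set.mem_preimage, ← map_fst_eq_map_snd hπ P.1]
      exact P.2⟩), Subtype.ext (map_fst_eq_map_snd hπ P.1)⟩

theorem continuous_toPullback : Continuous (toPullback hπ U) :=
  Continuous.subtype_mk ((Continuous.subtype_mk ((ComplexPoints.continuous_map _ _).comp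
    continuous_subtype_val) _).prodMk (Continuous.subtype_mk ((ComplexPoints.continuous_map _ _).comp
    continuous_subtype_val) _)) _

theorem squarePoint_toPullback
    (P : {P : ComplexPoints (pullback.fst π π ≫ e) // P.point ∈ fiberSquareOver π U}) :
    squarePoint hπ U (toPullback hπ U P) = P.1.point :=
  congrArg ComplexPoints.point (pairPoint_map hπ P.1)

theorem toPullback_pairPoint (w : (mapOver π hπ U).Pullback (mapOver π hπ U)) :
    toPullback hπ U ⟨pairPoint hπ w.1.1.1 w.1.2.1 (congrArg Subtype.val w.2),
      squarePoint_mem hπ U w⟩ = w := by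
  apply Subtype.ext
  apply Prod.ext
  · exact Subtype.ext
      (map_fst_pairPoint hπ w.1.1.1 w.1.2.1 (congrArg Subtype.val w.2))
  · exact Subtype.ext
      (map_snd_pairPoint hπ w.1.1.1 w.1.2.1 (congrArg Subtype.val w.2))

theorem isPreconnected_squarePoint_preimage {S : Set (fiberSquare π)}
    (hS : S ⊆ fiberSquareOver π U)
    (h : IsPreconnected {P : ComplexPoints (pullback.fst π π ≫ e) | P.point ∈ S}) :
    IsPreconnected (squarePoint hπ U ⁻¹' S) := by
  have := isPreconnected_iff_preconnectedSpace.1 h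
  let k : {P : ComplexPoints (pullback.fst π π ≫ e) | P.point ∈ S} →
      (mapOver π hπ U).Pullback (mapOver π hπ U) := fun P => toPullback hπ U ⟨P.1, hS P.2⟩
  have hk : Continuous k :=
    (continuous_toPullback hπ U).comp (Continuous.subtype_mk continuous_subtype_val _)
  have hr : Set.range k = squarePoint hπ U ⁻¹' S := by
    ext w
    constructor
    · rintro ⟨P, rfl⟩
      rw [Set.mem_preimage, squarePoint_toPullback]
      exact P.2
    · intro hw
      exact ⟨⟨_, hw⟩, toPullback_pairPoint hπ U w⟩
  rw [← hr]
  exact isPreconnected_range hk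

theorem exists_squarePoint_mem [LocallyOfFiniteType (pullback.fst π π ≫ e)]
    {S : Set (fiberSquare π)} (hS : IsLocallyClosed S)
    (hne : (S ∩ fiberSquareOver π U).Nonempty) : ∃ w, squarePoint hπ U w ∈ S := by
  obtain ⟨P, hP, hPV⟩ := ComplexPoints.exists_point_mem (f := pullback.fst π π ≫ e)
    (hS.inter (fiberSquareOver π U).isOpen.isLocallyClosed) hne
  exact ⟨toPullback hπ U ⟨P, hPV⟩, by rwa [squarePoint_toPullback]⟩

theorem inter_subset_of_forall_squarePoint_mem [LocallyOfFiniteType (pullback.fst π π ≫ e)]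
    {S T : Set (fiberSquare π)} (hS : IsLocallyClosed S) (hT : IsClosed T)
    (h : ∀ w, squarePoint hπ U w ∈ S → squarePoint hπ U w ∈ T) :
    S ∩ fiberSquareOver π U ⊆ T := by
  refine ComplexPoints.subset_of_forall_point_mem (f := pullback.fst π π ≫ e)
    (hS.inter (fiberSquareOver π U).isOpen.isLocallyClosed) hT ?_
  rintro P ⟨hP, hPV⟩
  have := h (toPullback hπ U ⟨P, hPV⟩)
  rw [squarePoint_toPullback] at this
  exact this hP

theorem squarePoint_mem_range_diagonal_iff [LocallyOfFiniteType e]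
    [LocallyOfFiniteType (pullback.fst π π ≫ e)]
    (w : (mapOver π hπ U).Pullback (mapOver π hπ U)) :
    squarePoint hπ U w ∈ Set.range (pullback.diagonal π) ↔ w ∈ pullbackDiag (mapOver π hπ U) := by
  have h1 : pullback.fst π π (squarePoint hπ U w) = w.1.1.1.point :=
    congrArg ComplexPoints.point
      (map_fst_pairPoint hπ w.1.1.1 w.1.2.1 (congrArg Subtype.val w.2))
  have h2 : pullback.snd π π (squarePoint hπ U w) = w.1.2.1.point :=
    congrArg ComplexPoints.point
      (map_snd_pairPoint hπ w.1.1.1 w.1.2.1 (congrArg Subtype.val w.2))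
  constructor
  · rintro ⟨x, hx⟩
    refine Subtype.ext (ComplexPoints.point_injective ?_)
    rw [← h1, ← h2, ← hx, ← Scheme.Hom.comp_apply, ← Scheme.Hom.comp_apply,
      pullback.diagonal_fst, pullback.diagonal_snd]
  · intro hw
    have hw' : w.1.1 = w.1.2 := hw
    refine ⟨w.1.1.1.point, ?_⟩
    have : ComplexPoints.map (pullback.diagonal π)
        (g := pullback.fst π π ≫ e) (by rw [pullback.diagonal_fst_assoc]) w.1.1.1 =
        pairPoint hπ w.1.1.1 w.1.2.1 (congrArg Subtype.val w.2) := by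
      apply Subtype.ext
      apply pullback.hom_ext
      · refine Eq.trans ?_ (pullback.lift_fst _ _ _).symm
        simp [ComplexPoints.map]
      · refine Eq.trans ?_ (pullback.lift_snd _ _ _).symm
        simp [ComplexPoints.map, hw']
    exact congrArg ComplexPoints.point this

end SquarePoint

/-! ### The components of the fiber square over `U` -/

section FiberSquareOver

open TopologicalSpace

variable {E C : Scheme.{0}} {π : E ⟶ C} {U : C.Opens}

variable (π U) in
/-- The topological space underlying `V₂`, as a subspace of `E₂`. It is definitionally the one that
underlies the open subscheme. -/
abbrev SquareOver : Type :=
  {y : fiberSquare π // y ∈ fiberSquareOver π U}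

theorem quasiSober_squareOver :
    QuasiSober (SquareOver π U) :=
  (fiberSquareOver π U).isOpen.isOpenEmbedding_subtypeVal.quasiSober

theorem exists_mem_genericPoints_specializes (y : SquareOver π U) :
    ∃ ξ ∈ genericPoints (SquareOver π U), ξ ⤳ y := by
  have := quasiSober_squareOver (π := π) (U := U)
  let ξ := genericPoints.ofComponent ⟨_, irreducibleComponent_mem_irreducibleComponents y⟩
  exact ⟨ξ.1, ξ.2,
    (genericPoints.isGenericPoint_ofComponent _).specializes mem_irreducibleComponent⟩

theorem noetherianSpace_squareOver [NoetherianSpace (fiberSquare π)] :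
    NoetherianSpace (SquareOver π U) :=
  Topology.IsInducing.subtypeVal.noetherianSpace

theorem finite_genericPoints [NoetherianSpace (fiberSquare π)] :
    Finite (genericPoints (SquareOver π U)) :=
  have := noetherianSpace_squareOver (π := π) (U := U)
  (genericPoints.finite NoetherianSpace.finite_irreducibleComponents).to_subtype

theorem isGenericPoint_univ_iff {C : Type*} [TopologicalSpace C] [IrreducibleSpace C]
    [QuasiSober C] [T0Space C] {x : C} :
    IsGenericPoint x Set.univ ↔ x = genericPoint C :=
  ⟨fun h => h.eq (genericPoint_spec C), fun h => h ▸ genericPoint_spec C⟩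

theorem isClosed_range_diagonal [IsSeparated π] :
    IsClosed (Set.range (pullback.diagonal π)) :=
  (pullback.diagonal π).isClosedEmbedding.isClosed_range

theorem preimage_closure_diagonalOver [IsSeparated π] :
    (Subtype.val ⁻¹' closure (diagonalOver π U) : Set (SquareOver π U)) =
      Subtype.val ⁻¹' diagonalOver π U := by
  refine subset_antisymm (fun y hy => ⟨?_, y.2⟩) (Set.preimage_mono subset_closure)
  exact closure_minimal Set.inter_subset_left isClosed_range_diagonal hy

variable {e : E ⟶ SpecC} {c : C ⟶ SpecC} {hπ : π ≫ c = e}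

/-- The component with generic point `ζ` is the diagonal if and only if it is so on complex
points. -/
theorem closure_eq_diagonalOver_iff [LocallyOfFiniteType e]
    [LocallyOfFiniteType (pullback.fst π π ≫ e)] [IsSeparated π] {W : C.Opens}
    {ζ : SquareOver π U} (hζW : (pullback.fst π π ≫ π) ζ.1 ∈ W) :
    (squarePoint hπ U ⁻¹' closure {ζ.1} ∩ pullbackOver (mapOver π hπ U) {u | u.1.point ∈ W} ⊆
        pullbackDiag (mapOver π hπ U) ∧
      pullbackDiag (mapOver π hπ U) ⊆ squarePoint hπ U ⁻¹' closure {ζ.1}) ↔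
    closure {ζ} = (Subtype.val ⁻¹' diagonalOver π U : Set (SquareOver π U)) := by
  rw [closure_singleton_subtype]
  constructor
  · rintro ⟨h1, h2⟩
    have h3 : ζ.1 ∈ Set.range (pullback.diagonal π) := by
      refine inter_subset_of_forall_squarePoint_mem hπ U
        (S := closure {ζ.1} ∩ (pullback.fst π π ≫ π) ⁻¹' W)
        (isClosed_closure.isLocallyClosed.inter
          (W.isOpen.preimage (pullback.fst π π ≫ π).continuous).isLocallyClosed)
        isClosed_range_diagonal (fun w hw => ?_) ⟨⟨subset_closure rfl, hζW⟩, ζ.2⟩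
      rw [squarePoint_mem_range_diagonal_iff]
      refine h1 ⟨hw.1, ?_⟩
      have := hw.2
      rw [Set.mem_preimage, apply_squarePoint] at this
      exact this
    refine subset_antisymm (fun y hy => ⟨closure_minimal (Set.singleton_subset_iff.2 h3)
      isClosed_range_diagonal hy, y.2⟩) (Set.preimage_mono ?_)
    refine inter_subset_of_forall_squarePoint_mem hπ U isClosed_range_diagonal.isLocallyClosed
      isClosed_closure fun w hw => h2 ?_
    rwa [← squarePoint_mem_range_diagonal_iff]
  · intro h
    have h' : ∀ w, squarePoint hπ U w ∈ closure {ζ.1} ↔ w ∈ pullbackDiag (mapOver π hπ U) := by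
      intro w
      rw [← squarePoint_mem_range_diagonal_iff]
      have h1 := Set.ext_iff.1 h ⟨squarePoint hπ U w, squarePoint_mem hπ U w⟩
      exact h1.trans ⟨fun h => h.1, fun h => ⟨h, squarePoint_mem hπ U w⟩⟩
    exact ⟨fun w hw => (h' w).1 hw.1, fun w hw => (h' w).2 hw⟩

variable [IsIntegral C] [LocallyOfFiniteType c] [Smooth (U.ι ≫ c)]
  [LocallyOfFiniteType (pullback.fst π π ≫ e)] [NoetherianSpace (fiberSquare π)]

/-- The components of `V₂` dominate `C`: a component contains a nonempty open subset of `V₂`, and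
`V₂(ℂ) → U(ℂ)` is an open map. -/
theorem apply_eq_genericPoint_of_mem_genericPoints (hU : IsCoveringOver π hπ U)
    {ζ : SquareOver π U} (hζ : ζ ∈ genericPoints (SquareOver π U)) :
    (pullback.fst π π ≫ π) ζ.1 = genericPoint C := by
  have := noetherianSpace_squareOver (π := π) (U := U)
  obtain ⟨o, ho, hne, hsub⟩ :=
    NoetherianSpace.exists_isOpen_nonempty_subset_irreducibleComponent (closure {ζ}) hζ
  by_contra hq
  let W : C.Opens := ⟨(closure {(pullback.fst π π ≫ π) ζ.1})ᶜ, isClosed_closure.isOpen_compl⟩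
  have hW : (W : Set C).Nonempty := by
    change (closure {(pullback.fst π π ≫ π) ζ.1})ᶜ.Nonempty
    rw [Set.nonempty_compl]
    exact fun h => hq (isGenericPoint_univ_iff.1 h)
  have hO : IsOpen (Subtype.val '' o : Set (fiberSquare π)) :=
    (fiberSquareOver π U).isOpen.isOpenEmbedding_subtypeVal.isOpenMap _ ho
  obtain ⟨y, hy⟩ := hne
  obtain ⟨w₀, hw₀⟩ := exists_squarePoint_mem hπ U hO.isLocallyClosed ⟨y.1, ⟨y, hy, rfl⟩, y.2⟩
  obtain ⟨w, ⟨y, hyo, hyw⟩, hwW⟩ :=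
    (dense_pullbackOver (dense_ofOpen_of_smooth hW) hU).inter_open_nonempty _
      (hO.preimage (continuous_squarePoint hπ U)) ⟨w₀, hw₀⟩
  have h1 : (pullback.fst π π ≫ π) (squarePoint hπ U w) ∈ W := by
    rw [apply_squarePoint]
    exact hwW
  refine h1 ?_
  rw [← hyw]
  have h2 : ζ.1 ⤳ y.1 := (specializes_iff_mem_closure.2 (hsub hyo)).map continuous_subtype_val
  exact (h2.map (pullback.fst π π ≫ π).continuous).mem_closure

/-- Over a small enough nonempty open subset `W` of `C` the components of `V₂` become disjoint and
have connected sets of complex points. -/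
theorem exists_opens_disjoint_isPreconnected (hwp : IsWellPosed π hπ)
    (hU : IsCoveringOver π hπ U) :
    ∃ W : C.Opens, (W : Set C).Nonempty ∧
      (∀ ζ ∈ genericPoints (SquareOver π U), ∀ ζ' ∈ genericPoints (SquareOver π U),
        ∀ y, y ∈ closure {ζ.1} → y ∈ closure {ζ'.1} → (pullback.fst π π ≫ π) y ∈ W → ζ = ζ') ∧
      ∀ ζ ∈ genericPoints (SquareOver π U), IsPreconnected
        {P : ComplexPoints (pullback.fst π π ≫ e) | P.point ∈
          closure {ζ.1} ∩ ((pullback.fst π π ≫ π) ⁻¹' W ∩ fiberSquareOver π U)} := by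
  -- `W` is chosen to avoid the image of the set `S` of points that lie on two components or outside
  -- the connected part of one; no point of `S` lies over the generic point of `C`
  choose O hζO hO using fun ζ : SquareOver π U =>
    exists_open_isPreconnected (pullback.fst π π ≫ e) ζ.1
  have := finite_genericPoints (π := π) (U := U)
  let S : Set (fiberSquare π) :=
    (⋃ r : {r : genericPoints (SquareOver π U) × genericPoints (SquareOver π U) //
      r.1 ≠ r.2}, closure {r.1.1.1.1} ∩ closure {r.1.2.1.1}) ∪
    ⋃ ζ : genericPoints (SquareOver π U), closure {ζ.1.1} \ O ζ.1
  have hS : IsClosed S :=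
    (isClosed_iUnion_of_finite fun _ => isClosed_closure.inter isClosed_closure).union
      (isClosed_iUnion_of_finite fun ζ => isClosed_closure.sdiff (O ζ.1).isOpen)
  have key : ∀ ζ : genericPoints (SquareOver π U), ∀ y ∈ closure {ζ.1.1},
      (pullback.fst π π ≫ π) y = genericPoint C → ζ.1.1 = y := fun ζ y hy h =>
    eq_of_specializes_of_isWellPosed (isWellPosed_fiberSquare hwp)
      (specializes_iff_mem_closure.2 hy) (apply_eq_genericPoint_of_mem_genericPoints hU ζ.2) h
  obtain ⟨W, hW, hne, hSW⟩ := exists_open_forall_notMem (pullback.fst π π ≫ π).continuous hS (by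
    intro y hy hgen
    rw [isGenericPoint_univ_iff] at hgen
    rcases hy with hy | hy
    · obtain ⟨⟨⟨ζ, ζ'⟩, hne⟩, h, h'⟩ := Set.mem_iUnion.1 hy
      exact hne (Subtype.ext (Subtype.ext ((key ζ y h hgen).trans (key ζ' y h' hgen).symm)))
    · obtain ⟨ζ, h, h'⟩ := Set.mem_iUnion.1 hy
      exact h' (key ζ y h hgen ▸ hζO ζ.1))
  refine ⟨⟨W, hW⟩, hne, fun ζ hζ ζ' hζ' y hy hy' hyW => ?_, fun ζ hζ => ?_⟩
  · by_contra hne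
    exact hSW y (Or.inl (Set.mem_iUnion.2 ⟨⟨(⟨ζ, hζ⟩, ⟨ζ', hζ'⟩),
      fun h => hne (congrArg Subtype.val h)⟩, hy, hy'⟩)) hyW
  · convert hO ζ (O ζ ⊓ (((pullback.fst π π ≫ π) ⁻¹ᵁ ⟨W, hW⟩) ⊓ fiberSquareOver π U)) inf_le_left
      using 3 with P
    refine ⟨fun h => ⟨h.1, ?_, h.2⟩, fun h => ⟨h.1, h.2.2⟩⟩
    by_contra hPO
    exact hSW _ (Or.inr (Set.mem_iUnion.2 ⟨⟨ζ, hζ⟩, h.1, hPO⟩)) h.2.1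

variable [IsSeparated π]

/-- The topological criterion for double transitivity, applied to the sets of complex points of the
irreducible components of `V₂`. -/
theorem monodromyDoublyTransitive_iff [LocallyOfFiniteType e] (hwp : IsWellPosed π hπ)
    (hU : IsCoveringOver π hπ U) (z : ComplexPoints.ofOpen c U) :
    MonodromyDoublyTransitive hU z ↔ {Z ∈ irreducibleComponents (SquareOver π U) |
      Z ≠ Subtype.val ⁻¹' diagonalOver π U}.Subsingleton := by
  obtain ⟨W, hW, hdisj, hpre⟩ := exists_opens_disjoint_isPreconnected hwp hU
  have := finite_genericPoints (π := π) (U := U)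
  have := quasiSober_squareOver (π := π) (U := U)
  have := preconnectedSpace_ofOpen_of_smooth c U
  have hηW : ∀ ζ : genericPoints (SquareOver π U), (pullback.fst π π ≫ π) ζ.1.1 ∈ W := by
    intro ζ
    rw [apply_eq_genericPoint_of_mem_genericPoints hU ζ.2]
    obtain ⟨x, hx⟩ := hW
    exact (genericPoint_specializes x).mem_open W.isOpen hx
  have hover : ∀ w, w ∈ pullbackOver (mapOver π hπ U) {u | u.1.point ∈ W} ↔
      (pullback.fst π π ≫ π) (squarePoint hπ U w) ∈ W := fun w => by
    rw [apply_squarePoint]; rfl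
  have main := isMultiplyPretransitive_monodromy_iff hU
    (locallyNonseparating_ofOpen_of_smooth (f := c) (U := U) W) (dense_ofOpen_of_smooth hW)
    (fun ζ : genericPoints (SquareOver π U) => squarePoint hπ U ⁻¹' closure {ζ.1.1})
    (fun ζ => isClosed_closure.preimage (continuous_squarePoint hπ U))
    (by
      refine Set.eq_univ_of_forall fun w => Set.mem_iUnion.2 ?_
      obtain ⟨ξ, hξ, h⟩ :=
        exists_mem_genericPoints_specializes ⟨squarePoint hπ U w, squarePoint_mem hπ U w⟩
      exact ⟨⟨ξ, hξ⟩, (h.map continuous_subtype_val).mem_closure⟩)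
    (by
      intro ζ ζ' hne
      refine Set.eq_empty_of_forall_notMem fun w hw => hne (Subtype.ext ?_)
      exact hdisj ζ.1 ζ.2 ζ'.1 ζ'.2 _ hw.1.1 hw.1.2 ((hover w).1 hw.2))
    (by
      intro ζ
      convert isPreconnected_squarePoint_preimage hπ U
        (fun y hy => hy.2.2) (hpre ζ.1 ζ.2) using 1
      ext w
      exact and_congr Iff.rfl ((hover w).trans (and_iff_left (squarePoint_mem hπ U w)).symm))
    (by
      intro ζ
      obtain ⟨w, hw⟩ := exists_squarePoint_mem hπ U
        (S := closure {ζ.1.1} ∩ (pullback.fst π π ≫ π) ⁻¹' W)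
        (isClosed_closure.isLocallyClosed.inter
          (W.isOpen.preimage (pullback.fst π π ≫ π).continuous).isLocallyClosed)
        ⟨ζ.1.1, ⟨subset_closure rfl, hηW ζ⟩, ζ.1.2⟩
      exact ⟨w, hw.1, (hover w).2 hw.2⟩) z
  -- components correspond to their generic points
  refine main.trans ⟨fun h => ?_, fun h => ?_⟩
  · rintro Z ⟨hZ, hZD⟩ Z' ⟨hZ', hZD'⟩
    obtain ⟨ζ, hζ⟩ := genericPoints.component_surjective ⟨Z, hZ⟩
    obtain ⟨ζ', hζ'⟩ := genericPoints.component_surjective ⟨Z', hZ'⟩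
    obtain rfl : closure {ζ.1} = Z := congrArg Subtype.val hζ
    obtain rfl : closure {ζ'.1} = Z' := congrArg Subtype.val hζ'
    rw [h (fun h' => hZD ((closure_eq_diagonalOver_iff (hηW ζ)).1 h'))
      (fun h' => hZD' ((closure_eq_diagonalOver_iff (hηW ζ')).1 h'))]
  · intro ζ hζ ζ' hζ'
    refine genericPoints.component_injective (Subtype.ext (h
      ⟨ζ.2, fun h' => hζ ((closure_eq_diagonalOver_iff (hηW ζ)).2 h')⟩
      ⟨ζ'.2, fun h' => hζ' ((closure_eq_diagonalOver_iff (hηW ζ')).2 h')⟩))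

/-- If `V₂` is nonempty, then its diagonal contains a point over the generic point of `C`. -/
theorem exists_mem_range_diagonal_apply_eq [LocallyOfFiniteType e] (hU : IsCoveringOver π hπ U)
    (y : SquareOver π U) :
    ∃ δ ∈ Set.range (pullback.diagonal π), (pullback.fst π π ≫ π) δ = genericPoint C := by
  by_contra! hcon
  obtain ⟨W, hW, hne, hDW⟩ := exists_open_forall_notMem (pullback.fst π π ≫ π).continuous
    (isClosed_range_diagonal (π := π)) fun δ hδ h => hcon δ hδ (isGenericPoint_univ_iff.1 h)
  obtain ⟨w₀, -⟩ := exists_squarePoint_mem hπ U isClosed_univ.isLocallyClosed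
    ⟨y.1, trivial, y.2⟩
  obtain ⟨w, hwD, hwW⟩ :=
    (dense_pullbackOver (dense_ofOpen_of_smooth (W := ⟨W, hW⟩) hne) hU).inter_open_nonempty _
      (isClopen_pullbackDiag hU).isOpen ⟨⟨(w₀.1.1, w₀.1.1), rfl⟩, rfl⟩
  refine hDW _ ((squarePoint_mem_range_diagonal_iff hπ U w).2 hwD) ?_
  rw [apply_squarePoint]
  exact hwW

/-- The closures in `E₂` of the components of `V₂` are components of `E₂`, and they all have the
same dimension as the diagonal. -/
theorem subsingleton_components_of_closure [LocallyOfFiniteType e] (hwp : IsWellPosed π hπ)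
    (hU : IsCoveringOver π hπ U)
    (h : {Z ∈ irreducibleComponents (fiberSquare π) | Z ≠ closure (diagonalOver π U) ∧
      topologicalKrullDim Z = topologicalKrullDim (diagonalOver π U)}.Subsingleton) :
    {Z ∈ irreducibleComponents (SquareOver π U) |
      Z ≠ Subtype.val ⁻¹' diagonalOver π U}.Subsingleton := by
  have := quasiSober_squareOver (π := π) (U := U)
  obtain ⟨d, hd⟩ := exists_topologicalKrullDim_closure_inter_eq (isWellPosed_fiberSquare hwp)
  have hd' : ∀ y, (pullback.fst π π ≫ π) y = genericPoint C →
      topologicalKrullDim (closure {y} : Set (fiberSquare π)) = d := fun y hy => by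
    have := hd y hy ⊤ trivial
    rwa [TopologicalSpace.Opens.coe_top, Set.inter_univ] at this
  have hdim : ∀ y : SquareOver π U, topologicalKrullDim (diagonalOver π U) = d := by
    intro y
    refine le_antisymm ?_ ?_
    -- every point of `V₂` lies on a component, and these have dimension `d`
    · refine (topologicalKrullDim_mono Set.inter_subset_right).trans
        (topologicalKrullDim_le_of_forall_exists_specializes (Y := SquareOver π U) fun y => ?_)
      obtain ⟨ξ, hξ, hξy⟩ := exists_mem_genericPoints_specializes y
      refine ⟨ξ, hξy, ?_⟩
      rw [← hd' ξ.1 (apply_eq_genericPoint_of_mem_genericPoints hU hξ), closure_singleton_subtype]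
      exact (Topology.IsInducing.subtypeVal.restrictPreimage
        (closure {ξ.1})).topologicalKrullDim_le
    -- the diagonal contains the closure in `V₂` of a point over the generic point of `C`
    · obtain ⟨δ, hδ, hδη⟩ := exists_mem_range_diagonal_apply_eq hU y
      have hδU : δ ∈ fiberSquareOver π U := by
        change (pullback.fst π π ≫ π) δ ∈ U
        rw [hδη]
        exact (genericPoint_specializes _).mem_open U.isOpen y.2
      rw [← hd δ hδη _ hδU]
      exact topologicalKrullDim_mono (Set.inter_subset_inter_left _
        (closure_minimal (Set.singleton_subset_iff.2 hδ) isClosed_range_diagonal))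
  have key : ∀ Z ∈ {Z ∈ irreducibleComponents (SquareOver π U) |
      Z ≠ Subtype.val ⁻¹' diagonalOver π U}, ∃ Z' ∈ {Z ∈ irreducibleComponents (fiberSquare π) |
      Z ≠ closure (diagonalOver π U) ∧
      topologicalKrullDim Z = topologicalKrullDim (diagonalOver π U)}, Subtype.val ⁻¹' Z' = Z := by
    rintro Z ⟨hZ, hZD⟩
    obtain ⟨Z', hZ', rfl⟩ := exists_preimage_eq_of_mem_irreducibleComponents _ hZ
    refine ⟨Z', ⟨hZ', ?_, ?_⟩, rfl⟩
    · rintro rfl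
      exact hZD preimage_closure_diagonalOver
    · obtain ⟨ξ, hξ⟩ := QuasiSober.sober hZ'.1 (isClosed_of_mem_irreducibleComponents _ hZ')
      obtain ⟨y, hy⟩ := hZ.1.nonempty
      have hξV : ξ ∈ fiberSquareOver π U :=
        (hξ.specializes hy).mem_open (fiberSquareOver π U).isOpen y.2
      have hξη := apply_eq_genericPoint_of_mem_genericPoints hU (ζ := ⟨ξ, hξV⟩) (by
        change closure {(⟨ξ, hξV⟩ : SquareOver π U)} ∈ irreducibleComponents (SquareOver π U)
        rw [closure_singleton_subtype, hξ.def]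
        exact hZ)
      rw [hdim y, ← hd' ξ hξη, hξ.def]
  intro Z₁ h₁ Z₂ h₂
  obtain ⟨Z₁', h₁', rfl⟩ := key Z₁ h₁
  obtain ⟨Z₂', h₂', rfl⟩ := key Z₂ h₂
  rw [h h₁' h₂']

end FiberSquareOver

end EnumerativeProblem

theorem theorem4p2 {E C : Scheme.{0}} (e : E ⟶ EnumerativeProblem.SpecC)
    (c : C ⟶ EnumerativeProblem.SpecC)
    (hE : EnumerativeProblem.IsAlgebraicSet e) (hC : EnumerativeProblem.IsAlgebraicSet c)
    (hirr : IrreducibleSpace C) (π : E ⟶ C) (hπ : π ≫ c = e)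
    (hwp : EnumerativeProblem.IsWellPosed π hπ)
    (U : C.Opens) (hsm : Smooth (U.ι ≫ c))
    (hU : EnumerativeProblem.IsCoveringOver π hπ U)
    (z : EnumerativeProblem.ComplexPoints.ofOpen c U) :
    (EnumerativeProblem.MonodromyDoublyTransitive hU z ↔
      {Z ∈ irreducibleComponents (EnumerativeProblem.fiberSquareOver π U) |
        Z ≠ Subtype.val ⁻¹' EnumerativeProblem.diagonalOver π U}.Subsingleton) ∧
    ({Z ∈ irreducibleComponents (EnumerativeProblem.fiberSquare π) |
        Z ≠ closure (EnumerativeProblem.diagonalOver π U) ∧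
        topologicalKrullDim Z =
          topologicalKrullDim (EnumerativeProblem.diagonalOver π U)}.Subsingleton →
      EnumerativeProblem.MonodromyDoublyTransitive hU z) := by
  have := hE.locallyOfFiniteType
  have := hE.quasiCompact
  have := hE.isSeparated
  have := hC.locallyOfFiniteType
  have := hC.quasiCompact
  have := hC.isSeparated
  have := hC.isReduced
  have : IsIntegral C := isIntegral_of_irreducibleSpace_of_isReduced C
  have hπc : LocallyOfFiniteType (π ≫ c) := by rwa [hπ]
  have : LocallyOfFiniteType π := locallyOfFiniteType_of_comp π c
  have hπs : IsSeparated (π ≫ c) := by rwa [hπ]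
  have : IsSeparated π := IsSeparated.of_comp π c
  have hπq : QuasiCompact (π ≫ c) := by rwa [hπ]
  have : QuasiCompact π := QuasiCompact.of_comp π c
  have hlft : LocallyOfFiniteType (pullback.fst π π ≫ e) := inferInstance
  have hqc : QuasiCompact (pullback.fst π π ≫ e) := inferInstance
  have : IsNoetherian (EnumerativeProblem.fiberSquare π) := by
    have := LocallyOfFiniteType.isLocallyNoetherian (pullback.fst π π ≫ e)
    have := QuasiCompact.compactSpace_of_compactSpace (pullback.fst π π ≫ e)
    exact {}
  have main := EnumerativeProblem.monodromyDoublyTransitive_iff hwp hU z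
  exact ⟨main, fun h => main.2 (EnumerativeProblem.subsingleton_components_of_closure hwp hU h)⟩
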